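/- Work in homotopy type theory (a universe hierarchy $U_0:U_1:\cdots$, $\Pi$-, $\Sigma$- and identity types, the usual basic types, propositional truncation $\|-\|$, function extensionality and univalence), and fix a universe $U$ of the hierarchy. Write $\mathrm{fib}_f(y):\equiv\sum_{x:X}(f(x)=y)$. A map is an equivalence if all its fibers are contractible. A higher modality $!$ on $U$ consists of an operator $!:U\to U$, units $(-)^!:X\to\,!X$, an induction principle $\mathrm{ind}:\prod_{a:A}!P(a^!)\to\prod_{u:!A}!P(u)$ for all $A:U$ and $P:\,!A\to U$ with a computation rule $\mathrm{ind}(h)(a^!)=h(a)$, and witnesses that $(-)^!:(u=v)\to\,!(u=v)$ is an equivalence for all $u,v:\,!A$. A type $X$ is modal if $(-)^!:X\to\,!X$ is an equivalence, and $U_!:\equiv\sum_{X:U}\mathrm{isModal}(X)$. For $f:X\to Y$ in $U$, let $!f:\,!X\to\,!Y$ be the induced map, with its naturality square $!f(x^!)=f(x)^!$. For $y:Y$ this square induces a map $\delta:\mathrm{fib}_f(y)\to\mathrm{fib}_{!f}(y^!)$, and $\delta$ extends uniquely along the unit of $\mathrm{fib}_f(y)$ to a map $\gamma:\,!\mathrm{fib}_f(y)\to\mathrm{fib}_{!f}(y^!)$.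 The map $f$ is a $!$-fibration if $\gamma$ is an equivalence for all $y:Y$, $!$-étale if $\delta$ is an equivalence for all $y:Y$, and $!$-connected if $!\mathrm{fib}_f(y)$ is contractible for all $y:Y$. The connected/modal factorization of $f$ is $X\to\sum_{y:Y}!\mathrm{fib}_f(y)\to Y$, with the $!$-connected factor $x\mapsto(f(x),(x,\mathrm{refl})^!)$ and the $!$-modal factor $\mathrm{fst}$. The equivalence/étale factorization of $f$ is $X\to\sum_{y:Y}\mathrm{fib}_{!f}(y^!)\to Y$, with the $!$-equivalence factor $x\mapsto(f(x),\delta(x,\mathrm{refl}))$ and the $!$-étale factor $\mathrm{fst}$. **Theorem.** The following is provable in homotopy type theory, for every universe $U$ of the hierarchy, every higher modality $!$ on $U$ and all $X,Y:U$ and $f:X\to Y$. For all $y:Y$ the map $\delta$ has exactly one extension along the unit of $\mathrm{fib}_f(y)$, namely $\gamma$, and the following are equivalent: 1. $f$ is a $!$-fibration. 2. $!$ preserves all fibers of $f$: whenever $F\to X\xrightarrow{f}Y$ is a fiber sequence over a point $y:Y$, with $F:U$, then $!F\to\,!X\xrightarrow{!f}\,!Y$ is a fiber sequence over $y^!$.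 3. $!$ preserves all pullbacks of $f$: applying $!$ to any pullback square with vertical maps $g:A\to B$ and $f:X\to Y$, where $A,B:U$, gives a pullback square with vertical maps $!g$ and $!f$. 4. The connected/modal factorization and the equivalence/étale factorization of $f$ are equal as factorizations of $f$. 5. The $!$-modal factor of $f$ is $!$-étale. 6. The $!$-equivalence factor of $f$ is $!$-connected. 7. The connecting map $\mathrm{tot}(\gamma):\sum_{y:Y}!\mathrm{fib}_f(y)\to\sum_{y:Y}\mathrm{fib}_{!f}(y^!)$, $(y,w)\mapsto(y,\gamma(w))$, is a $!$-fibration. 8. $f$ has $!$-locally constant $!$-fibers: the family $!\mathrm{fib}_f:Y\to U_!$ factors through the unit $Y\to\,!Y$, i.e. there is $E:\,!Y\to U_!$ with $E(y^!)=\,!\mathrm{fib}_f(y)$ in $U_!$ for all $y:Y$. If $f$ is surjective (every fiber is merely inhabited), these are also equivalent to: 9. For every $y:Y$ and $(x,p):\mathrm{fib}_f(y)$, the induced map $\mathrm{fib}_{(-)^!}(x^!)\to\mathrm{fib}_{(-)^!}(y^!)$ between fibers of the units of $X$ and $Y$ is $!$-connected. Moreover, if $f$ is a $!$-fibration, then so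 is every map $g:A\to B$ in $U$ that is a pullback of $f$, and if $f:X\to Y$ and $g:Y\to Z$ are $!$-fibrations, then so is $g\circ f$. -/

import Mathlib

/- Homotopy type theory as a formal system, in the style of Appendix A.1 of the HoTT Book: a
dependently typed lambda calculus with a cumulative hierarchy of universes, primitive constants
with closed types, and an untyped convertibility relation generated by beta, eta and the
computation rules of the constants. The axioms are function extensionality and univalence. -/

namespace HoTT

/-- Primitive constants. They are universe polymorphic (see `Const.type`); only the univalence
axiom records the universe that it is about. -/
inductive Const : Type
  | empty | emptyInd
  | unit | star | unitInd
  | coprod | inl | inr | coprodInd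
  | nat | zero | succ | natInd
  | sigma | pair | sigmaInd
  | ident | refl | identInd
  | trunc | truncIn | truncEq | truncRec
  | funext
  | ua (i : ℕ)

/-- Raw terms, with de Bruijn indices. `pi A B` and `lam A b` bind one variable in `B`, `b`. -/
inductive Tm : Type
  | var (n : ℕ)
  | univ (i : ℕ)
  | pi (A B : Tm)
  | lam (A b : Tm)
  | app (f a : Tm)
  | const (c : Const)

namespace Tm

def liftRen (ξ : ℕ → ℕ) : ℕ → ℕ
  | 0 => 0
  | n + 1 => ξ n + 1

def rename : (ℕ → ℕ) → Tm → Tm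
  | ξ, var n => var (ξ n)
  | _, univ i => univ i
  | ξ, pi A B => pi (rename ξ A) (rename (liftRen ξ) B)
  | ξ, lam A b => lam (rename ξ A) (rename (liftRen ξ) b)
  | ξ, app f a => app (rename ξ f) (rename ξ a)
  | _, const c => const c

/-- Weakening by one variable. -/
def wk (t : Tm) : Tm := t.rename Nat.succ

def liftSub (σ : ℕ → Tm) : ℕ → Tm
  | 0 => var 0
  | n + 1 => (σ n).wk

def subst : (ℕ → Tm) → Tm → Tm
  | σ, var n => σ n
  | _, univ i => univ i
  | σ, pi A B => pi (subst σ A) (subst (liftSub σ) B)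
  | σ, lam A b => lam (subst σ A) (subst (liftSub σ) b)
  | σ, app f a => app (subst σ f) (subst σ a)
  | _, const c => const c

def instSub (a : Tm) : ℕ → Tm
  | 0 => a
  | n + 1 => var n

/-- `b.inst a` is `b[a/x]` for the last variable `x`. -/
def inst (b a : Tm) : Tm := b.subst (instSub a)

def apps (f : Tm) (as : List Tm) : Tm := as.foldl app f

end Tm

/- A binder-friendly presentation of terms. An `Ex` gives, for every number `n` of variables in
scope, a raw term in `n` variables; binders are written with Lean functions, and a variable
that was bound when `n` variables were in scope has index `m - (n + 1)` when `m` are. -/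

structure Ex : Type where
  toTm : ℕ → Tm

namespace Ex

/-- The closed raw term. -/
def close (e : Ex) : Tm := e.toTm 0

def univ (i : ℕ) : Ex := ⟨fun _ => .univ i⟩

def const (c : Const) : Ex := ⟨fun _ => .const c⟩

def app (f a : Ex) : Ex := ⟨fun n => .app (f.toTm n) (a.toTm n)⟩

def boundVar (n : ℕ) : Ex := ⟨fun m => .var (m - (n + 1))⟩

def pi (A : Ex) (B : Ex → Ex) : Ex :=
  ⟨fun n => .pi (A.toTm n) ((B (boundVar n)).toTm (n + 1))⟩

def lam (A : Ex) (b : Ex → Ex) : Ex :=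
  ⟨fun n => .lam (A.toTm n) ((b (boundVar n)).toTm (n + 1))⟩

/-- `f a` is the application term. -/
instance : CoeFun Ex (fun _ => Ex → Ex) := ⟨app⟩

def arr (A B : Ex) : Ex := pi A fun _ => B

/- Defined notions of type theory. Types of arguments are passed explicitly. -/

/-- `Σ (x : A), B x` -/
def sig (A : Ex) (B : Ex → Ex) : Ex := const .sigma A (lam A B)

/-- `(a, b) : Σ (x : A), B x` -/
def dpair (A : Ex) (B : Ex → Ex) (a b : Ex) : Ex := const .pair A (lam A B) a b

def fst (A : Ex) (B : Ex → Ex) (p : Ex) : Ex :=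
  const .sigmaInd A (lam A B) (lam (sig A B) fun _ => A)
    (lam A fun a => lam (B a) fun _ => a) p

def snd (A : Ex) (B : Ex → Ex) (p : Ex) : Ex :=
  const .sigmaInd A (lam A B) (lam (sig A B) fun q => B (fst A B q))
    (lam A fun a => lam (B a) fun b => b) p

def prod (A B : Ex) : Ex := sig A fun _ => B

/-- Logical equivalence of types. -/
def iff (A B : Ex) : Ex := prod (arr A B) (arr B A)

/-- `x = y` in `A` -/
def eq (A x y : Ex) : Ex := const .ident A x y

def rfl (A x : Ex) : Ex := const .refl A x

/-- `f x = f y` from `p : x = y` -/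
def ap (A B f x y p : Ex) : Ex :=
  const .identInd A (lam A fun x => lam A fun y => lam (eq A x y) fun _ => eq B (f x) (f y))
    (lam A fun x => rfl B (f x)) x y p

/-- `y = x` from `p : x = y` -/
def inv (A x y p : Ex) : Ex :=
  const .identInd A (lam A fun x => lam A fun y => lam (eq A x y) fun _ => eq A y x)
    (lam A fun x => rfl A x) x y p

/-- `x = z` from `p : x = y` and `q : y = z` -/
def concat (A x y z p q : Ex) : Ex :=
  const .identInd A
    (lam A fun x => lam A fun y => lam (eq A x y) fun _ =>
      pi A fun z => arr (eq A y z) (eq A x z))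
    (lam A fun x => lam A fun z => lam (eq A x z) fun q => q) x y p z q

def isContr (A : Ex) : Ex := sig A fun a => pi A fun x => eq A a x

def isProp (A : Ex) : Ex := pi A fun x => pi A fun y => eq A x y

/-- `fib_f(y)` for `f : A → B` and `y : B` -/
def fib (A B f y : Ex) : Ex := sig A fun x => eq B (f x) y

/-- The point of `x : A` in the type `Σ (x : A), f x = y` given by `p : f x = y`. -/
def fibMk (A B f y x p : Ex) : Ex := dpair A (fun x => eq B (f x) y) x p

def fibPt (A B f y w : Ex) : Ex := fst A (fun x => eq B (f x) y) w

def fibPath (A B f y w : Ex) : Ex := snd A (fun x => eq B (f x) y) w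

def isEquiv (A B f : Ex) : Ex := pi B fun b => isContr (fib A B f b)

/-- The preimage of `b` under `f : A → B`, given `e : isEquiv f`. -/
def equivInv (A B f e b : Ex) : Ex :=
  fibPt A B f b
    (fst (fib A B f b) (fun c => pi (fib A B f b) fun w => eq (fib A B f b) c w) (e b))

def equiv (A B : Ex) : Ex := sig (arr A B) fun f => isEquiv A B f

/-- `f : A → B` is surjective: all its fibers are merely inhabited. -/
def isSurj (A B f : Ex) : Ex := pi B fun b => const .trunc (fib A B f b)

def idFun (A : Ex) : Ex := lam A fun x => x

/-- The identity map is an equivalence. -/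
def idIsEquiv (A : Ex) : Ex :=
  lam A fun b =>
    dpair (fib A A (idFun A) b)
      (fun c => pi (fib A A (idFun A) b) fun w => eq (fib A A (idFun A) b) c w)
      (fibMk A A (idFun A) b b (rfl A b))
      (lam (fib A A (idFun A) b) fun w =>
        const .sigmaInd A (lam A fun x => eq A (idFun A x) b)
          (lam (fib A A (idFun A) b) fun w =>
            eq (fib A A (idFun A) b) (fibMk A A (idFun A) b b (rfl A b)) w)
          (lam A fun x => lam (eq A (idFun A x) b) fun p =>
            const .identInd A
              (lam A fun x => lam A fun b => lam (eq A x b) fun p =>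
                eq (fib A A (idFun A) b) (fibMk A A (idFun A) b b (rfl A b))
                  (fibMk A A (idFun A) b x p))
              (lam A fun x => rfl (fib A A (idFun A) x) (fibMk A A (idFun A) x x (rfl A x)))
              x b p)
          w)

/-- `idtoeqv : (A = B) → (A ≃ B)` for `A B : U_i` -/
def idToEquiv (i : ℕ) (A B : Ex) : Ex :=
  lam (eq (univ i) A B) fun p =>
    const .identInd (univ i)
      (lam (univ i) fun A => lam (univ i) fun B => lam (eq (univ i) A B) fun _ => equiv A B)
      (lam (univ i) fun A => dpair (arr A A) (fun f => isEquiv A A f) (idFun A) (idIsEquiv A))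
      A B p

/-- `happly : (f = g) → Π (x : A), f x = g x` for `f g : Π (x : A), B x` -/
def happly (A B f g : Ex) : Ex :=
  lam (eq (pi A fun x => B x) f g) fun p =>
    const .identInd (pi A fun x => B x)
      (lam (pi A fun x => B x) fun f => lam (pi A fun x => B x) fun g =>
        lam (eq (pi A fun x => B x) f g) fun _ => pi A fun x => eq (B x) (f x) (g x))
      (lam (pi A fun x => B x) fun f => lam A fun x => rfl (B x) (f x))
      f g p

end Ex

open Ex in
/-- The types of the constants, for each universe level `i` of their parameters and `k` of the
motive of an eliminator. -/
def Const.typeEx (i k : ℕ) : Const → Ex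
  | empty => univ 0
  | emptyInd =>
      pi (arr (Ex.const empty) (univ k)) fun C => pi (Ex.const empty) fun x => C x
  | unit => univ 0
  | star => Ex.const unit
  | unitInd =>
      pi (arr (Ex.const unit) (univ k)) fun C =>
        arr (C (Ex.const star)) (pi (Ex.const unit) fun x => C x)
  | coprod => arr (univ i) (arr (univ i) (univ i))
  | inl => pi (univ i) fun A => pi (univ i) fun B => arr A (Ex.const coprod A B)
  | inr => pi (univ i) fun A => pi (univ i) fun B => arr B (Ex.const coprod A B)
  | coprodInd =>
      pi (univ i) fun A => pi (univ i) fun B =>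
        pi (arr (Ex.const coprod A B) (univ k)) fun C =>
          arr (pi A fun a => C (Ex.const inl A B a)) <|
            arr (pi B fun b => C (Ex.const inr A B b)) <|
              pi (Ex.const coprod A B) fun x => C x
  | nat => univ 0
  | zero => Ex.const nat
  | succ => arr (Ex.const nat) (Ex.const nat)
  | natInd =>
      pi (arr (Ex.const nat) (univ k)) fun C =>
        arr (C (Ex.const zero)) <|
          arr (pi (Ex.const nat) fun n => arr (C n) (C (Ex.const succ n))) <|
            pi (Ex.const nat) fun n => C n
  | sigma => pi (univ i) fun A => arr (arr A (univ i)) (univ i)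
  | pair =>
      pi (univ i) fun A => pi (arr A (univ i)) fun B =>
        pi A fun a => arr (B a) (Ex.const sigma A B)
  | sigmaInd =>
      pi (univ i) fun A => pi (arr A (univ i)) fun B =>
        pi (arr (Ex.const sigma A B) (univ k)) fun C =>
          arr (pi A fun a => pi (B a) fun b => C (Ex.const pair A B a b)) <|
            pi (Ex.const sigma A B) fun p => C p
  | ident => pi (univ i) fun A => arr A (arr A (univ i))
  | refl => pi (univ i) fun A => pi A fun x => Ex.const ident A x x
  | identInd =>
      pi (univ i) fun A =>
        pi (pi A fun x => pi A fun y => arr (Ex.const ident A x y) (univ k)) fun C =>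
          arr (pi A fun x => C x x (Ex.const refl A x)) <|
            pi A fun x => pi A fun y => pi (Ex.const ident A x y) fun p => C x y p
  | trunc => arr (univ i) (univ i)
  | truncIn => pi (univ i) fun A => arr A (Ex.const trunc A)
  | truncEq => pi (univ i) fun A => isProp (Ex.const trunc A)
  | truncRec =>
      pi (univ i) fun A => pi (univ k) fun B =>
        arr (isProp B) (arr (arr A B) (arr (Ex.const trunc A) B))
  | funext =>
      pi (univ i) fun A => pi (arr A (univ i)) fun B =>
        pi (pi A fun x => B x) fun f => pi (pi A fun x => B x) fun g =>
          isEquiv (eq (pi A fun x => B x) f g) (pi A fun x => eq (B x) (f x) (g x))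
            (happly A B f g)
  | ua j =>
      pi (univ j) fun A => pi (univ j) fun B =>
        isEquiv (eq (univ j) A B) (equiv A B) (idToEquiv j A B)

def Const.type (i k : ℕ) (c : Const) : Tm := (c.typeEx i k).close

open Tm in
/-- The computation rules. The parameters stored in a constructor are ignored: in a well-typed
term they agree with those of the eliminator. -/
inductive Compute : Tm → Tm → Prop
  | unit (C c : Tm) : Compute (apps (const .unitInd) [C, c, const .star]) c
  | inl (A B C f g A' B' a : Tm) :
      Compute (apps (const .coprodInd) [A, B, C, f, g, apps (const .inl) [A', B', a]]) (app f a)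
  | inr (A B C f g A' B' b : Tm) :
      Compute (apps (const .coprodInd) [A, B, C, f, g, apps (const .inr) [A', B', b]]) (app g b)
  | zero (C z s : Tm) : Compute (apps (const .natInd) [C, z, s, const .zero]) z
  | succ (C z s n : Tm) :
      Compute (apps (const .natInd) [C, z, s, app (const .succ) n])
        (apps s [n, apps (const .natInd) [C, z, s, n]])
  | pair (A B C g A' B' a b : Tm) :
      Compute (apps (const .sigmaInd) [A, B, C, g, apps (const .pair) [A', B', a, b]])
        (apps g [a, b])
  | refl (A C c x y A' z : Tm) :
      Compute (apps (const .identInd) [A, C, c, x, y, apps (const .refl) [A', z]]) (app c z)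
  | truncIn (A B p f A' a : Tm) :
      Compute (apps (const .truncRec) [A, B, p, f, apps (const .truncIn) [A', a]]) (app f a)

/-- Convertibility (judgmental equality). -/
inductive Conv : Tm → Tm → Prop
  | refl (a : Tm) : Conv a a
  | symm {a b : Tm} : Conv a b → Conv b a
  | trans {a b c : Tm} : Conv a b → Conv b c → Conv a c
  | pi {A A' B B' : Tm} : Conv A A' → Conv B B' → Conv (.pi A B) (.pi A' B')
  | lam {A A' b b' : Tm} : Conv A A' → Conv b b' → Conv (.lam A b) (.lam A' b')
  | app {f f' a a' : Tm} : Conv f f' → Conv a a' → Conv (.app f a) (.app f' a')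
  | beta (A b a : Tm) : Conv (.app (.lam A b) a) (b.inst a)
  | eta (A f : Tm) : Conv (.lam A (.app f.wk (.var 0))) f
  | compute {a b : Tm} : Compute a b → Conv a b

/-- `HasType Γ a A` is the judgment `Γ ⊢ a : A`. The last declared variable is the head of `Γ`.
A context is extended only by a type in it, so in a derivation that ends in the empty context
all contexts are well-formed. -/
inductive HasType : List Tm → Tm → Tm → Prop
  | var {Γ : List Tm} {n : ℕ} {A : Tm} : Γ[n]? = some A →
      HasType Γ (.var n) (A.rename fun m => m + (n + 1))
  | univ (Γ : List Tm) (i : ℕ) : HasType Γ (.univ i) (.univ (i + 1))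
  | cumul {Γ : List Tm} {A : Tm} {i : ℕ} :
      HasType Γ A (.univ i) → HasType Γ A (.univ (i + 1))
  | pi {Γ : List Tm} {A B : Tm} {i : ℕ} :
      HasType Γ A (.univ i) → HasType (A :: Γ) B (.univ i) → HasType Γ (.pi A B) (.univ i)
  | lam {Γ : List Tm} {A B b : Tm} {i : ℕ} :
      HasType Γ A (.univ i) → HasType (A :: Γ) b B → HasType Γ (.lam A b) (.pi A B)
  | app {Γ : List Tm} {A B f a : Tm} :
      HasType Γ f (.pi A B) → HasType Γ a A → HasType Γ (.app f a) (B.inst a)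
  | const (Γ : List Tm) (c : Const) (i k : ℕ) : HasType Γ (.const c) (c.type i k)
  | conv {Γ : List Tm} {a A B : Tm} {i : ℕ} :
      HasType Γ a A → Conv A B → HasType Γ B (.univ i) → HasType Γ a B

/-- A closed type is a theorem of homotopy type theory if some closed term inhabits it. -/
def Provable (T : Ex) : Prop := ∃ t : Tm, HasType [] t T.close

/- Higher modalities and the modal prism. -/

/-- The components of a higher modality on the universe `U_level`, as expressions of type theory;
`forallModality` binds variables of the types that the components have to have. -/
structure Modality : Type where
  level : ℕ
  /-- the operator `! : U → U` -/
  bang : Ex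
  /-- `unit X x` is `x^!` -/
  unit : Ex
  ind : Ex
  comp : Ex
  /-- identity types of types of the form `!A` are modal -/
  idModal : Ex

namespace Modality

open Ex

/-- `T M` for every higher modality `M` on the universe `U_i`. -/
def forallModality (i : ℕ) (T : Modality → Ex) : Ex :=
  pi (arr (univ i) (univ i)) fun bang =>
  pi (pi (univ i) fun X => arr X (bang X)) fun unit =>
  pi (pi (univ i) fun A => pi (arr (bang A) (univ i)) fun P =>
      arr (pi A fun a => bang (P (unit A a))) (pi (bang A) fun u => bang (P u))) fun ind =>
  pi (pi (univ i) fun A => pi (arr (bang A) (univ i)) fun P =>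
      pi (pi A fun a => bang (P (unit A a))) fun f => pi A fun a =>
        eq (bang (P (unit A a))) (ind A P f (unit A a)) (f a)) fun comp =>
  pi (pi (univ i) fun A => pi (bang A) fun u => pi (bang A) fun v =>
      isEquiv (eq (bang A) u v) (bang (eq (bang A) u v)) (unit (eq (bang A) u v))) fun idModal =>
  T ⟨i, bang, unit, ind, comp, idModal⟩

variable (M : Modality)

/-- The universe that `!` acts on. -/
def U : Ex := univ M.level

def isModal (X : Ex) : Ex := isEquiv X (M.bang X) (M.unit X)

/-- The universe of modal types. -/
def modalUniv : Ex := sig M.U fun X => M.isModal X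

/- The longer constructions below are functions of the type theory itself, applied to their
arguments; `M.lamMap b` is `λ (X Y : U) (f : X → Y), b X Y f`. -/

def lamMap (b : Ex → Ex → Ex → Ex) : Ex :=
  lam M.U fun X => lam M.U fun Y => lam (arr X Y) fun f => b X Y f

/-- `!f : !X → !Y` for `f : X → Y` -/
def map (X Y f : Ex) : Ex :=
  (M.lamMap fun X Y f =>
    M.ind X (lam (M.bang X) fun _ => Y) (lam X fun x => M.unit Y (f x))) X Y f

/-- The naturality square `!f (x^!) = (f x)^!` -/
def nat (X Y f x : Ex) : Ex :=
  (M.lamMap fun X Y f => lam X fun x =>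
    M.comp X (lam (M.bang X) fun _ => Y) (lam X fun x => M.unit Y (f x)) x) X Y f x

/-- `ap (-)^! p : x^! = y^!` for `p : x = y` in `X` -/
def apUnit (X x y p : Ex) : Ex := ap X (M.bang X) (M.unit X) x y p

/-- `ap !f p : !f u = !f v` for `f : X → Y` and `p : u = v` in `!X` -/
def apMap (X Y f u v p : Ex) : Ex := ap (M.bang X) (M.bang Y) (M.map X Y f) u v p

/-- `δ : fib_f(y) → fib_{!f}(y^!)`, `δ(x, p) = (x^!, nat · ap (-)^! p)` -/
def delta (X Y f y : Ex) : Ex :=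
  (M.lamMap fun X Y f => lam Y fun y => lam (fib X Y f y) fun w =>
    let x := fibPt X Y f y w
    let p := fibPath X Y f y w
    fibMk (M.bang X) (M.bang Y) (M.map X Y f) (M.unit Y y) (M.unit X x)
      (concat (M.bang Y) (M.map X Y f (M.unit X x)) (M.unit Y (f x)) (M.unit Y y)
        (M.nat X Y f x) (M.apUnit Y (f x) y p))) X Y f y

/-- The map `!T → T` inverse to the unit, for `e : isModal T`. -/
def modalRetract (T e z : Ex) : Ex :=
  (lam M.U fun T => lam (M.isModal T) fun e => lam (M.bang T) fun z =>
    equivInv T (M.bang T) (M.unit T) e z) T e z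

/-- For `p q : !A → !Y` and `base : Π (a : A), p (a^!) = q (a^!)`, the induced
`Π (u : !A), p u = q u`. It comes from `!`-induction, as the identity types of `!Y` are modal. -/
def extendPath (A Y p q base : Ex) : Ex :=
  (lam M.U fun A => lam M.U fun Y =>
    lam (arr (M.bang A) (M.bang Y)) fun p => lam (arr (M.bang A) (M.bang Y)) fun q =>
    lam (pi A fun a => eq (M.bang Y) (p (M.unit A a)) (q (M.unit A a))) fun base =>
    lam (M.bang A) fun u =>
      M.modalRetract (eq (M.bang Y) (p u) (q u)) (M.idModal Y (p u) (q u))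
        (M.ind A (lam (M.bang A) fun u => eq (M.bang Y) (p u) (q u))
          (lam A fun a =>
            M.unit (eq (M.bang Y) (p (M.unit A a)) (q (M.unit A a))) (base a)) u))
    A Y p q base

/-- The map `F → fib_f(y)` induced by `F --j--> X --f--> Y` and `H t : f (j t) = y`. -/
def fiberGap (F X Y j f y H : Ex) : Ex := lam F fun t => fibMk X Y f y (j t) (H t)

/-- The map `!F → fib_{!f}(y^!)` induced by `!F --!j--> !X --!f--> !Y` and the extension to `!F`
of the identifications `!f (!j (t^!)) = !f ((j t)^!) = (f (j t))^! = y^!`. -/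
def bangFiberGap (F X Y j f y H : Ex) : Ex :=
  (lam M.U fun F => lam M.U fun X => lam M.U fun Y => lam (arr F X) fun j =>
    lam (arr X Y) fun f => lam Y fun y => lam (pi F fun t => eq Y (f (j t)) y) fun H =>
    lam (M.bang F) fun u =>
      fibMk (M.bang X) (M.bang Y) (M.map X Y f) (M.unit Y y) (M.map F X j u)
        (M.extendPath F Y (lam (M.bang F) fun u => M.map X Y f (M.map F X j u))
          (lam (M.bang F) fun _ => M.unit Y y)
          (lam F fun t =>
            let v0 := M.map X Y f (M.map F X j (M.unit F t))
            let v1 := M.map X Y f (M.unit X (j t))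
            let v2 := M.unit Y (f (j t))
            let v3 := M.unit Y y
            concat (M.bang Y) v0 v1 v3
              (M.apMap X Y f (M.map F X j (M.unit F t)) (M.unit X (j t)) (M.nat F X j t)) <|
            concat (M.bang Y) v1 v2 v3 (M.nat X Y f (j t)) <|
            M.apUnit Y (f (j t)) y (H t)) u))
    F X Y j f y H

/-- `γ : !fib_f(y) → fib_{!f}(y^!)` -/
def gamma (X Y f y : Ex) : Ex :=
  (M.lamMap fun X Y f => lam Y fun y =>
    M.bangFiberGap (fib X Y f y) X Y (lam (fib X Y f y) fun w => fibPt X Y f y w) f y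
      (lam (fib X Y f y) fun w => fibPath X Y f y w)) X Y f y

/-- `fib_{!f}(y^!)` -/
def bangFib (X Y f y : Ex) : Ex := fib (M.bang X) (M.bang Y) (M.map X Y f) (M.unit Y y)

/-- The modal prism: `γ` extends `δ` along the modal unit, and it is the only such map. -/
def prism (X Y f : Ex) : Ex :=
  pi Y fun y =>
    prod
      (pi (fib X Y f y) fun w =>
        eq (M.bangFib X Y f y) (M.gamma X Y f y (M.unit (fib X Y f y) w)) (M.delta X Y f y w))
      (isContr (sig (arr (M.bang (fib X Y f y)) (M.bangFib X Y f y)) fun h =>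
        pi (fib X Y f y) fun w =>
          eq (M.bangFib X Y f y) (h (M.unit (fib X Y f y) w)) (M.delta X Y f y w)))

/- Classes of maps `f : X → Y`. -/

/-- All types `!fib_f(y)` are contractible. -/
def isConnectedMap (X Y f : Ex) : Ex :=
  (M.lamMap fun X Y f => pi Y fun y => isContr (M.bang (fib X Y f y))) X Y f

/-- All maps `δ` are equivalences. -/
def isEtale (X Y f : Ex) : Ex :=
  (M.lamMap fun X Y f =>
    pi Y fun y => isEquiv (fib X Y f y) (M.bangFib X Y f y) (M.delta X Y f y)) X Y f

/-- All maps `γ` are equivalences. -/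
def isFibration (X Y f : Ex) : Ex :=
  (M.lamMap fun X Y f =>
    pi Y fun y => isEquiv (M.bang (fib X Y f y)) (M.bangFib X Y f y) (M.gamma X Y f y)) X Y f

/-- `!` preserves all fibers of `f`: whenever `F → X → Y` is a fiber sequence over `y : Y`,
so is `!F → !X → !Y` over `y^!`. -/
def preservesFibers (X Y f : Ex) : Ex :=
  pi Y fun y => pi M.U fun F => pi (arr F X) fun j =>
    pi (pi F fun t => eq Y (f (j t)) y) fun H =>
      arr (isEquiv F (fib X Y f y) (fiberGap F X Y j f y H))
        (isEquiv (M.bang F) (M.bangFib X Y f y) (M.bangFiberGap F X Y j f y H))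

end Modality

/-- A commutative square with `g : A → B`, `x : A → X`, `y : B → Y`, `f : X → Y` and
`H a : f (x a) = y (g a)`. -/
structure Square : Type where
  (A B X Y g x y f H : Ex)

namespace Square

open Ex

/-- The type `Σ (b : B) (z : X), f z = y b`. -/
def pullback (S : Square) : Ex := sig S.B fun b => sig S.X fun z => eq S.Y (S.f z) (S.y b)

/-- The induced map from `A` to the pullback. -/
def gap (S : Square) : Ex :=
  lam S.A fun a =>
    dpair S.B (fun b => sig S.X fun z => eq S.Y (S.f z) (S.y b)) (S.g a)
      (dpair S.X (fun z => eq S.Y (S.f z) (S.y (S.g a))) (S.x a) (S.H a))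

def isPullback (S : Square) : Ex := isEquiv S.A S.pullback S.gap

/-- `T S` for all commutative squares `S` of types in `U_i` with right-hand side `f : X → Y`. -/
def forallSquares (i : ℕ) (X Y f : Ex) (T : Square → Ex) : Ex :=
  pi (univ i) fun A => pi (univ i) fun B =>
    pi (arr A B) fun g => pi (arr A X) fun x => pi (arr B Y) fun y =>
      pi (pi A fun a => eq Y (f (x a)) (y (g a))) fun H => T ⟨A, B, X, Y, g, x, y, f, H⟩

/-- The identification `!f (!x (a^!)) = !f ((x a)^!) = (f (x a))^! = (y (g a))^! = !y ((g a)^!)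
= !y (!g (a^!))`. -/
def bangBase (M : Modality) (S : Square) (a : Ex) : Ex :=
  let v0 := M.map S.X S.Y S.f (M.map S.A S.X S.x (M.unit S.A a))
  let v1 := M.map S.X S.Y S.f (M.unit S.X (S.x a))
  let v2 := M.unit S.Y (S.f (S.x a))
  let v3 := M.unit S.Y (S.y (S.g a))
  let v4 := M.map S.B S.Y S.y (M.unit S.B (S.g a))
  let v5 := M.map S.B S.Y S.y (M.map S.A S.B S.g (M.unit S.A a))
  concat (M.bang S.Y) v0 v1 v5
    (M.apMap S.X S.Y S.f (M.map S.A S.X S.x (M.unit S.A a)) (M.unit S.X (S.x a))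
      (M.nat S.A S.X S.x a)) <|
  concat (M.bang S.Y) v1 v2 v5 (M.nat S.X S.Y S.f (S.x a)) <|
  concat (M.bang S.Y) v2 v3 v5 (M.apUnit S.Y (S.f (S.x a)) (S.y (S.g a)) (S.H a)) <|
  concat (M.bang S.Y) v3 v4 v5 (inv (M.bang S.Y) v4 v3 (M.nat S.B S.Y S.y (S.g a))) <|
  M.apMap S.B S.Y S.y (M.unit S.B (S.g a)) (M.map S.A S.B S.g (M.unit S.A a))
    (inv (M.bang S.B) (M.map S.A S.B S.g (M.unit S.A a)) (M.unit S.B (S.g a))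
      (M.nat S.A S.B S.g a))

/-- The square `!S`. -/
def bang (M : Modality) (S : Square) : Square where
  A := M.bang S.A
  B := M.bang S.B
  X := M.bang S.X
  Y := M.bang S.Y
  g := M.map S.A S.B S.g
  x := M.map S.A S.X S.x
  y := M.map S.B S.Y S.y
  f := M.map S.X S.Y S.f
  H := M.extendPath S.A S.Y
    (lam (M.bang S.A) fun u => M.map S.X S.Y S.f (M.map S.A S.X S.x u))
    (lam (M.bang S.A) fun u => M.map S.B S.Y S.y (M.map S.A S.B S.g u))
    (lam S.A fun a => bangBase M S a)

end Square

namespace Modality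

open Ex

variable (M : Modality)

/-- `!` preserves all pullbacks of `f`. -/
def preservesPullbacks (X Y f : Ex) : Ex :=
  Square.forallSquares M.level X Y f fun S => arr S.isPullback (S.bang M).isPullback

/-- If `f` is a `!`-fibration, so is every pullback `g` of `f`. -/
def pullbacksAreFibrations (X Y f : Ex) : Ex :=
  arr (M.isFibration X Y f) <|
    Square.forallSquares M.level X Y f fun S => arr S.isPullback (M.isFibration S.A S.B S.g)

/- The two factorizations of `f : X → Y`. -/

/-- The type of factorizations `X --l--> Z --r--> Y` of `f`. -/
def factorization (X Y f : Ex) : Ex :=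
  sig M.U fun Z => sig (arr X Z) fun l => sig (arr Z Y) fun r =>
    pi X fun x => eq Y (r (l x)) (f x)

def factorizationMk (X Y f Z l r h : Ex) : Ex :=
  dpair M.U (fun Z => sig (arr X Z) fun l => sig (arr Z Y) fun r =>
    pi X fun x => eq Y (r (l x)) (f x)) Z <|
  dpair (arr X Z) (fun l => sig (arr Z Y) fun r => pi X fun x => eq Y (r (l x)) (f x)) l <|
  dpair (arr Z Y) (fun r => pi X fun x => eq Y (r (l x)) (f x)) r h

/-- `Σ (y : Y), !fib_f(y)` -/
def modalMid (X Y f : Ex) : Ex := sig Y fun y => M.bang (fib X Y f y)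

/-- The `!`-connected factor `x ↦ (f x, (x, refl)^!)`. -/
def connectedFactor (X Y f : Ex) : Ex :=
  lam X fun x =>
    dpair Y (fun y => M.bang (fib X Y f y)) (f x)
      (M.unit (fib X Y f (f x)) (fibMk X Y f (f x) x (rfl Y (f x))))

/-- The `!`-modal factor `(y, w) ↦ y`. -/
def modalFactor (X Y f : Ex) : Ex :=
  lam (M.modalMid X Y f) fun z => fst Y (fun y => M.bang (fib X Y f y)) z

/-- `Σ (y : Y), fib_{!f}(y^!)` -/
def etaleMid (X Y f : Ex) : Ex := sig Y fun y => M.bangFib X Y f y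

/-- The `!`-equivalence factor `x ↦ (f x, δ (x, refl))`. -/
def equivalenceFactor (X Y f : Ex) : Ex :=
  lam X fun x =>
    dpair Y (fun y => M.bangFib X Y f y) (f x)
      (M.delta X Y f (f x) (fibMk X Y f (f x) x (rfl Y (f x))))

/-- The `!`-étale factor `(y, w) ↦ y`. -/
def etaleFactor (X Y f : Ex) : Ex :=
  lam (M.etaleMid X Y f) fun z => fst Y (fun y => M.bangFib X Y f y) z

def connectedModalFactorization (X Y f : Ex) : Ex :=
  M.factorizationMk X Y f (M.modalMid X Y f) (M.connectedFactor X Y f) (M.modalFactor X Y f)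
    (lam X fun x => rfl Y (f x))

def equivalenceEtaleFactorization (X Y f : Ex) : Ex :=
  M.factorizationMk X Y f (M.etaleMid X Y f) (M.equivalenceFactor X Y f) (M.etaleFactor X Y f)
    (lam X fun x => rfl Y (f x))

def factorizationsAgree (X Y f : Ex) : Ex :=
  eq (M.factorization X Y f) (M.connectedModalFactorization X Y f)
    (M.equivalenceEtaleFactorization X Y f)

def modalFactorIsEtale (X Y f : Ex) : Ex :=
  M.isEtale (M.modalMid X Y f) Y (M.modalFactor X Y f)

def equivalenceFactorIsConnected (X Y f : Ex) : Ex :=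
  M.isConnectedMap X (M.etaleMid X Y f) (M.equivalenceFactor X Y f)

/-- `tot(γ) : (y, w) ↦ (y, γ w)` -/
def totGamma (X Y f : Ex) : Ex :=
  lam (M.modalMid X Y f) fun z =>
    dpair Y (fun y => M.bangFib X Y f y) (fst Y (fun y => M.bang (fib X Y f y)) z)
      (M.gamma X Y f (fst Y (fun y => M.bang (fib X Y f y)) z)
        (snd Y (fun y => M.bang (fib X Y f y)) z))

def totGammaIsFibration (X Y f : Ex) : Ex :=
  M.isFibration (M.modalMid X Y f) (M.etaleMid X Y f) (M.totGamma X Y f)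

/-- `! ∘ fib_f : Y → U_!` factors through the unit `Y → !Y`: for the map `! : U → U_!` that is
given by a proof `m` that the types `!Z` are modal, there are `E : !Y → U_!` and
identifications `E (y^!) = (!fib_f(y), m)` in `U_!`. -/
def locallyConstantFibers (X Y f : Ex) : Ex :=
  sig (pi M.U fun Z => M.isModal (M.bang Z)) fun m =>
    sig (arr (M.bang Y) M.modalUniv) fun E =>
      pi Y fun y => eq M.modalUniv (E (M.unit Y y))
        (dpair M.U (fun X => M.isModal X) (M.bang (fib X Y f y)) (m (fib X Y f y)))

/-- The map `fib_{(-)^!}(x^!) → fib_{(-)^!}(y^!)` induced by `f` and `p : f x = y`: it sends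
`(x', q)` to `f x'` with `(f x')^! = !f (x'^!) = !f (x^!) = (f x)^! = y^!`. -/
def unitFiberMap (X Y f y x p : Ex) : Ex :=
  (M.lamMap fun X Y f => lam Y fun y => lam X fun x => lam (eq Y (f x) y) fun p =>
    lam (fib X (M.bang X) (M.unit X) (M.unit X x)) fun w =>
      let x' := fibPt X (M.bang X) (M.unit X) (M.unit X x) w
      let q := fibPath X (M.bang X) (M.unit X) (M.unit X x) w
      let v0 := M.unit Y (f x')
      let v1 := M.map X Y f (M.unit X x')
      let v2 := M.map X Y f (M.unit X x)
      let v3 := M.unit Y (f x)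
      let v4 := M.unit Y y
      fibMk Y (M.bang Y) (M.unit Y) (M.unit Y y) (f x') <|
        concat (M.bang Y) v0 v1 v4 (inv (M.bang Y) v1 v0 (M.nat X Y f x')) <|
        concat (M.bang Y) v1 v2 v4 (M.apMap X Y f (M.unit X x') (M.unit X x) q) <|
        concat (M.bang Y) v2 v3 v4 (M.nat X Y f x) <|
        M.apUnit Y (f x) y p)
    X Y f y x p

/-- For all `y : Y` and `(x, p) : fib_f(y)` the induced map
`fib_{(-)^!}(x^!) → fib_{(-)^!}(y^!)` is `!`-connected. -/
def unitFiberMapsConnected (X Y f : Ex) : Ex :=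
  pi Y fun y => pi (fib X Y f y) fun w =>
    M.isConnectedMap
      (fib X (M.bang X) (M.unit X) (M.unit X (fibPt X Y f y w)))
      (fib Y (M.bang Y) (M.unit Y) (M.unit Y y))
      (M.unitFiberMap X Y f y (fibPt X Y f y w) (fibPath X Y f y w))

/-- For all `g : Y → Z`: if `f` and `g` are `!`-fibrations, so is `g ∘ f`. -/
def compositesAreFibrations (X Y f : Ex) : Ex :=
  pi M.U fun Z => pi (arr Y Z) fun g =>
    arr (M.isFibration X Y f) <| arr (M.isFibration Y Z g) <|
      M.isFibration X Z (lam X fun x => g (f x))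

/-- It is a theorem of homotopy type theory that `T M X Y f` holds for every higher modality `M`
on the universe `U_i` and every map `f : X → Y` of types in `U_i`. -/
def HoldsForAllMaps (i : ℕ) (T : Modality → Ex → Ex → Ex → Ex) : Prop :=
  Provable <| forallModality i fun M =>
    pi (univ i) fun X => pi (univ i) fun Y => pi (arr X Y) fun f => T M X Y f

end Modality

end HoTT

set_option linter.unusedVariables false

/-! ### Evaluator and type checker -/

namespace HoTT

/-! The theorem asserts derivability, so the proof has to produce terms of the formal type theory. A
bidirectional type checker is written as a Lean function and proved sound once (`Tm.tc_sound`).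
Every internal lemma is a pair of a type and a term, which the kernel checks by evaluating the
checker. The lemma is then added to the context as a variable: later proofs can use it, but
convertibility never unfolds it. Substituting the terms back shows that such an extension proves
nothing new (`Conservative`). All internal work takes place over a generic modality on `univ 0`.
Raising all universe levels of a finished derivation (`HasType.shift`) gives the statement for every
universe.

The mathematics is organized around localizations, that is, maps `m : A → T` that exhibit `T` as
`!A` (`loc`). By univalence and function extensionality a localization may be replaced by the unit
`A → !A` (`locInd`), so all properties of localizations are checked for units only. Since `γ`
extends `δ` (`gammaBeta`), `f` is a fibration exactly if all maps `δ` are localizations. The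
extension of `x ↦ (f x)^!` to `!X` is unique, so `δ` may be computed, up to equivalence, with any
localization `X → T` and any map `T → !Y` in place of the unit and `!f` (`deltaInvariance`).

The main criterion is `fibOfFamily`. Suppose that `E` is a family of modal types over `!Y` and that
the maps `fib_f(y) → E (y^!)` are localizations. Then `X → Σ (v : !Y), E v` is a localization
(`totSigUnit`), so the first projection of this Σ-type plays the role of `!f`. Its fiber over `y^!`
is `E (y^!)`, and therefore `f` is a fibration. This yields the criterion by locally constant fibers
and the stability under pullback. The analogous statement over an arbitrary localization of the base
(`totSig`) handles composites.

Pullbacks of `f` have the fibers of `f`, so for a fibration the gap map of the image square extends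
a localization and is an equivalence; conversely each fiber is itself a pullback. For the
factorizations one uses that a connected map into a modal type is a localization (`locOfConn`), and
that the map `X → Σ (y : Y), Q y` induced by maps `d : fib_f(y) → Q y` has the fibers of these maps
(`fibTot`). The equivalence factor also becomes a localization when followed by the unit
(`equivalenceFactorLoc`), whence `!tot(γ)` is an equivalence; so if `tot(γ)` is a fibration, its
fibers are connected, and the fibers of `γ`, modal retracts of these, are contractible. Finally, `Σ
(y : Y), fib_{!f}(y^!)` can be read as a Σ-type over `!X`. Connectedness of the equivalence factor
thereby becomes connectedness of maps between fibers of units. This is a modal condition on the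
point of `!X`, hence need only be tested at points `x^!`. -/

noncomputable def Const.code (c : Const) : ℕ :=
  -- The numbering is the order of declaration. In the numerals below, 13, 14, 15 are `sigma`,
  -- `pair`, `sigmaInd`, then 16, 17, 18 are `ident`, `refl`, `identInd`; 19 is `trunc`, 23 is
  -- `funext`, and 24 is `ua 0`.
  Const.rec (motive := fun _ => ℕ) 0 1 2 3 4 5 6 7 8 9 10 11 12 13 14 15 16 17 18 19 20 21 22 23
    (fun i => i.add 24) c

/-! The functions are defined by recursors, which the kernel evaluates fast. -/

namespace Tm
noncomputable section

def ifVar {α : Type} (t : Tm) (d : Unit → α) (k : ℕ → α) : α :=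
  Tm.rec (motive := fun _ => α) k (fun _ => d ()) (fun _ _ _ _ => d ()) (fun _ _ _ _ => d ())
    (fun _ _ _ _ => d ()) (fun _ => d ()) t
def ifUniv {α : Type} (t : Tm) (d : Unit → α) (k : ℕ → α) : α :=
  Tm.rec (motive := fun _ => α) (fun _ => d ()) k (fun _ _ _ _ => d ()) (fun _ _ _ _ => d ())
    (fun _ _ _ _ => d ()) (fun _ => d ()) t
def ifPi {α : Type} (t : Tm) (d : Unit → α) (k : Tm → Tm → α) : α :=
  Tm.rec (motive := fun _ => α) (fun _ => d ()) (fun _ => d ()) (fun A B _ _ => k A B)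
    (fun _ _ _ _ => d ()) (fun _ _ _ _ => d ()) (fun _ => d ()) t
def ifLam {α : Type} (t : Tm) (d : Unit → α) (k : Tm → Tm → α) : α :=
  Tm.rec (motive := fun _ => α) (fun _ => d ()) (fun _ => d ()) (fun _ _ _ _ => d ())
    (fun A b _ _ => k A b) (fun _ _ _ _ => d ()) (fun _ => d ()) t
def ifApp {α : Type} (t : Tm) (d : Unit → α) (k : Tm → Tm → α) : α :=
  Tm.rec (motive := fun _ => α) (fun _ => d ()) (fun _ => d ()) (fun _ _ _ _ => d ())
    (fun _ _ _ _ => d ()) (fun f a _ _ => k f a) (fun _ => d ()) t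
def isConst (c : ℕ) (t : Tm) : Bool :=
  Tm.rec (motive := fun _ => Bool) (fun _ => false) (fun _ => false) (fun _ _ _ _ => false)
    (fun _ _ _ _ => false) (fun _ _ _ _ => false) (fun c' => c.beq c'.code) t
def ifCons {α : Type} (l : List Tm) (d : α) (k : Tm → List Tm → α) : α :=
  List.rec (motive := fun _ => α) d (fun a l _ => k a l) l

def beq (t : Tm) : Tm → Bool :=
  Tm.rec (motive := fun _ => Tm → Bool) (fun n u => ifVar u (fun _ => false) fun m => n.beq m)
    (fun n u => ifUniv u (fun _ => false) fun m => n.beq m)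
    (fun _ _ A B u => ifPi u (fun _ => false) fun A' B' => and (A A') (B B'))
    (fun _ _ A B u => ifLam u (fun _ => false) fun A' B' => and (A A') (B B'))
    (fun _ _ A B u => ifApp u (fun _ => false) fun A' B' => and (A A') (B B'))
    (fun c u => isConst c.code u) t

/-- Adds `d` to the indices from `c` on. -/
def lift (d : ℕ) (t : Tm) : ℕ → Tm :=
  Tm.rec (motive := fun _ => ℕ → Tm) (fun n c => var (bif n.blt c then n else n.add d))
    (fun i _ => univ i) (fun _ _ A B c => pi (A c) (B c.succ)) (fun _ _ A b c => lam (A c) (b c.succ))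
    (fun _ _ f a c => app (f c) (a c)) (fun c _ => const c) t

/-- Entry `n` is weakened by the `k` binders under which it is inserted. Indices past the end drop
by the length of the environment. -/
def envVar (as : List Tm) : ℕ → ℕ → Tm :=
  List.rec (motive := fun _ => ℕ → ℕ → Tm) (fun n k => var (n.add k))
    (fun a _ r n k => Nat.rec (motive := fun _ => Tm) (lift k a 0) (fun m _ => r m k) n) as

def msub (as : List Tm) (t : Tm) : ℕ → Tm :=
  Tm.rec (motive := fun _ => ℕ → Tm) (fun n k => bif n.blt k then var n else envVar as (n.sub k) k)
    (fun i _ => univ i) (fun _ _ A B c => pi (A c) (B c.succ)) (fun _ _ A b c => lam (A c) (b c.succ))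
    (fun _ _ f a c => app (f c) (a c)) (fun c _ => const c) t

/-- The empty environment is the identity substitution, for which the term is not traversed. -/
def esub (as : List Tm) (k : ℕ) (t : Tm) : Tm := ifCons as t fun _ _ => msub as t k

abbrev Stack := List Tm

def lookEnv (as : List Tm) (n : ℕ) (h : Tm → Tm × Stack) (k : ℕ → Tm × Stack) : Tm × Stack :=
  List.rec (motive := fun _ => ℕ → Tm × Stack) k
    (fun a _ r n => Nat.rec (motive := fun _ => Tm × Stack) (h a) (fun m _ => r m) n) as n

/-- The arguments are a delayed substitution for the variables of the term, the term, and the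
arguments to which it is applied. The result is a head with its arguments, in which no substitution
is pending. -/
abbrev Machine := List Tm → Tm → Stack → Tm × Stack

def whLam (rec : Machine) (as : List Tm) (A b : Tm) (st : Stack) : Tm × Stack :=
  ifCons st (lam (esub as 0 A) (esub as 1 b), []) fun a st => rec (a :: as) b st

/-- A scrutinee that does not evaluate to a fully applied pair leaves the eliminator stuck, and `d`
is returned. -/
def whPair (rec : Machine) (g : Tm) (rest : Stack) (d r : Tm × Stack) : Tm × Stack :=
  bif isConst 14 r.1 then
    ifCons r.2 d fun _ l => ifCons l d fun _ l => ifCons l d fun a l => ifCons l d fun b l =>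
      bif l.isEmpty then rec [] g (a :: b :: rest) else d
  else d

def whRefl (rec : Machine) (g : Tm) (rest : Stack) (d r : Tm × Stack) : Tm × Stack :=
  bif isConst 17 r.1 then
    ifCons r.2 d fun _ l => ifCons l d fun a l => bif l.isEmpty then rec [] g (a :: rest) else d
  else d

def whSigma (rec : Machine) (d : Tm × Stack) (st : Stack) : Tm × Stack :=
  ifCons st d fun _ l => ifCons l d fun _ l => ifCons l d fun _ l => ifCons l d fun g l =>
    ifCons l d fun p rest => whPair rec g rest d (rec [] p [])

def whIdent (rec : Machine) (d : Tm × Stack) (st : Stack) : Tm × Stack :=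
  ifCons st d fun _ l => ifCons l d fun _ l => ifCons l d fun g l => ifCons l d fun _ l =>
    ifCons l d fun _ l => ifCons l d fun p rest => whRefl rec g rest d (rec [] p [])

/-- Only the eliminators of Σ-types and identity types compute; the internal proofs need no other
rule. -/
def whConst (rec : Machine) (c : Const) (st : Stack) : Tm × Stack :=
  bif c.code.beq 15 then whSigma rec (const c, st) st
  else bif c.code.beq 18 then whIdent rec (const c, st) st
  else (const c, st)

def whStep (rec : Machine) (as : List Tm) (t : Tm) (st : Stack) : Tm × Stack :=
  Tm.rec (motive := fun _ => Tm × Stack) (fun n => lookEnv as n (fun a => rec [] a st) fun m => (var m, st))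
    (fun i => (univ i, st)) (fun A B _ _ => (pi (esub as 0 A) (esub as 1 B), st))
    (fun A b _ _ => whLam rec as A b st) (fun f a _ _ => rec as f (esub as 0 a :: st))
    (fun c => whConst rec c st) t

/-- `F` is fuel. When it runs out the delayed substitution is carried out and evaluation stops; the
result is still convertible to the input. -/
def wh (F : ℕ) : Machine :=
  Nat.rec (motive := fun _ => Machine) (fun as t st => (esub as 0 t, st))
    (fun _ r as t st => whStep r as t st) F

def convArgs (cv : Tm → Tm → Bool) (as : List Tm) : List Tm → Bool :=
  List.rec (motive := fun _ => List Tm → Bool) (fun l => ifCons l true fun _ _ => false)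
    (fun a _ r l => ifCons l false fun b bs => and (cv a b) (r bs)) as

def convEta (cv : Tm → Tm → Bool) (b h : Tm) (st : List Tm) : Bool :=
  cv b (app (lift 1 (apps h st) 0) (var 0))

/-- The annotations of two abstractions are not compared, which `Conv.lam_annotation` justifies. -/
def convLam (cv : Tm → Tm → Bool) (b : Tm) (st : List Tm) (h' : Tm) (st' : List Tm) : Bool :=
  and st.isEmpty (ifLam h' (fun _ => convEta cv b h' st') fun _ b' => and st'.isEmpty (cv b b'))

def convNe (cv : Tm → Tm → Bool) (h : Tm) (st : List Tm) (h' : Tm) (st' : List Tm) : Bool :=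
  ifLam h' (fun _ => and (beq h h') (convArgs cv st st')) fun _ b' => and st'.isEmpty (convEta cv b' h st)

def convPi (cv : Tm → Tm → Bool) (A B : Tm) (st : List Tm) (h' : Tm) (st' : List Tm) : Bool :=
  ifPi h' (fun _ => false) fun A' B' => and (cv A A') (and (cv B B') (convArgs cv st st'))

def convWh (cv : Tm → Tm → Bool) (r r' : Tm × List Tm) : Bool :=
  ifLam r.1 (fun _ => ifPi r.1 (fun _ => convNe cv r.1 r.2 r'.1 r'.2) fun A B => convPi cv A B r.2 r'.1 r'.2)
    fun _ b => convLam cv b r.2 r'.1 r'.2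

/-- The syntactic test comes first, so that identical terms are not evaluated. -/
def conv (F : ℕ) : Tm → Tm → Bool :=
  Nat.rec (motive := fun _ => Tm → Tm → Bool) (fun _ _ => false)
    (fun F r t u => or (beq t u) (convWh r (wh F [] t []) (wh F [] u []))) F

def look (Γ : List Tm) : ℕ → Option Tm :=
  List.rec (motive := fun _ => ℕ → Option Tm) (fun _ => none)
    (fun A _ r n => Nat.rec (motive := fun _ => Option Tm) (some A) (fun m _ => r m) n) Γ

/-- Lemmas quantify over types in `univ 2` and over predicates with values in `univ 2`, which
themselves form types in `univ 3`. One level for all constants therefore suffices. -/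
def constLevel : ℕ := 3

/-- An inferred type comes with a pending substitution. Along an iterated application only the list
grows; the codomain is instantiated when the type is needed. -/
abbrev Result := Option (List Tm × Tm)

def andThen {α β : Type} (o : Option α) (k : α → Option β) : Option β :=
  Option.rec (motive := fun _ => Option β) none k o

/-- `tc allow F Γ t none` infers a type, `tc allow F Γ t (some T)` checks against `T`. -/
abbrev Checker := List Tm → Tm → Option Tm → Result

def univLevel (r : Tm × List Tm) : Option ℕ :=
  ifUniv r.1 (fun _ => none) fun i => ifCons r.2 (some i) fun _ _ => none

def sortOf (F : ℕ) (rec : Checker) (Γ : List Tm) (A : Tm) : Option ℕ :=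
  andThen (rec Γ A none) fun S => univLevel (wh F S.1 S.2 [])

def piMax (i j : ℕ) : Result := some ([], univ (bif i.ble j then j else i))

def tcVar (n : ℕ) (A : Option Tm) : Result := andThen A fun A => some ([], lift n.succ A 0)

def tcPi (F : ℕ) (rec : Checker) (Γ : List Tm) (A B : Tm) : Result :=
  andThen (sortOf F rec Γ A) fun i => andThen (sortOf F rec (A :: Γ) B) fun j => piMax i j

def tcLam (F : ℕ) (rec : Checker) (Γ : List Tm) (A b : Tm) : Result :=
  andThen (sortOf F rec Γ A) fun _ => andThen (rec (A :: Γ) b none) fun S =>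
    some ([], pi A (esub S.1 0 S.2))

def tcIdent (F : ℕ) (rec : Checker) (Γ : List Tm) (A x y : Tm) : Result :=
  andThen (sortOf F rec Γ A) fun i => andThen (rec Γ x (some A)) fun _ =>
    andThen (rec Γ y (some A)) fun _ => some ([], univ i)

/-- The conversion rule requires the target to be a type. Subject reduction is not established, so a
Π-type found by evaluation is checked anew. -/
def tcAppWh (F : ℕ) (rec : Checker) (Γ : List Tm) (P : Tm) (a : Tm) : Result :=
  ifPi P (fun _ => none) fun A B => andThen (tcPi F rec Γ A B) fun _ =>
    andThen (rec Γ a (some A)) fun _ => some ([a], B)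

def tcApp (F : ℕ) (rec : Checker) (Γ : List Tm) (f a : Tm) : Result :=
  andThen (rec Γ f none) fun S =>
    ifPi S.2 (fun _ => tcAppWh F rec Γ (apps (wh F S.1 S.2 []).1 (wh F S.1 S.2 []).2) a) fun A B =>
      andThen (rec Γ a (some (esub S.1 0 A))) fun _ => some (a :: S.1, B)

/-- Inference with the general type of `sigma` would put every Σ-type into `univ constLevel`. This
rule returns the larger of the levels of its two parts; `tcIdent` does the same for identity types.
-/
def tcSigma (F : ℕ) (rec : Checker) (Γ : List Tm) (f A B : Tm) : Result :=
  ifLam B (fun _ => tcApp F rec Γ f B) fun A' b =>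
    bif beq A A' then tcPi F rec Γ A b else tcApp F rec Γ f B

def tcAppSpine (F : ℕ) (rec : Checker) (Γ : List Tm) (f a : Tm) : Result :=
  ifApp f (fun _ => tcApp F rec Γ f a) fun g x =>
    bif isConst 13 g then tcSigma F rec Γ f x a
    else ifApp g (fun _ => tcApp F rec Γ f a) fun h A =>
      bif isConst 16 h then tcIdent F rec Γ A x a else tcApp F rec Γ f a

def tcInfer (allow : Const → Bool) (F : ℕ) (rec : Checker) (Γ : List Tm) (t : Tm) : Result :=
  Tm.rec (motive := fun _ => Result) (fun n => tcVar n (look Γ n)) (fun i => some ([], univ i.succ))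
    (fun A B _ _ => tcPi F rec Γ A B) (fun A b _ _ => tcLam F rec Γ A b)
    (fun f a _ _ => tcAppSpine F rec Γ f a)
    (fun c => bif allow c then some ([], c.type constLevel constLevel) else none) t

def tcCheckUniv (i j : ℕ) : Result := bif i.ble j then some ([], univ j) else none

def tcCheckConv (F : ℕ) (rec : Checker) (Γ : List Tm) (t T : Tm) : Result :=
  andThen (rec Γ t none) fun S => bif conv F (esub S.1 0 S.2) T then some ([], T) else none

def tcCheckLam (F : ℕ) (rec : Checker) (Γ : List Tm) (A b A' B : Tm) : Result :=
  andThen (sortOf F rec Γ A) fun _ => bif conv F A A' then rec (A :: Γ) b (some B) else none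

/-- Against a universe, cumulativity makes it enough that the inferred level is not too large. -/
def tcCheckInf (F : ℕ) (rec : Checker) (Γ : List Tm) (t T : Tm) : Result :=
  ifUniv T (fun _ => tcCheckConv F rec Γ t T) fun j => andThen (sortOf F rec Γ t) fun i => tcCheckUniv i j

def tcCheck (F : ℕ) (rec : Checker) (Γ : List Tm) (t T : Tm) : Result :=
  ifLam t (fun _ => tcCheckInf F rec Γ t T) fun A b =>
    ifPi T (fun _ => tcCheckConv F rec Γ t T) fun A' B => tcCheckLam F rec Γ A b A' B

def tcStep (allow : Const → Bool) (F : ℕ) (rec : Checker) (Γ : List Tm) (t : Tm)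
    (T : Option Tm) : Result :=
  Option.rec (motive := fun _ => Result) (tcInfer allow F rec Γ t) (fun T => tcCheck F rec Γ t T) T

def tc (allow : Const → Bool) (F : ℕ) : Checker :=
  Nat.rec (motive := fun _ => Checker) (fun _ _ _ => none)
    (fun F r Γ t T => tcStep allow F r Γ t T) F

end
end Tm
end HoTT

namespace HoTT
namespace Tm

/-! Algebra of renaming and substitution -/

theorem liftRen_comp (ξ ζ : ℕ → ℕ) (n : ℕ) : liftRen ξ (liftRen ζ n) = liftRen (fun m => ξ (ζ m)) n := by
  cases n <;> rfl

theorem rename_rename (t : Tm) (ξ ζ : ℕ → ℕ) :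
    (t.rename ζ).rename ξ = t.rename fun n => ξ (ζ n) := by
  induction t generalizing ξ ζ with
  | var | univ | const => rfl
  | pi A B hA hB | lam A B hA hB => simp only [rename, hA, hB, liftRen_comp]
  | app f a hf ha => simp only [rename, hf, ha]

theorem liftSub_liftRen (σ : ℕ → Tm) (ξ : ℕ → ℕ) (n : ℕ) :
    liftSub σ (liftRen ξ n) = liftSub (fun m => σ (ξ m)) n := by
  cases n <;> rfl

theorem subst_rename (t : Tm) (σ : ℕ → Tm) (ξ : ℕ → ℕ) :
    (t.rename ξ).subst σ = t.subst fun n => σ (ξ n) := by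
  induction t generalizing σ ξ with
  | var | univ | const => rfl
  | pi A B hA hB | lam A B hA hB => simp only [rename, subst, hA, hB, liftSub_liftRen]
  | app f a hf ha => simp only [rename, subst, hf, ha]

theorem rename_liftSub (σ : ℕ → Tm) (ξ : ℕ → ℕ) (n : ℕ) :
    (liftSub σ n).rename (liftRen ξ) = liftSub (fun m => (σ m).rename ξ) n := by
  cases n with
  | zero => rfl
  | succ n => simp only [liftSub, wk, rename_rename]; rfl

theorem rename_subst (t : Tm) (σ : ℕ → Tm) (ξ : ℕ → ℕ) :
    (t.subst σ).rename ξ = t.subst fun n => (σ n).rename ξ := by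
  induction t generalizing σ ξ with
  | var | univ | const => rfl
  | pi A B hA hB | lam A B hA hB => simp only [rename, subst, hA, hB, rename_liftSub]
  | app f a hf ha => simp only [rename, subst, hf, ha]

theorem subst_liftSub (σ τ : ℕ → Tm) (n : ℕ) :
    (liftSub σ n).subst (liftSub τ) = liftSub (fun m => (σ m).subst τ) n := by
  cases n with
  | zero => rfl
  | succ n => simp only [liftSub, wk, rename_subst, subst_rename]

theorem subst_subst (t : Tm) (σ τ : ℕ → Tm) :
    (t.subst σ).subst τ = t.subst fun n => (σ n).subst τ := by
  induction t generalizing σ τ with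
  | var | univ | const => rfl
  | pi A B hA hB | lam A B hA hB => simp only [subst, hA, hB, subst_liftSub]
  | app f a hf ha => simp only [subst, hf, ha]

theorem liftSub_var : liftSub var = var := by
  funext n; cases n <;> rfl

theorem subst_var (t : Tm) : t.subst var = t := by
  induction t with
  | var | univ | const => rfl
  | pi A B hA hB | lam A B hA hB => simp only [subst, liftSub_var, hA, hB]
  | app f a hf ha => simp only [subst, hf, ha]

theorem liftSub_ren (ξ : ℕ → ℕ) : liftSub (fun n => var (ξ n)) = fun n => var (liftRen ξ n) := by
  funext n; cases n <;> rfl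

theorem rename_eq_subst (t : Tm) (ξ : ℕ → ℕ) : t.rename ξ = t.subst fun n => var (ξ n) := by
  induction t generalizing ξ with
  | var | univ | const => rfl
  | pi A B hA hB | lam A B hA hB => simp only [rename, subst, liftSub_ren, hA, hB]
  | app f a hf ha => simp only [rename, subst, hf, ha]

theorem wk_subst_liftSub (t : Tm) (σ : ℕ → Tm) : t.wk.subst (liftSub σ) = (t.subst σ).wk := by
  simp only [wk, subst_rename, rename_subst, liftSub]

theorem wk_inst (t a : Tm) : t.wk.inst a = t := by
  simp only [wk, inst, subst_rename, instSub]; exact subst_var t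

theorem inst_subst (b a : Tm) (σ : ℕ → Tm) :
    (b.inst a).subst σ = (b.subst (liftSub σ)).inst (a.subst σ) := by
  simp only [inst, subst_subst]
  congr 1; funext n
  cases n with
  | zero => rfl
  | succ n => simp only [instSub, liftSub, wk, subst_rename]; exact (subst_var _).symm

theorem inst_rename (b a : Tm) (ξ : ℕ → ℕ) :
    (b.inst a).rename ξ = (b.rename (liftRen ξ)).inst (a.rename ξ) := by
  simp only [rename_eq_subst, inst_subst, liftSub_ren]

theorem apps_subst (f : Tm) (as : List Tm) (σ : ℕ → Tm) :
    (apps f as).subst σ = apps (f.subst σ) (as.map (subst σ)) := by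
  induction as generalizing f with
  | nil => rfl
  | cons a as ih => exact ih (app f a)

/-! The substitutions computed by the checker -/

/-- The meaning of an environment, against which the substitution functions of the checker are
verified. -/
def ofList : List Tm → ℕ → Tm
  | [], n => var n
  | a :: _, 0 => a
  | _ :: as, n + 1 => ofList as n

theorem ofList_nil : ofList [] = var := rfl

theorem ofList_singleton (a : Tm) : ofList [a] = instSub a := by
  funext n; cases n <;> rfl

def liftSubN (σ : ℕ → Tm) : ℕ → ℕ → Tm
  | 0 => σ
  | k + 1 => liftSub (liftSubN σ k)

theorem liftSubN_lt (σ : ℕ → Tm) {n k : ℕ} (h : n < k) : liftSubN σ k n = var n := by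
  induction k generalizing n with
  | zero => omega
  | succ k ih => cases n with
    | zero => rfl
    | succ n => simp only [liftSubN, liftSub, ih (n := n) (by omega)]; rfl

theorem liftSubN_ge (σ : ℕ → Tm) {n k : ℕ} (h : k ≤ n) :
    liftSubN σ k n = (σ (n - k)).rename fun m => m + k := by
  induction k generalizing n with
  | zero => exact ((rename_eq_subst _ _).trans (subst_var _)).symm
  | succ k ih => cases n with
    | zero => omega
    | succ n =>
      simp only [liftSubN, liftSub, ih (n := n) (by omega), wk, rename_rename, Nat.add_sub_add_right]
      rfl

theorem blt_of_lt {n k : ℕ} (h : n < k) : n.blt k = true := Nat.ble_eq_true_of_le h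

theorem blt_of_ge {n k : ℕ} (h : k ≤ n) : n.blt k = false := by
  rw [Bool.eq_false_iff, ne_eq, Nat.blt, Nat.ble_eq]; omega

theorem lift_pi (d : ℕ) (A B : Tm) (c : ℕ) : lift d (pi A B) c = pi (lift d A c) (lift d B c.succ) := rfl
theorem lift_lam (d : ℕ) (A b : Tm) (c : ℕ) : lift d (lam A b) c = lam (lift d A c) (lift d b c.succ) := rfl
theorem lift_app (d : ℕ) (f a : Tm) (c : ℕ) : lift d (app f a) c = app (lift d f c) (lift d a c) := rfl

theorem lift_eq (d : ℕ) (t : Tm) (c : ℕ) :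
    lift d t c = t.subst (liftSubN (fun n => var (n + d)) c) := by
  induction t generalizing c with
  | var n =>
    change var _ = liftSubN _ _ _
    rcases Nat.lt_or_ge n c with h | h
    · rw [liftSubN_lt _ h, blt_of_lt h]; rfl
    · rw [liftSubN_ge _ h, blt_of_ge h]
      simp only [cond, rename, Nat.add_eq]; congr 1; omega
  | univ | const => rfl
  | pi A B hA hB | lam A B hA hB => simp only [lift_pi, lift_lam, subst, hA, hB, Nat.succ_eq_add_one, liftSubN]
  | app f a hf ha => simp only [lift_app, subst, hf, ha]

theorem lift_zero_eq (d : ℕ) (t : Tm) : lift d t 0 = t.rename fun n => n + d := by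
  rw [lift_eq, rename_eq_subst]; rfl

theorem envVar_eq (as : List Tm) (n k : ℕ) :
    envVar as n k = (ofList as n).rename fun m => m + k := by
  induction as generalizing n with
  | nil => rfl
  | cons a as ih => cases n with
    | zero => exact lift_zero_eq k a
    | succ n => exact ih n

theorem msub_pi (as : List Tm) (A B : Tm) (k : ℕ) : msub as (pi A B) k = pi (msub as A k) (msub as B k.succ) := rfl
theorem msub_lam (as : List Tm) (A b : Tm) (k : ℕ) : msub as (lam A b) k = lam (msub as A k) (msub as b k.succ) := rfl
theorem msub_app (as : List Tm) (f a : Tm) (k : ℕ) : msub as (app f a) k = app (msub as f k) (msub as a k) := rfl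

theorem msub_eq (as : List Tm) (t : Tm) (k : ℕ) :
    msub as t k = t.subst (liftSubN (ofList as) k) := by
  induction t generalizing k with
  | var n =>
    change (bif n.blt k then var n else envVar as (n.sub k) k) = liftSubN _ _ _
    rcases Nat.lt_or_ge n k with h | h
    · rw [liftSubN_lt _ h, blt_of_lt h]; rfl
    · rw [liftSubN_ge _ h, blt_of_ge h]
      exact envVar_eq as _ k
  | univ | const => rfl
  | pi A B hA hB | lam A B hA hB => simp only [msub_pi, msub_lam, subst, hA, hB, Nat.succ_eq_add_one, liftSubN]
  | app f a hf ha => simp only [msub_app, subst, hf, ha]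

theorem esub_eq (as : List Tm) (k : ℕ) (t : Tm) :
    esub as k t = t.subst (liftSubN (ofList as) k) := by
  cases as with
  | cons a as => exact msub_eq _ t k
  | nil =>
    have h : liftSubN (ofList []) k = var := by
      induction k with
      | zero => rfl
      | succ k ih => rw [liftSubN, ih, liftSub_var]
    rw [h, subst_var]; rfl

theorem esub_zero (as : List Tm) (t : Tm) : esub as 0 t = t.subst (ofList as) := esub_eq as 0 t

/-- Pushing an argument onto the environment has the effect of a beta step under the delayed
substitution; `whLam` and `tcApp` rest on this. -/
theorem subst_cons (as : List Tm) (a b : Tm) :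
    (b.subst (liftSub (ofList as))).inst a = b.subst (ofList (a :: as)) := by
  simp only [inst, subst_subst]
  congr 1; funext n
  cases n with
  | zero => rfl
  | succ n => simp only [liftSub, wk, subst_rename, instSub, ofList]; exact subst_var _

/-! Closed terms -/

theorem const_type_subst (c : Const) (i k : ℕ) (σ : ℕ → Tm) : (c.type i k).subst σ = c.type i k := by
  cases c <;> rfl

theorem const_type_rename (c : Const) (i k : ℕ) (ξ : ℕ → ℕ) :
    (c.type i k).rename ξ = c.type i k := by
  cases c <;> rfl

end Tm

open Tm

/-! ### Stability of convertibility and typing under substitution -/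

theorem Compute.subst {a b : Tm} (h : Compute a b) (σ : ℕ → Tm) :
    Compute (a.subst σ) (b.subst σ) := by
  cases h <;> simp only [apps_subst, List.map, Tm.subst] <;> constructor

theorem Conv.subst {a b : Tm} (h : Conv a b) (σ : ℕ → Tm) : Conv (a.subst σ) (b.subst σ) := by
  induction h generalizing σ with
  | refl a => exact .refl _
  | symm _ ih => exact (ih σ).symm
  | trans _ _ ih ih' => exact (ih σ).trans (ih' σ)
  | pi _ _ ih ih' => exact .pi (ih σ) (ih' _)
  | lam _ _ ih ih' => exact .lam (ih σ) (ih' _)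
  | app _ _ ih ih' => exact .app (ih σ) (ih' σ)
  | beta A b a => rw [inst_subst]; exact .beta _ _ _
  | eta A f =>
    simp only [Tm.subst, wk_subst_liftSub]
    exact .eta _ _
  | compute h => exact .compute (h.subst σ)

theorem Conv.rename {a b : Tm} (h : Conv a b) (ξ : ℕ → ℕ) : Conv (a.rename ξ) (b.rename ξ) := by
  simpa only [rename_eq_subst] using h.subst _

theorem Conv.apps {f g : Tm} (h : Conv f g) (as : List Tm) : Conv (Tm.apps f as) (Tm.apps g as) := by
  induction as generalizing f g with
  | nil => exact h
  | cons a as ih => exact ih (.app h (.refl a))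

/-- An entry of a context is a type over the earlier variables only, so both types are weakened to
the whole context before they are compared. -/
def RenTyping (Γ Δ : List Tm) (ξ : ℕ → ℕ) : Prop :=
  ∀ n A, Γ[n]? = some A →
    ∃ B, Δ[ξ n]? = some B ∧ (A.rename fun m => m + (n + 1)).rename ξ = B.rename fun m => m + (ξ n + 1)

theorem RenTyping.lift {Γ Δ : List Tm} {ξ : ℕ → ℕ} (h : RenTyping Γ Δ ξ) (A : Tm) :
    RenTyping (A :: Γ) (A.rename ξ :: Δ) (liftRen ξ) := by
  intro n B hB
  cases n with
  | zero =>
    simp only [List.getElem?_cons_zero, Option.some.injEq] at hB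
    subst hB
    refine ⟨A.rename ξ, rfl, ?_⟩
    simp only [rename_rename]; rfl
  | succ n =>
    obtain ⟨C, hC, e⟩ := h n B (by simpa using hB)
    refine ⟨C, by simpa [liftRen] using hC, ?_⟩
    have := congrArg Tm.wk e
    simp only [wk, rename_rename] at this
    simp only [rename_rename]
    exact this

theorem HasType.rename {Γ Δ : List Tm} {t T : Tm} (h : HasType Γ t T) {ξ : ℕ → ℕ}
    (hξ : RenTyping Γ Δ ξ) : HasType Δ (t.rename ξ) (T.rename ξ) := by
  induction h generalizing Δ ξ with
  | var hn =>
    obtain ⟨B, hB, e⟩ := hξ _ _ hn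
    rw [e]; exact .var hB
  | univ Γ i => exact .univ _ i
  | cumul _ ih => exact .cumul (ih hξ)
  | pi _ _ ih ih' => exact .pi (ih hξ) (ih' (hξ.lift _))
  | lam _ _ ih ih' => exact .lam (ih hξ) (ih' (hξ.lift _))
  | app _ _ ih ih' => rw [inst_rename]; exact .app (ih hξ) (ih' hξ)
  | const Γ c i k => rw [const_type_rename]; exact .const _ c i k
  | conv _ hc _ ih ih' => exact .conv (ih hξ) (hc.rename ξ) (ih' hξ)

theorem RenTyping.succ (Γ : List Tm) (A : Tm) : RenTyping Γ (A :: Γ) Nat.succ := by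
  intro n B hB
  refine ⟨B, by simpa using hB, ?_⟩
  rw [rename_rename]; rfl

theorem HasType.wk {Γ : List Tm} {t T : Tm} (h : HasType Γ t T) (A : Tm) :
    HasType (A :: Γ) t.wk T.wk := h.rename (.succ Γ A)

def SubTyping (Γ Δ : List Tm) (σ : ℕ → Tm) : Prop :=
  ∀ n A, Γ[n]? = some A → HasType Δ (σ n) ((A.rename fun m => m + (n + 1)).subst σ)

theorem SubTyping.lift {Γ Δ : List Tm} {σ : ℕ → Tm} (h : SubTyping Γ Δ σ) (A : Tm) :
    SubTyping (A :: Γ) (A.subst σ :: Δ) (liftSub σ) := by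
  intro n B hB
  cases n with
  | zero =>
    simp only [List.getElem?_cons_zero, Option.some.injEq] at hB
    subst hB
    have : ((A.rename fun m => m + (0 + 1)).subst (liftSub σ))
        = (A.subst σ).rename fun m => m + (0 + 1) := wk_subst_liftSub A σ
    rw [this]
    exact .var rfl
  | succ n =>
    have := (h n B (by simpa using hB)).wk (A.subst σ)
    rw [← wk_subst_liftSub, Tm.wk, Tm.wk, rename_rename] at this
    exact this

theorem HasType.subst {Γ Δ : List Tm} {t T : Tm} (h : HasType Γ t T) {σ : ℕ → Tm}
    (hσ : SubTyping Γ Δ σ) : HasType Δ (t.subst σ) (T.subst σ) := by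
  induction h generalizing Δ σ with
  | var hn => exact hσ _ _ hn
  | univ Γ i => exact .univ _ i
  | cumul _ ih => exact .cumul (ih hσ)
  | pi _ _ ih ih' => exact .pi (ih hσ) (ih' (hσ.lift _))
  | lam _ _ ih ih' => exact .lam (ih hσ) (ih' (hσ.lift _))
  | app _ _ ih ih' => rw [inst_subst]; exact .app (ih hσ) (ih' hσ)
  | const Γ c i k => rw [const_type_subst]; exact .const _ c i k
  | conv _ hc _ ih ih' => exact .conv (ih hσ) (hc.subst σ) (ih' hσ)

theorem SubTyping.inst {Γ : List Tm} {a A : Tm} (ha : HasType Γ a A) :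
    SubTyping (A :: Γ) Γ (instSub a) := by
  intro n B hB
  cases n with
  | zero =>
    simp only [List.getElem?_cons_zero, Option.some.injEq] at hB
    subst hB
    have : ((A.rename fun m => m + (0 + 1)).subst (instSub a)) = A := wk_inst A a
    rw [this]; exact ha
  | succ n =>
    have e : ((B.rename fun m => m + (n + 1 + 1)).subst (instSub a))
        = B.rename fun m => m + (n + 1) := by
      rw [subst_rename, rename_eq_subst]; rfl
    rw [e]; exact .var (by simpa using hB)

theorem HasType.inst {Γ : List Tm} {t T a A : Tm} (h : HasType (A :: Γ) t T) (ha : HasType Γ a A) :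
    HasType Γ (t.inst a) (T.inst a) := h.subst (.inst ha)

/-- Replaces the type of the last variable by a convertible one. -/
theorem HasType.conv_head {Γ : List Tm} {t T A A' : Tm} {i j : ℕ} (h : HasType (A' :: Γ) t T)
    (hA' : HasType Γ A' (.univ i)) (_ : HasType Γ A (.univ j)) (hc : Conv A A') :
    HasType (A :: Γ) t T := by
  -- The identity is a well-typed substitution between the two contexts; only variable 0 needs the
  -- conversion rule.
  have hσ : SubTyping (A' :: Γ) (A :: Γ) Tm.var := by
    intro n B hB
    rw [subst_var]
    cases n with
    | zero =>
      simp only [List.getElem?_cons_zero, Option.some.injEq] at hB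
      subst hB
      exact .conv (.var (A := A) rfl) (hc.rename _) (hA'.wk A)
    | succ n => exact .var (by simpa using hB)
  simpa only [subst_var] using h.subst hσ

def IsType (Γ : List Tm) (A : Tm) : Prop := ∃ i, HasType Γ A (.univ i)

theorem HasType.le {Γ : List Tm} {A : Tm} {i j : ℕ} (h : HasType Γ A (.univ i)) (hij : i ≤ j) :
    HasType Γ A (.univ j) := by
  induction hij with
  | refl => exact h
  | step _ ih => exact ih.cumul

/-- The rules `cumul` and `conv` do not change the term, so an induction through them reaches the
formation rule. -/
theorem HasType.pi_inv {Γ : List Tm} {A B T : Tm} (h : HasType Γ (.pi A B) T) :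
    IsType Γ A ∧ IsType (A :: Γ) B := by
  generalize e : Tm.pi A B = t at h
  induction h with
  | pi h h' => cases e; exact ⟨⟨_, h⟩, ⟨_, h'⟩⟩
  | cumul _ ih => exact ih e
  | conv _ _ _ ih _ => exact ih e
  | _ => cases e

/-- All types in a context are types. -/
def WellFormed (Γ : List Tm) : Prop :=
  ∀ (n : ℕ) (A : Tm), Γ[n]? = some A → IsType Γ (A.rename fun m => m + (n + 1))

theorem WellFormed.nil : WellFormed [] := by
  intro n A h; simp at h

theorem WellFormed.cons {Γ : List Tm} {A : Tm} (h : WellFormed Γ) (hA : IsType Γ A) :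
    WellFormed (A :: Γ) := by
  intro n B hB
  cases n with
  | zero =>
    simp only [List.getElem?_cons_zero, Option.some.injEq] at hB
    subst hB
    obtain ⟨i, hi⟩ := hA
    exact ⟨i, hi.wk A⟩
  | succ n =>
    obtain ⟨i, hi⟩ := h n B (by simpa using hB)
    refine ⟨i, ?_⟩
    have := hi.wk A
    rw [Tm.wk, rename_rename] at this
    exact this

end HoTT

namespace HoTT
namespace Tm

/-! Soundness of the type checker -/

theorem ifVar_eq {t : Tm} {k : ℕ → Bool} (h : ifVar t (fun _ => false) k = true) : ∃ n, t = var n ∧ k n = true := by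
  cases t <;> first | exact ⟨_, rfl, h⟩ | cases h

theorem ifUniv_eq {t : Tm} {k : ℕ → Bool} (h : ifUniv t (fun _ => false) k = true) :
    ∃ n, t = univ n ∧ k n = true := by
  cases t <;> first | exact ⟨_, rfl, h⟩ | cases h

theorem ifPi_cases {α : Type} (t : Tm) (d : Unit → α) (k : Tm → Tm → α) :
    (∃ A B, t = pi A B ∧ ifPi t d k = k A B) ∨ ifPi t d k = d () := by
  cases t <;> first | exact .inr rfl | exact .inl ⟨_, _, rfl, rfl⟩

theorem ifLam_cases {α : Type} (t : Tm) (d : Unit → α) (k : Tm → Tm → α) :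
    (∃ A B, t = lam A B ∧ ifLam t d k = k A B) ∨ ifLam t d k = d () := by
  cases t <;> first | exact .inr rfl | exact .inl ⟨_, _, rfl, rfl⟩

theorem ifApp_cases {α : Type} (t : Tm) (d : Unit → α) (k : Tm → Tm → α) :
    (∃ A B, t = app A B ∧ ifApp t d k = k A B) ∨ ifApp t d k = d () := by
  cases t <;> first | exact .inr rfl | exact .inl ⟨_, _, rfl, rfl⟩

theorem code_injective {c c' : Const} (h : c.code = c'.code) : c = c' := by
  cases c <;> cases c' <;> simp only [Const.code, Nat.add_eq] at h <;> first | rfl | omega | (congr 1; omega)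

theorem eq_of_code {c c' : Const} (h : c.code.beq c'.code = true) : c = c' :=
  code_injective (Nat.eq_of_beq_eq_true h)

theorem isConst_eq {c : Const} {t : Tm} (h : isConst c.code t = true) : t = const c := by
  cases t <;> first | exact congrArg const (code_injective (Nat.eq_of_beq_eq_true h)).symm | cases h

theorem beq_eq {t u : Tm} (h : beq t u = true) : t = u := by
  induction t generalizing u with
  | var n => obtain ⟨m, rfl, h⟩ := ifVar_eq h; rw [Nat.eq_of_beq_eq_true h]
  | univ n => obtain ⟨m, rfl, h⟩ := ifUniv_eq h; rw [Nat.eq_of_beq_eq_true h]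
  | const c => exact (isConst_eq h).symm
  | pi A B hA hB =>
    replace h : ifPi u (fun _ => false) (fun A' B' => beq A A' && beq B B') = true := h
    rcases ifPi_cases u (fun _ => false) fun A' B' => beq A A' && beq B B' with ⟨A', B', rfl, e⟩ | e
    · rw [e, Bool.and_eq_true] at h; rw [hA h.1, hB h.2]
    · rw [e] at h; cases h
  | lam A B hA hB =>
    replace h : ifLam u (fun _ => false) (fun A' B' => beq A A' && beq B B') = true := h
    rcases ifLam_cases u (fun _ => false) fun A' B' => beq A A' && beq B B' with ⟨A', B', rfl, e⟩ | e
    · rw [e, Bool.and_eq_true] at h; rw [hA h.1, hB h.2]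
    · rw [e] at h; cases h
  | app A B hA hB =>
    replace h : ifApp u (fun _ => false) (fun A' B' => beq A A' && beq B B') = true := h
    rcases ifApp_cases u (fun _ => false) fun A' B' => beq A A' && beq B B' with ⟨A', B', rfl, e⟩ | e
    · rw [e, Bool.and_eq_true] at h; rw [hA h.1, hB h.2]
    · rw [e] at h; cases h

/-- The machine `m` computes convertible terms. -/
def Machine.Sound (m : Machine) : Prop :=
  ∀ as t st, Conv (apps (t.subst (ofList as)) st) (apps (m as t st).1 (m as t st).2)

theorem Machine.Sound.nil {m : Machine} (h : m.Sound) (t : Tm) (st : List Tm) :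
    Conv (apps t st) (apps (m [] t st).1 (m [] t st).2) := by
  simpa only [ofList_nil, subst_var] using h [] t st

theorem lookEnv_sound {m : Machine} (hm : m.Sound) (as : List Tm) (n : ℕ) (st : List Tm) :
    Conv (apps (ofList as n) st)
      (apps (lookEnv as n (fun a => m [] a st) fun k => (var k, st)).1
        (lookEnv as n (fun a => m [] a st) fun k => (var k, st)).2) := by
  induction as generalizing n with
  | nil => exact .refl _
  | cons a as ih => cases n with
    | zero => exact hm.nil a st
    | succ n => exact ih n

theorem Machine.Sound.lam {m : Machine} (hm : m.Sound) (as : List Tm) (A b : Tm) (st : List Tm) :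
    Conv (apps ((Tm.lam A b).subst (ofList as)) st)
      (apps (whLam m as A b st).1 (whLam m as A b st).2) := by
  cases st with
  | nil => simp only [whLam, ifCons, esub_zero, esub_eq as 1, liftSubN]; exact .refl _
  | cons a st =>
    refine .trans (Conv.apps (.beta _ _ a) st) ?_
    rw [subst_cons]
    exact hm _ _ _

theorem Machine.Sound.sigma {m : Machine} (hm : m.Sound) (st : List Tm) :
    Conv (apps (const .sigmaInd) st) 
      (apps (whSigma m (const .sigmaInd, st) st).1 (whSigma m (const .sigmaInd, st) st).2) := by
  rcases st with _ | ⟨A, _ | ⟨B, _ | ⟨C, _ | ⟨g, _ | ⟨p, rest⟩⟩⟩⟩⟩ <;> try exact .refl _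
  simp only [whSigma, whPair, ifCons]
  cases hc : isConst 14 (m [] p []).1 with
  | false => exact .refl _
  | true =>
    have hp := hm.nil p []
    rw [isConst_eq (c := .pair) hc] at hp
    rcases h2 : (m [] p []).2 with _ | ⟨A', _ | ⟨B', _ | ⟨a, _ | ⟨b, _ | _⟩⟩⟩⟩ <;> try exact .refl _
    rw [h2] at hp
    refine .trans (Conv.apps (f := apps (const .sigmaInd) [A, B, C, g, p]) ?_ rest)
      (hm.nil g (a :: b :: rest))
    exact .trans (.app (.refl _) hp) (.compute (.pair _ _ _ _ _ _ _ _))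

theorem Machine.Sound.ident {m : Machine} (hm : m.Sound) (st : List Tm) :
    Conv (apps (const .identInd) st) 
      (apps (whIdent m (const .identInd, st) st).1 (whIdent m (const .identInd, st) st).2) := by
  rcases st with _ | ⟨A, _ | ⟨C, _ | ⟨g, _ | ⟨x, _ | ⟨y, _ | ⟨p, rest⟩⟩⟩⟩⟩⟩ <;> try exact .refl _
  simp only [whIdent, whRefl, ifCons]
  cases hc : isConst 17 (m [] p []).1 with
  | false => exact .refl _
  | true =>
    have hp := hm.nil p []
    rw [isConst_eq (c := .refl) hc] at hp
    rcases h2 : (m [] p []).2 with _ | ⟨A', _ | ⟨a, _ | _⟩⟩ <;> try exact .refl _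
    rw [h2] at hp
    refine .trans (Conv.apps (f := apps (const .identInd) [A, C, g, x, y, p]) ?_ rest)
      (hm.nil g (a :: rest))
    exact .trans (.app (.refl _) hp) (.compute (.refl _ _ _ _ _ _ _))

theorem Machine.Sound.step {m : Machine} (hm : m.Sound) : Machine.Sound (whStep m) := by
  intro as t st
  cases t with
  | var n => exact lookEnv_sound hm as n st
  | univ i => exact .refl _
  | pi A B => simp only [whStep, esub_zero, esub_eq as 1, liftSubN]; exact .refl _
  | lam A b => exact hm.lam as A b st
  | app f a => simp only [whStep, esub_zero]; exact hm as f (a.subst (ofList as) :: st)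
  | const c =>
    simp only [whStep, whConst]
    cases h : c.code.beq 15 with
    | true => cases eq_of_code (c' := .sigmaInd) h; exact hm.sigma st
    | false => cases h' : c.code.beq 18 with
      | true => cases eq_of_code (c' := .identInd) h'; exact hm.ident st
      | false => exact .refl _

theorem wh_sound (F : ℕ) : Machine.Sound (wh F) := by
  induction F with
  | zero => intro as t st; change Conv _ (apps (esub as 0 t) st); rw [esub_zero]; exact .refl _
  | succ F ih => exact ih.step

/-- If the test `cv` succeeds, the terms are convertible. -/
def ConvTest (cv : Tm → Tm → Bool) : Prop := ∀ t u, cv t u = true → Conv t u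

theorem ConvTest.args {cv : Tm → Tm → Bool} (hcv : ConvTest cv) {as bs : List Tm}
    (h : convArgs cv as bs = true) {f g : Tm} (hf : Conv f g) : Conv (apps f as) (apps g bs) := by
  induction as generalizing bs f g with
  | nil => cases bs with
    | nil => exact hf
    | cons b bs => cases h
  | cons a as ih => cases bs with
    | nil => cases h
    | cons b bs =>
      replace h : and (cv a b) (convArgs cv as bs) = true := h
      rw [Bool.and_eq_true] at h
      exact ih h.2 (.app hf (hcv _ _ h.1))

theorem ConvTest.eta {cv : Tm → Tm → Bool} (hcv : ConvTest cv) {A b h : Tm} {st : List Tm}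
    (e : convEta cv b h st = true) : Conv (lam A b) (apps h st) := by
  have := hcv _ _ e
  rw [lift_zero_eq] at this
  exact .trans (.lam (.refl _) this) (.eta A (apps h st))

/-- Convertibility ignores the annotation of an abstraction. -/
theorem _root_.HoTT.Conv.lam_annotation (A A' b : Tm) : Conv (lam A b) (lam A' b) := by
  -- Eta with annotation `A`, applied to `lam A' b`; a beta step inside the expansion gives back
  -- `b`.
  have h := Conv.eta A (lam A' b)
  refine .trans (.lam (.refl A) ?_) h
  refine .symm (.trans (.beta _ _ _) ?_)
  have : (b.rename (liftRen Nat.succ)).inst (var 0) = b := by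
    rw [inst, subst_rename]
    refine .trans ?_ (subst_var b)
    congr 1; funext n; cases n <;> rfl
  rw [this]; exact .refl _

theorem ConvTest.lam {cv : Tm → Tm → Bool} (hcv : ConvTest cv) {A A' b b' : Tm}
    (e : cv b b' = true) : Conv (Tm.lam A b) (Tm.lam A' b') :=
  .trans (Conv.lam_annotation A A' b) (.lam (.refl _) (hcv _ _ e))

theorem ConvTest.ne {cv : Tm → Tm → Bool} (hcv : ConvTest cv) {h h' : Tm} {st st' : List Tm}
    (e : convNe cv h st h' st' = true) :
    Conv (apps h st) (apps h' st') := by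
  rw [convNe] at e
  rcases ifLam_cases h' (fun _ => beq h h' && convArgs cv st st') fun _ b' =>
      st'.isEmpty && convEta cv b' h st with
    ⟨A, b, rfl, e'⟩ | e'
  · rw [e'] at e
    rw [Bool.and_eq_true, List.isEmpty_iff] at e
    obtain ⟨rfl, e⟩ := e
    exact (hcv.eta e).symm
  · rw [e', Bool.and_eq_true] at e
    exact hcv.args e.2 (beq_eq e.1 ▸ .refl _)

theorem ConvTest.whnf {cv : Tm → Tm → Bool} (hcv : ConvTest cv) {r r' : Tm × List Tm}
    (e : convWh cv r r' = true) :
    Conv (apps r.1 r.2) (apps r'.1 r'.2) := by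
  obtain ⟨h, st⟩ := r
  obtain ⟨h', st'⟩ := r'
  cases h with
  | lam A b =>
    replace e : convLam cv b st h' st' = true := e
    rw [convLam, Bool.and_eq_true, List.isEmpty_iff] at e
    obtain ⟨rfl, e⟩ := e
    rcases ifLam_cases h' (fun _ => convEta cv b h' st') fun _ b' => st'.isEmpty && cv b b' with
      ⟨A', b', rfl, e'⟩ | e'
    · rw [e', Bool.and_eq_true, List.isEmpty_iff] at e
      obtain ⟨rfl, e⟩ := e
      exact hcv.lam e
    · rw [e'] at e; exact hcv.eta e
  | pi A B =>
    replace e : convPi cv A B st h' st' = true := e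
    rw [convPi] at e
    rcases ifPi_cases h' (fun _ => false) fun A' B' => cv A A' && (cv B B' && convArgs cv st st') with
      ⟨A', B', rfl, e'⟩ | e'
    · rw [e', Bool.and_eq_true, Bool.and_eq_true] at e
      exact hcv.args e.2.2 (.pi (hcv _ _ e.1) (hcv _ _ e.2.1))
    · rw [e'] at e; cases e
  | var | univ | app | const => exact hcv.ne e


theorem conv_sound (F : ℕ) : ConvTest (conv F) := by
  induction F with
  | zero => intro t u h; cases h
  | succ F ih =>
    intro t u h
    replace h : or (beq t u) (convWh (conv F) (wh F [] t []) (wh F [] u [])) = true := h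
    rcases Bool.or_eq_true_iff.1 h with h | h
    · exact beq_eq h ▸ .refl _
    · exact .trans ((wh_sound F).nil t []) (.trans (ih.whnf h) ((wh_sound F).nil u []).symm)

theorem look_eq (Γ : List Tm) (n : ℕ) : look Γ n = Γ[n]? := by
  induction Γ generalizing n with
  | nil => rfl
  | cons A Γ ih => cases n with
    | zero => rfl
    | succ n => exact (ih n).trans List.getElem?_cons_succ.symm

/-- The type of a result, with its pending substitution carried out. -/
def resultType (S : List Tm × Tm) : Tm := S.2.subst (ofList S.1)

/-- The conversion rule needs to know that its target is a type. Inference delivers this fact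
together with the type; checking presupposes it. -/
structure Checker.Sound (rec : Checker) : Prop where
  infer : ∀ {Γ t S}, WellFormed Γ → rec Γ t none = some S →
    HasType Γ t (resultType S) ∧ IsType Γ (resultType S)
  check : ∀ {Γ t T S}, WellFormed Γ → rec Γ t (some T) = some S → IsType Γ T → HasType Γ t T

theorem isType_univ (Γ : List Tm) (i : ℕ) : IsType Γ (univ i) := ⟨_, .univ _ i⟩

theorem resultType_nil (T : Tm) : resultType ([], T) = T := subst_var T

theorem andThen_eq_some_iff {α β : Type} {o : Option α} {k : α → Option β} {b : β} :
    andThen o k = some b ↔ ∃ a, o = some a ∧ k a = some b := by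
  have : andThen o k = o.bind k := by cases o <;> rfl
  rw [this, Option.bind_eq_some_iff]

theorem univLevel_eq {r : Tm × List Tm} {i : ℕ} (h : univLevel r = some i) : r = (univ i, []) := by
  obtain ⟨t, st⟩ := r
  cases t with
  | univ j => cases st with
    | nil => cases h; rfl
    | cons => cases h
  | var | pi | lam | app | const => cases h

variable {rec : Checker} {F : ℕ} {Γ : List Tm}

theorem Checker.Sound.sort (h : rec.Sound) (hΓ : WellFormed Γ) {A : Tm} {i : ℕ}
    (e : sortOf F rec Γ A = some i) : HasType Γ A (univ i) := by
  rw [sortOf, andThen_eq_some_iff] at e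
  obtain ⟨S, hS, e⟩ := e
  refine .conv (h.infer hΓ hS).1 ?_ (.univ _ i)
  have hc := wh_sound F S.1 S.2 []
  rwa [univLevel_eq e] at hc

theorem Checker.Sound.pi (h : rec.Sound) (hΓ : WellFormed Γ) {A B : Tm} {S : List Tm × Tm}
    (e : tcPi F rec Γ A B = some S) : ∃ i, HasType Γ A (univ i) ∧ HasType (A :: Γ) B (univ i) ∧
      S = ([], univ i) := by
  simp only [tcPi, piMax, andThen_eq_some_iff, Option.some.injEq] at e
  obtain ⟨i, hA, j, hB, rfl⟩ := e
  have hA := h.sort hΓ hA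
  have hB := h.sort (hΓ.cons ⟨_, hA⟩) hB
  cases hij : i.ble j with
  | true => exact ⟨j, hA.le (Nat.le_of_ble_eq_true hij), hB, rfl⟩
  | false =>
    have : j ≤ i := by
      by_contra hlt
      rw [Nat.ble_eq_true_of_le (by omega)] at hij
      cases hij
    exact ⟨i, hA, hB.le this, rfl⟩

/-- The constant has a type at every level, so it is used at the level of its arguments rather than
at `constLevel`. -/
theorem hasType_sigma {A b : Tm} {i : ℕ} (hA : HasType Γ A (univ i))
    (hb : HasType (A :: Γ) b (univ i)) :
    HasType Γ (app (app (const .sigma) A) (lam A b)) (univ i) :=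
  .app (B := univ i) (.app (B := pi (pi (var 0) (univ i)) (univ i)) (.const Γ .sigma i 0) hA)
    (.lam hA hb)

theorem hasType_ident {A x y : Tm} {i : ℕ} (hA : HasType Γ A (univ i)) (hx : HasType Γ x A)
    (hy : HasType Γ y A) :
    HasType Γ (app (app (app (const .ident) A) x) y) (univ i) := by
  have h1 : HasType Γ (app (const .ident) A) (.pi A (.pi A.wk (univ i))) :=
    .app (B := .pi (var 0) (.pi (var 1) (univ i))) (.const Γ .ident i 0) hA
  have h2 := HasType.app h1 hx
  have e : (Tm.pi A.wk (univ i)).inst x = .pi A (univ i) := congrArg (fun B => Tm.pi B (univ i)) (wk_inst A x)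
  rw [e] at h2
  exact .app (B := univ i) h2 hy

theorem Checker.Sound.app (h : rec.Sound) (hΓ : WellFormed Γ) {f a : Tm} {S : List Tm × Tm}
    (e : tcApp F rec Γ f a = some S) :
    HasType Γ (Tm.app f a) (resultType S) ∧ IsType Γ (resultType S) := by
  rw [tcApp, andThen_eq_some_iff] at e
  obtain ⟨⟨as, P⟩, hf, e⟩ := e
  have hf := h.infer hΓ hf
  rcases ifPi_cases P
    (fun _ => tcAppWh F rec Γ (apps (wh F as P []).1 (wh F as P []).2) a)
    fun A B => andThen (rec Γ a (some (esub as 0 A))) fun _ => some (a :: as, B) with ⟨A, B, rfl, e'⟩ | e'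
  · rw [e', andThen_eq_some_iff] at e
    obtain ⟨r, ha, e⟩ := e
    cases e
    rw [esub_zero] at ha
    obtain ⟨hA, hB⟩ := hf.2.choose_spec.pi_inv
    have ha := h.check hΓ ha hA
    have hs : resultType (a :: as, B) = (B.subst (liftSub (ofList as))).inst a :=
      (subst_cons as a B).symm
    rw [hs]
    exact ⟨.app hf.1 ha, hB.choose, hB.choose_spec.inst ha⟩
  · rw [e', tcAppWh] at e
    rcases ifPi_cases (apps (wh F as P []).1 (wh F as P []).2) (fun _ => none)
      fun A B => andThen (tcPi F rec Γ A B) fun _ => andThen (rec Γ a (some A)) fun _ => some ([a], B)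
      with ⟨A, B, hP, e''⟩ | e''
    · simp only [e'', andThen_eq_some_iff] at e
      obtain ⟨r, hp, r', ha, e⟩ := e
      cases e
      obtain ⟨i, hA, hB, -⟩ := h.pi hΓ hp
      have ha := h.check hΓ ha ⟨i, hA⟩
      have hc := wh_sound F as P []
      rw [hP] at hc
      have hf' := HasType.conv hf.1 hc (.pi hA hB)
      have hs : resultType ([a], B) = B.inst a := by rw [resultType, ofList_singleton]; rfl
      rw [hs]
      exact ⟨.app hf' ha, i, hB.inst ha⟩
    · rw [e''] at e; cases e

theorem Checker.Sound.appSpine (h : rec.Sound) (hΓ : WellFormed Γ) {f a : Tm} {S : List Tm × Tm}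
    (e : tcAppSpine F rec Γ f a = some S) :
    HasType Γ (Tm.app f a) (resultType S) ∧ IsType Γ (resultType S) := by
  rw [tcAppSpine] at e
  rcases ifApp_cases f (fun _ => tcApp F rec Γ f a) fun g x =>
    bif isConst 13 g then tcSigma F rec Γ f x a
    else ifApp g (fun _ => tcApp F rec Γ f a) fun h A =>
      bif isConst 16 h then tcIdent F rec Γ A x a else tcApp F rec Γ f a with ⟨g, x, rfl, e'⟩ | e'
  · rw [e'] at e
    cases hs : isConst 13 g with
    | true =>
      rw [hs, cond_true, tcSigma] at e
      rcases ifLam_cases a (fun _ => tcApp F rec Γ (Tm.app g x) a) fun A' b =>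
        bif beq x A' then tcPi F rec Γ x b else tcApp F rec Γ (Tm.app g x) a with ⟨A', b, rfl, e''⟩ | e''
      · rw [e''] at e
        cases hb : beq x A' with
        | false => rw [hb] at e; exact h.app hΓ e
        | true =>
          rw [hb] at e
          obtain rfl := beq_eq hb
          obtain ⟨i, hA, hB, rfl⟩ := h.pi hΓ e
          obtain rfl := isConst_eq (c := .sigma) hs
          exact ⟨hasType_sigma hA hB, isType_univ _ i⟩
      · rw [e''] at e; exact h.app hΓ e
    | false =>
      rw [hs, cond_false] at e
      rcases ifApp_cases g (fun _ => tcApp F rec Γ (Tm.app g x) a) fun h A =>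
        bif isConst 16 h then tcIdent F rec Γ A x a else tcApp F rec Γ (Tm.app g x) a
        with ⟨k, A, rfl, e''⟩ | e''
      · rw [e''] at e
        cases hi : isConst 16 k with
        | true =>
          obtain rfl := isConst_eq (c := .ident) hi
          simp only [hi, cond_true, tcIdent, andThen_eq_some_iff, Option.some.injEq] at e
          obtain ⟨i, hA, _, hx, _, hy, rfl⟩ := e
          have hA := h.sort hΓ hA
          exact ⟨hasType_ident hA (h.check hΓ hx ⟨i, hA⟩) (h.check hΓ hy ⟨i, hA⟩), isType_univ _ i⟩
        | false => rw [hi] at e; exact h.app hΓ e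
      · rw [e''] at e; exact h.app hΓ e
  · rw [e'] at e; exact h.app hΓ e

/-- The types of the allowed constants are types. -/
def AllowedTypes (allow : Const → Bool) : Prop :=
  ∀ c, allow c = true → IsType [] (c.type constLevel constLevel)

theorem HasType.weaken_closed {t T : Tm} (h : HasType [] t T) (Γ : List Tm) (ξ : ℕ → ℕ) :
    HasType Γ (t.rename ξ) (T.rename ξ) :=
  h.rename fun n A hA => by simp at hA

theorem Checker.Sound.inferStep {allow : Const → Bool} (hc : AllowedTypes allow) (h : rec.Sound)
    (hΓ : WellFormed Γ) {t : Tm} {S : List Tm × Tm} (e : tcInfer allow F rec Γ t = some S) :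
    HasType Γ t (resultType S) ∧ IsType Γ (resultType S) := by
  cases t with
  | var n =>
    replace e : tcVar n (look Γ n) = some S := e
    simp only [tcVar, look_eq, andThen_eq_some_iff, Option.some.injEq] at e
    obtain ⟨A, hA, rfl⟩ := e
    rw [resultType_nil, lift_zero_eq]
    exact ⟨.var hA, hΓ n A hA⟩
  | univ i => cases e; exact ⟨.univ _ i, isType_univ _ _⟩
  | pi A B =>
    obtain ⟨i, hA, hB, rfl⟩ := h.pi hΓ e
    exact ⟨.pi hA hB, isType_univ _ i⟩
  | lam A b =>
    replace e : tcLam F rec Γ A b = some S := e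
    simp only [tcLam, andThen_eq_some_iff, Option.some.injEq] at e
    obtain ⟨i, hA, S, hb, rfl⟩ := e
    have hA := h.sort hΓ hA
    obtain ⟨hb, j, hB⟩ := h.infer (hΓ.cons ⟨i, hA⟩) hb
    rw [resultType_nil, esub_zero]
    exact ⟨.lam hA hb, max i j, .pi (hA.le (le_max_left _ _)) (hB.le (le_max_right _ _))⟩
  | app f a => exact h.appSpine hΓ e
  | const c =>
    replace e : (bif allow c then some ([], c.type constLevel constLevel) else none) = some S := e
    cases ha : allow c with
    | false => rw [ha] at e; cases e
    | true =>
      rw [ha] at e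
      cases e
      rw [resultType_nil]
      refine ⟨.const _ c _ _, ?_⟩
      obtain ⟨i, hi⟩ := hc c ha
      have := HasType.weaken_closed hi Γ id
      rw [const_type_rename] at this
      exact ⟨i, this⟩

theorem Checker.Sound.checkConv (h : rec.Sound) (hΓ : WellFormed Γ) {t T : Tm} {S : List Tm × Tm}
    (e : tcCheckConv F rec Γ t T = some S) (hT : IsType Γ T) : HasType Γ t T := by
  rw [tcCheckConv, andThen_eq_some_iff] at e
  obtain ⟨r, hr, e⟩ := e
  cases hc : conv F (esub r.1 0 r.2) T with
  | false => rw [hc] at e; cases e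
  | true =>
    rw [esub_zero] at hc
    exact .conv (h.infer hΓ hr).1 (conv_sound F _ _ hc) hT.choose_spec

theorem Checker.Sound.checkInf (h : rec.Sound) (hΓ : WellFormed Γ) {t T : Tm} {S : List Tm × Tm}
    (e : tcCheckInf F rec Γ t T = some S) (hT : IsType Γ T) : HasType Γ t T := by
  cases T with
  | univ j =>
    replace e : (andThen (sortOf F rec Γ t) fun i => tcCheckUniv i j) = some S := e
    simp only [tcCheckUniv, andThen_eq_some_iff] at e
    obtain ⟨i, hi, e⟩ := e
    cases hij : i.ble j with
    | false => rw [hij] at e; cases e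
    | true => exact (h.sort hΓ hi).le (Nat.le_of_ble_eq_true hij)
  | var | pi | lam | app | const => exact h.checkConv hΓ e hT

theorem Checker.Sound.checkStep (h : rec.Sound) (hΓ : WellFormed Γ) {t T : Tm} {S : List Tm × Tm}
    (e : tcCheck F rec Γ t T = some S) (hT : IsType Γ T) : HasType Γ t T := by
  rw [tcCheck] at e
  rcases ifLam_cases t (fun _ => tcCheckInf F rec Γ t T) fun A b =>
    ifPi T (fun _ => tcCheckConv F rec Γ t T) fun A' B => tcCheckLam F rec Γ A b A' B
    with ⟨A, b, rfl, e'⟩ | e'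
  · rw [e'] at e
    rcases ifPi_cases T (fun _ => tcCheckConv F rec Γ (Tm.lam A b) T) fun A' B =>
      tcCheckLam F rec Γ A b A' B with ⟨A', B, rfl, e''⟩ | e''
    · rw [e'', tcCheckLam, andThen_eq_some_iff] at e
      obtain ⟨i, hA, e⟩ := e
      have hA := h.sort hΓ hA
      cases hc : conv F A A' with
      | false => rw [hc] at e; cases e
      | true =>
        rw [hc] at e
        have hc := conv_sound F _ _ hc
        obtain ⟨⟨j, hA'⟩, k, hB⟩ := hT.choose_spec.pi_inv
        -- The body is checked under the annotation `A`, whereas `B` is known to be a type under the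
        -- convertible `A'`.
        have hb := h.check (hΓ.cons ⟨i, hA⟩) e ⟨k, hB.conv_head hA' hA hc⟩
        exact .conv (.lam hA hb) (.pi hc (.refl _)) hT.choose_spec
    · rw [e''] at e; exact h.checkConv hΓ e hT
  · rw [e'] at e; exact h.checkInf hΓ e hT

theorem tc_sound {allow : Const → Bool} (hc : AllowedTypes allow) (F : ℕ) :
    Checker.Sound (tc allow F) := by
  induction F with
  | zero => exact ⟨fun _ h => (by cases h), fun _ h => (by cases h)⟩
  | succ F ih => exact ⟨fun hΓ e => ih.inferStep hc hΓ e, fun hΓ e hT => ih.checkStep hΓ e hT⟩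

end Tm
end HoTT

namespace HoTT
open Tm

/-! Constants whose types the checker may use -/

/-- The stages `allow₁`, `allow₂`, `allow₃`, `allow` order the constants so that the type of each
mentions only constants of earlier stages. It can then be checked by the checker for those. Of the
univalence axioms only that for `univ 0` is admitted. -/
noncomputable def allow₁ (c : Const) : Bool := c.code.beq 13 || (c.code.beq 16 || c.code.beq 19)
noncomputable def allow₂ (c : Const) : Bool := allow₁ c || (c.code.beq 14 || c.code.beq 17)
noncomputable def allow₃ (c : Const) : Bool := allow₂ c || (c.code.beq 15 || c.code.beq 18)
noncomputable def allow (c : Const) : Bool := allow₃ c || (c.code.beq 23 || c.code.beq 24)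

noncomputable def isTypeTest (al : Const → Bool) (c : Const) : Bool :=
  (sortOf 100 (tc al 100) [] (c.type constLevel constLevel)).isSome

theorem isType_of_test {al : Const → Bool} (h : AllowedTypes al) {c : Const}
    (e : isTypeTest al c = true) : IsType [] (c.type constLevel constLevel) := by
  obtain ⟨i, hi⟩ := Option.isSome_iff_exists.1 e
  exact ⟨i, (tc_sound h 100).sort .nil hi⟩

theorem Tm.AllowedTypes.or {al : Const → Bool} (h : AllowedTypes al) {c₁ c₂ : Const}
    (e₁ : isTypeTest al c₁ = true) (e₂ : isTypeTest al c₂ = true) :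
    AllowedTypes fun c => al c || (c.code.beq c₁.code || c.code.beq c₂.code) := by
  intro c hc
  rw [Bool.or_eq_true, Bool.or_eq_true] at hc
  rcases hc with hc | hc | hc
  · exact h c hc
  · cases eq_of_code hc; exact isType_of_test h e₁
  · cases eq_of_code hc; exact isType_of_test h e₂

theorem Tm.AllowedTypes.none : AllowedTypes fun _ => false := fun _ h => by cases h

theorem allowedTypes₁ : AllowedTypes allow₁ := by
  -- Constants are added in pairs, and the first stage has three; hence the repetition.
  have h := AllowedTypes.none.or (c₁ := .sigma) (c₂ := .sigma) (by decide +kernel) (by decide +kernel)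
  have h' := AllowedTypes.none.or (c₁ := .ident) (c₂ := .trunc) (by decide +kernel) (by decide +kernel)
  intro c hc
  rw [allow₁, Bool.or_eq_true] at hc
  rcases hc with hc | hc
  · exact h c (Bool.or_eq_true _ _ ▸ .inr (Bool.or_eq_true _ _ ▸ .inl hc))
  · exact h' c hc

theorem allowedTypes₂ : AllowedTypes allow₂ :=
  allowedTypes₁.or (c₁ := .pair) (c₂ := .refl) (by decide +kernel) (by decide +kernel)

theorem allowedTypes₃ : AllowedTypes allow₃ :=
  allowedTypes₂.or (c₁ := .sigmaInd) (c₂ := .identInd) (by decide +kernel) (by decide +kernel)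

theorem allowedTypes : AllowedTypes allow :=
  allowedTypes₃.or (c₁ := .funext) (c₂ := .ua 0) (by decide +kernel) (by decide +kernel)

/-! Extensions of a context by theorems -/

def fuel : ℕ := 4000

/-- A type and an inhabitant. -/
structure Decl : Type where
  type : Ex
  term : Ex

noncomputable def Decl.test (Γ : List Tm) (n : ℕ) (d : Decl) : Bool :=
  (sortOf fuel (tc allow fuel) Γ (d.type.toTm n)).isSome &&
    (tc allow fuel Γ (d.term.toTm n) (some (d.type.toTm n))).isSome

theorem Decl.hasType_of_test {Γ : List Tm} (hΓ : WellFormed Γ) {n : ℕ} {d : Decl}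
    (h : d.test Γ n = true) :
    IsType Γ (d.type.toTm n) ∧ HasType Γ (d.term.toTm n) (d.type.toTm n) := by
  rw [test, Bool.and_eq_true] at h
  obtain ⟨i, hi⟩ := Option.isSome_iff_exists.1 h.1
  obtain ⟨S, hS⟩ := Option.isSome_iff_exists.1 h.2
  have hT : IsType Γ (d.type.toTm n) := ⟨i, (tc_sound allowedTypes fuel).sort hΓ hi⟩
  exact ⟨hT, (tc_sound allowedTypes fuel).check hΓ hS hT⟩

def extend (Γ : List Tm) : ℕ → List Decl → List Tm
  | _, [] => Γ
  | n, d :: ds => extend (d.type.toTm n :: Γ) n.succ ds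

noncomputable def testAll (Γ : List Tm) : ℕ → List Decl → Bool
  | _, [] => true
  | n, d :: ds => d.test Γ n && testAll (d.type.toTm n :: Γ) n.succ ds

/-- `Γ` extends `Γ₀` by `d` types that are inhabited over `Γ₀`. -/
structure Conservative (Γ₀ Γ : List Tm) (d : ℕ) : Prop where
  wellFormed : WellFormed Γ
  descend : ∀ {T t : Tm}, HasType Γ t (T.rename fun n => n + d) → ∃ t', HasType Γ₀ t' T
  strengthen : ∀ {T t : Tm}, HasType Γ (t.rename fun n => n + d) (T.rename fun n => n + d) →
    HasType Γ₀ t T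

theorem Conservative.refl {Γ : List Tm} (h : WellFormed Γ) : Conservative Γ Γ 0 :=
  ⟨h, fun {T t} ht => ⟨t, by rw [rename_eq_subst] at ht; exact subst_var T ▸ ht⟩, fun {T t} ht => by
    rw [rename_eq_subst, rename_eq_subst] at ht; exact subst_var T ▸ subst_var t ▸ ht⟩

theorem inst_rename_add (T a : Tm) (d : ℕ) :
    (T.rename fun n => n + (d + 1)).inst a = T.rename fun n => n + d := by
  rw [inst, subst_rename, rename_eq_subst]; rfl

/-- The proof `a` is substituted for the new variable. This variable does not occur in the lifted
`T`, nor, for `strengthen`, in the lifted `t`. -/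
theorem Conservative.cons {Γ₀ Γ : List Tm} {d : ℕ} (h : Conservative Γ₀ Γ d) {A a : Tm}
    (hA : IsType Γ A) (ha : HasType Γ a A) : Conservative Γ₀ (A :: Γ) (d + 1) where
  wellFormed := h.wellFormed.cons hA
  descend {T t} ht := by
    have := ht.inst ha
    rw [inst_rename_add] at this
    exact h.descend this
  strengthen {T t} ht := by
    have := ht.inst ha
    rw [inst_rename_add, inst_rename_add] at this
    exact h.strengthen this

theorem Conservative.extend {Γ₀ Γ : List Tm} {d n : ℕ} (h : Conservative Γ₀ Γ d) (ds : List Decl)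
    (e : testAll Γ n ds = true) : Conservative Γ₀ (extend Γ n ds) (d + ds.length) := by
  induction ds generalizing Γ d n with
  | nil => exact h
  | cons D ds ih =>
    rw [testAll, Bool.and_eq_true] at e
    obtain ⟨hT, ht⟩ := Decl.hasType_of_test h.wellFormed e.1
    have := ih (h.cons hT ht) e.2
    rwa [Nat.add_assoc, Nat.add_comm 1] at this

/-! Universe levels -/

namespace Tm

def shiftConst (s : ℕ) : Const → Const
  | .ua i => .ua (s + i)
  | c => c

/-- Raises all universe levels by `s`. -/
def shift (s : ℕ) : Tm → Tm
  | var n => var n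
  | univ i => univ (s + i)
  | pi A B => pi (shift s A) (shift s B)
  | lam A b => lam (shift s A) (shift s b)
  | app f a => app (shift s f) (shift s a)
  | const c => const (shiftConst s c)

variable (s : ℕ)

theorem shift_rename (t : Tm) (ξ : ℕ → ℕ) : (t.rename ξ).shift s = (t.shift s).rename ξ := by
  induction t generalizing ξ with
  | var | univ | const => rfl
  | pi A B hA hB | lam A B hA hB | app A B hA hB => simp only [rename, shift, hA, hB]

theorem shift_liftSub (σ : ℕ → Tm) (n : ℕ) :
    (liftSub σ n).shift s = liftSub (fun m => (σ m).shift s) n := by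
  cases n with
  | zero => rfl
  | succ n => exact shift_rename s _ _

theorem shift_subst (t : Tm) (σ : ℕ → Tm) :
    (t.subst σ).shift s = (t.shift s).subst fun n => (σ n).shift s := by
  induction t generalizing σ with
  | var | univ | const => rfl
  | pi A B hA hB | lam A B hA hB => simp only [subst, shift, hA, hB, shift_liftSub]
  | app A B hA hB => simp only [subst, shift, hA, hB]

theorem shift_inst (b a : Tm) : (b.inst a).shift s = (b.shift s).inst (a.shift s) := by
  simp only [inst, shift_subst]
  congr 1; funext n; cases n <;> rfl

theorem shift_apps (f : Tm) (as : List Tm) :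
    (apps f as).shift s = apps (f.shift s) (as.map (shift s)) := by
  induction as generalizing f with
  | nil => rfl
  | cons a as ih => exact ih (app f a)

end Tm

theorem Compute.shift (s : ℕ) {a b : Tm} (h : Compute a b) : Compute (a.shift s) (b.shift s) := by
  cases h <;> simp only [shift_apps, List.map, Tm.shift, shiftConst] <;> constructor

theorem Conv.shift (s : ℕ) {a b : Tm} (h : Conv a b) : Conv (a.shift s) (b.shift s) := by
  induction h with
  | refl a => exact .refl _
  | symm _ ih => exact ih.symm
  | trans _ _ ih ih' => exact ih.trans ih'
  | pi _ _ ih ih' => exact .pi ih ih'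
  | lam _ _ ih ih' => exact .lam ih ih'
  | app _ _ ih ih' => exact .app ih ih'
  | beta A b a => rw [shift_inst]; exact .beta _ _ _
  | eta A f => simp only [Tm.shift, wk, shift_rename]; exact .eta _ _
  | compute h => exact .compute (h.shift s)

/-- The types `empty`, `unit` and `nat` sit in `univ 0` whatever the level parameters, so their
shifted typing uses cumulativity. `ua` carries its universe along; all other types shift with their
parameters. -/
theorem HasType.const_shift (s : ℕ) (Γ : List Tm) (c : Const) (i k : ℕ) :
    HasType Γ ((Tm.const c).shift s) ((c.type i k).shift s) := by
  cases c with
  | empty => exact (HasType.const Γ .empty i k).le (Nat.zero_le s)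
  | unit => exact (HasType.const Γ .unit i k).le (Nat.zero_le s)
  | nat => exact (HasType.const Γ .nat i k).le (Nat.zero_le s)
  | ua j => exact .const Γ (.ua (s + j)) (s + i) (s + k)
  | _ => exact .const Γ _ (s + i) (s + k)

theorem HasType.shift (s : ℕ) {Γ : List Tm} {t T : Tm} (h : HasType Γ t T) :
    HasType (Γ.map (Tm.shift s)) (t.shift s) (T.shift s) := by
  induction h with
  | var hn => rw [shift_rename]; exact .var (by rw [List.getElem?_map, hn]; rfl)
  | univ Γ i => exact .univ _ (s + i)
  | cumul _ ih => exact .cumul ih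
  | pi _ _ ih ih' => exact .pi ih ih'
  | lam _ _ ih ih' => exact .lam ih ih'
  | app _ _ ih ih' => rw [shift_inst]; exact .app ih ih'
  | const Γ c i k => exact .const_shift s _ c i k
  | conv _ hc _ ih ih' => exact .conv ih (hc.shift s) ih'

namespace Modality
open Ex

/-- The modality that `forallModality 0` binds. -/
def generic : Modality := ⟨0, boundVar 0, boundVar 1, boundVar 2, boundVar 3, boundVar 4⟩

def genericContext : List Tm :=
  [(pi (univ 0) fun A => pi (generic.bang A) fun u => pi (generic.bang A) fun v =>
      isEquiv (eq (generic.bang A) u v) (generic.bang (eq (generic.bang A) u v))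
        (generic.unit (eq (generic.bang A) u v))).toTm 4,
   (pi (univ 0) fun A => pi (arr (generic.bang A) (univ 0)) fun P =>
      pi (pi A fun a => generic.bang (P (generic.unit A a))) fun f => pi A fun a =>
        eq (generic.bang (P (generic.unit A a))) (generic.ind A P f (generic.unit A a)) (f a)).toTm 3,
   (pi (univ 0) fun A => pi (arr (generic.bang A) (univ 0)) fun P =>
      arr (pi A fun a => generic.bang (P (generic.unit A a)))
        (pi (generic.bang A) fun u => generic.bang (P u))).toTm 2,
   (pi (univ 0) fun X => arr X (generic.bang X)).toTm 1,
   (arr (univ 0) (univ 0)).toTm 0]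

/-- Inverting this iterated Π-type gives the well-formedness of the generic context. -/
theorem forallModality_test :
    (sortOf fuel (tc allow fuel) [] (forallModality 0 fun _ => univ 0).close).isSome = true := by
  decide +kernel

theorem wellFormed_of_pi {Γ Δ : List Tm} {T : Tm} (hΓ : WellFormed Γ)
    (h : IsType Γ (Δ.foldl (fun T A => Tm.pi A T) T)) : WellFormed (Δ ++ Γ) ∧ IsType (Δ ++ Γ) T := by
  induction Δ generalizing T with
  | nil => exact ⟨hΓ, h⟩
  | cons A Δ ih =>
    obtain ⟨h1, i, h2⟩ := ih h
    obtain ⟨hA, hT⟩ := h2.pi_inv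
    exact ⟨h1.cons hA, hT⟩

theorem isType_pis {Γ Δ : List Tm} {S T : Tm} (hΓ : WellFormed Γ)
    (h : IsType Γ (Δ.foldl (fun T A => Tm.pi A T) S)) (hT : IsType (Δ ++ Γ) T) :
    IsType Γ (Δ.foldl (fun T A => Tm.pi A T) T) := by
  induction Δ generalizing S T with
  | nil => exact hT
  | cons A Δ ih =>
    obtain ⟨-, i, hp⟩ := wellFormed_of_pi (Δ := Δ) hΓ h
    obtain ⟨⟨j, hA⟩, -⟩ := hp.pi_inv
    obtain ⟨k, hT⟩ := hT
    exact ih h ⟨max j k, .pi (hA.le (le_max_left _ _)) (hT.le (le_max_right _ _))⟩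

theorem hasType_lams {Γ Δ : List Tm} {t T : Tm} (h : IsType Γ (Δ.foldl (fun T A => Tm.pi A T) T))
    (hΓ : WellFormed Γ) (ht : HasType (Δ ++ Γ) t T) :
    ∃ t', HasType Γ t' (Δ.foldl (fun T A => Tm.pi A T) T) := by
  induction Δ generalizing t T with
  | nil => exact ⟨t, ht⟩
  | cons A Δ ih =>
    obtain ⟨-, i, hp⟩ := wellFormed_of_pi (Δ := Δ) hΓ h
    exact ih h (.lam hp.pi_inv.1.choose_spec ht)

theorem genericContext_isType :
    IsType [] (genericContext.foldl (fun T A => Tm.pi A T) (.univ 0)) := by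
  obtain ⟨i, hi⟩ := Option.isSome_iff_exists.1 forallModality_test
  exact ⟨i, (tc_sound allowedTypes fuel).sort .nil hi⟩

theorem genericContext_wellFormed : WellFormed genericContext := by
  have h := (wellFormed_of_pi .nil genericContext_isType).1
  rwa [List.append_nil] at h

/-- The type that `HoldsForAllMaps 0 T` asserts to be inhabited, over `genericContext`. -/
def forallMaps (T : Modality → Ex → Ex → Ex → Ex) : Ex :=
  pi (univ 0) fun X => pi (univ 0) fun Y => pi (arr X Y) fun f => T generic X Y f

/-- The type with number `k` in `Γ` is `T` in a context with `d` variables less. -/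
noncomputable def lemmaTest (Γ : List Tm) (d k : ℕ) (T : Tm) : Bool :=
  Option.rec false (fun A => beq (lift k.succ A 0) (lift d T 0)) (look Γ k)

/-- Suppose that one of the types by which the generic context is extended is the type that
`HoldsForAllMaps 0 T` asserts to be inhabited, and that `T` is uniform in the universe. -/
theorem holdsForAllMaps_of_test {Γ : List Tm} {d : ℕ} (hΓ : Conservative genericContext Γ d) (k : ℕ)
    {i : ℕ} {T : Modality → Ex → Ex → Ex → Ex}
    (h : lemmaTest Γ d k ((forallMaps T).toTm 5) = true)
    (hi : (forallModality 0 fun M => pi (univ 0) fun X => pi (univ 0) fun Y => pi (arr X Y) fun f =>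
        T M X Y f).close.shift i =
      (forallModality i fun M => pi (univ i) fun X => pi (univ i) fun Y => pi (arr X Y) fun f =>
        T M X Y f).close) :
    HoldsForAllMaps i T := by
  rw [lemmaTest, look_eq] at h
  obtain ⟨A, hA⟩ : ∃ A, Γ[k]? = some A := by
    cases e : Γ[k]? with
    | none => rw [e] at h; cases h
    | some A => exact ⟨A, rfl⟩
  rw [hA] at h
  have e := beq_eq h
  rw [lift_zero_eq, lift_zero_eq] at e
  have ht : HasType Γ (.var k) _ := .var hA
  obtain ⟨j, hj⟩ := hΓ.wellFormed k A hA
  rw [show (fun m => m + (k + 1)) = fun m => m + k.succ from rfl, e] at ht hj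
  -- The variable proves the statement in the extended context; substituting the proofs of the
  -- lemmas leaves a proof over the generic context.
  obtain ⟨t', ht'⟩ := hΓ.descend ht
  have hT : IsType (genericContext ++ []) ((forallMaps T).toTm 5) := by
    rw [List.append_nil]
    -- The statement mentions no lemma, so substituting for the lemmas leaves it unchanged as a term
    -- and its formation descends.
    exact ⟨j, hΓ.strengthen (t := (forallMaps T).toTm 5) (T := .univ j) hj⟩
  have ht' : HasType (genericContext ++ []) t' ((forallMaps T).toTm 5) := by rwa [List.append_nil]
  obtain ⟨t'', ht''⟩ := hasType_lams (isType_pis .nil genericContext_isType hT) .nil ht'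
  -- Up to here the modality lives on `univ 0`; now the whole derivation is raised.
  have := ht''.shift i
  rw [HoldsForAllMaps, Provable, ← hi]
  exact ⟨_, this⟩

end Modality
end HoTT

/-! ### Notation for internal statements and proofs -/

namespace HoTT

/-- A term with a claimed type. The claim is not checked here; it serves to infer the arguments
that the syntax needs. -/
structure Trm (T : Ex) : Type where
  val : Ex

namespace Trm
open Ex

instance (T : Ex) : CoeOut (Trm T) Ex := ⟨Trm.val⟩

variable {A B : Ex} {P : Ex → Ex} {x y z : Ex}

/-- Claims another type, which should be convertible. -/
def c {S T : Ex} (t : Trm S) : Trm T := ⟨t.val⟩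

def lam {B : Ex → Ex} (b : (x : Trm A) → Trm (B x.val)) : Trm (pi A B) :=
  ⟨Ex.lam A fun x => (b ⟨x⟩).val⟩

def app {B : Ex → Ex} (f : Trm (pi A B)) (a : Trm A) : Trm (B a.val) := ⟨f.val a.val⟩

def pair (a : Trm A) (b : Trm (P a.val)) : Trm (sig A P) := ⟨dpair A P a.val b.val⟩
def fst (p : Trm (sig A P)) : Trm A := ⟨Ex.fst A P p.val⟩
def snd (p : Trm (sig A P)) : Trm (P (Ex.fst A P p.val)) := ⟨Ex.snd A P p.val⟩

/-- Induction on a pair. -/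
def split (p : Trm (sig A P)) (C : Ex → Ex)
    (d : (a : Trm A) → (b : Trm (P a.val)) → Trm (C (dpair A P a.val b.val))) : Trm (C p.val) :=
  ⟨Ex.const .sigmaInd A (Ex.lam A P) (Ex.lam (sig A P) C)
    (Ex.lam A fun a => Ex.lam (P a) fun b => (d ⟨a⟩ ⟨b⟩).val) p.val⟩

/-- Reflexivity, for convertible endpoints. -/
def rfl : Trm (eq A x y) := ⟨Ex.rfl A x⟩
def inv (p : Trm (eq A x y)) : Trm (eq A y x) := ⟨Ex.inv A x y p.val⟩
def trans (p : Trm (eq A x y)) (q : Trm (eq A y z)) : Trm (eq A x z) :=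
  ⟨Ex.concat A x y z p.val q.val⟩
/-- Concatenation, where the middle points need only be convertible. -/
def trans' {A' y' : Ex} (p : Trm (eq A x y)) (q : Trm (eq A' y' z)) : Trm (eq A x z) := p.trans q.c
def ap (p : Trm (eq A x y)) (f : Ex → Ex) : Trm (eq B (f x) (f y)) :=
  ⟨Ex.ap A B (Ex.lam A f) x y p.val⟩

/-- Path induction with both endpoints free. -/
def ind (p : Trm (eq A x y)) (C : Ex → Ex → Ex → Ex)
    (d : (x : Trm A) → Trm (C x.val x.val (Ex.rfl A x.val))) : Trm (C x y p.val) :=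
  ⟨Ex.const .identInd A
    (Ex.lam A fun x => Ex.lam A fun y => Ex.lam (eq A x y) fun p => C x y p)
    (Ex.lam A fun x => (d ⟨x⟩).val) x y p.val⟩

/-- Path induction with a fixed left endpoint, into the universe `univ 2`. -/
def indL (p : Trm (eq A x y)) (C : Ex → Ex → Ex) (d : Trm (C x (Ex.rfl A x))) : Trm (C y p.val) :=
  ⟨Ex.const .identInd A
    (Ex.lam A fun x => Ex.lam A fun y => Ex.lam (eq A x y) fun p =>
      -- Quantifying over all based motives inside the free-endpoint motive yields based path
      -- induction. This type lies in `univ 3`, which accounts for `constLevel`.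
      pi (pi A fun y => arr (eq A x y) (univ 2)) fun C => arr (C x (Ex.rfl A x)) (C y p))
    (Ex.lam A fun x => Ex.lam (pi A fun y => arr (eq A x y) (univ 2)) fun C =>
      Ex.lam (C x (Ex.rfl A x)) fun d => d)
    x y p.val (Ex.lam A fun y => Ex.lam (eq A x y) fun p => C y p) d.val⟩

/-- Path induction with a fixed right endpoint, into the universe `univ 2`. -/
def indR (p : Trm (eq A x y)) (C : Ex → Ex → Ex) (d : Trm (C y (Ex.rfl A y))) : Trm (C x p.val) :=
  ⟨Ex.const .identInd A
    (Ex.lam A fun x => Ex.lam A fun y => Ex.lam (eq A x y) fun p =>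
      pi (pi A fun x => arr (eq A x y) (univ 2)) fun C => arr (C y (Ex.rfl A y)) (C x p))
    (Ex.lam A fun y => Ex.lam (pi A fun x => arr (eq A x y) (univ 2)) fun C =>
      Ex.lam (C y (Ex.rfl A y)) fun d => d)
    x y p.val (Ex.lam A fun x => Ex.lam (eq A x y) fun p => C x p) d.val⟩

def transport (p : Trm (eq A x y)) (P : Ex → Ex) (u : Trm (P x)) : Trm (P y) :=
  ⟨Ex.const .identInd A
    (Ex.lam A fun x => Ex.lam A fun y => Ex.lam (eq A x y) fun _ => arr (P x) (P y))
    (Ex.lam A fun x => Ex.lam (P x) fun u => u) x y p.val u.val⟩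

instance : CoeFun (Trm (pi A P)) fun _ => (a : Trm A) → Trm (P a.val) := ⟨app⟩
instance : CoeFun (Trm (arr A B)) fun _ => Trm A → Trm B := ⟨fun f a => app f a⟩

def prop (h : Trm (isProp A)) (x y : Trm A) : Trm (eq A x.val y.val) := ⟨h.val x.val y.val⟩

/-- Application to several arguments, without inference. -/
def apps {S T : Ex} (f : Trm S) (as : List Ex) : Trm T := ⟨as.foldl Ex.app f.val⟩

def contr (a : Trm A) (h : (x : Trm A) → Trm (eq A a.val x.val)) : Trm (isContr A) :=
  pair a (lam h)
def center (h : Trm (isContr A)) : Trm A := fst h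
def contract (h : Trm (isContr A)) (x : Trm A) : Trm (eq A h.center.val x.val) :=
  (snd h).c.app (B := fun x => eq A h.center.val x) x

section
variable {f : Ex} {b : Ex}
def fibMk (x : Trm A) (p : Trm (eq B (f x.val) y)) : Trm (fib A B f y) :=
  ⟨Ex.fibMk A B f y x.val p.val⟩
def pt (w : Trm (fib A B f y)) : Trm A := ⟨fibPt A B f y w.val⟩
def path (w : Trm (fib A B f y)) : Trm (eq B (f w.pt.val) y) := ⟨fibPath A B f y w.val⟩
def fiber (e : Trm (isEquiv A B f)) (b : Trm B) : Trm (isContr (fib A B f b.val)) := app e b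
def preimage (e : Trm (isEquiv A B f)) (b : Trm B) : Trm A := ⟨equivInv A B f e.val b.val⟩
def fibInd (w : Trm (fib A B f y)) (C : Ex → Ex)
    (d : (x : Trm A) → (p : Trm (eq B (f x.val) y)) → Trm (C (Ex.fibMk A B f y x.val p.val))) :
    Trm (C w.val) :=
  split w C d
end

end Trm

/-- Statements of lemmas. Arguments bound by `all`, `fam`, `imp` and `raw` are, in this order,
implicit, implicit families of types, explicit, and explicit without a type when the lemma is used. -/
inductive Stmt : Type
  | all (A : Ex) (s : Ex → Stmt)
  | fam (A : Ex) (k : ℕ) (s : (Ex → Ex) → Stmt)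
  | imp (A : Ex) (s : Ex → Stmt)
  | raw (A : Ex) (s : Ex → Stmt)
  | concl (A : Ex)

namespace Stmt
open Ex

def toEx : Stmt → Ex
  | all A s => pi A fun x => (s x).toEx
  | fam A k s => pi (arr A (univ k)) fun P => (s fun x => P x).toEx
  | imp A s => pi A fun x => (s x).toEx
  | raw A s => pi A fun x => (s x).toEx
  | concl A => A

/-- Proofs from arguments. -/
def Proof : Stmt → Type
  | all _ s => (x : Ex) → (s x).Proof
  | fam _ _ s => (P : Ex → Ex) → (s P).Proof
  | imp A s => (x : Trm A) → (s x.val).Proof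
  | raw _ s => (x : Ex) → (s x).Proof
  | concl A => Trm A

/-- The ways to use a lemma. -/
def Use : Stmt → Type
  | all _ s => {x : Ex} → (s x).Use
  | fam _ _ s => {P : Ex → Ex} → (s P).Use
  | imp A s => (x : Trm A) → (s x.val).Use
  | raw _ s => (x : Ex) → (s x).Use
  | concl A => Trm A

def lam : (s : Stmt) → s.Proof → Ex
  | all A s, p => Ex.lam A fun x => (s x).lam (p x)
  | fam A k s, p => Ex.lam (arr A (univ k)) fun P => (s fun x => P x).lam (p fun x => P x)
  | imp A s, p => Ex.lam A fun x => (s x).lam (p ⟨x⟩)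
  | raw A s, p => Ex.lam A fun x => (s x).lam (p x)
  | concl _, t => t.val

def implicit {α : Type} {β : α → Type} (f : (x : α) → β x) (x : α) : β x := f x

def use : (s : Stmt) → Ex → s.Use
  | all _ s, t => implicit (fun x => (s x).use (t x)) _
  -- The lemma is applied to the abstraction `λ x, P x`. The redexes that this leaves in its type
  -- are resolved by the convertibility test.
  | fam A _ s, t => implicit (fun P => (s P).use (t (Ex.lam A P))) _
  | imp _ s, t => fun x => (s x.val).use (t x.val)
  | raw _ s, t => fun x => (s x).use (t x)
  | concl _, t => ⟨t⟩

/-- The theorem with number `n`: the variable that stands for it in the context. -/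
def thm (s : Stmt) (n : ℕ) {β : Type} (h : s.Use = β) : β := h ▸ s.use (boundVar (n + 5))

/-- Quantification over types. -/
abbrev type (s : Ex → Stmt) : Stmt := all (univ 2) s
abbrev small (s : Ex → Stmt) : Stmt := all (univ 0) s

def decl (s : Stmt) (p : s.Proof) : Decl := ⟨s.toEx, s.lam p⟩

end Stmt
end HoTT

/-! ### Paths, fibers and pairs -/

namespace HoTT.Internal
open Ex

/-- `concat` is defined by induction on its first path, so `rfl` is a left unit by computation, but
a right unit only by path induction. -/
abbrev transRefl.stmt : Stmt :=
  .type fun A => .all A fun x => .all A fun y => .imp (eq A x y) fun p =>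
    .concl (eq (eq A x y) (concat A x y y p (rfl A y)) p)
def transRefl := transRefl.stmt.thm 0 (by dsimp only [Stmt.Use])
def transRefl.proof : transRefl.stmt.Proof :=
  fun A _ _ p => p.ind (fun x y p => eq (eq A x y) (concat A x y y p (rfl A y)) p) fun _ => .rfl

def transRefl.context : List Tm :=
  -- The five variables of the generic modality precede the lemmas.
  extend Modality.genericContext 5 [transRefl.stmt.decl transRefl.proof]

theorem transRefl.conservative : Conservative Modality.genericContext transRefl.context 1 :=
  (Conservative.refl Modality.genericContext_wellFormed).extend _ (by decide +kernel)

abbrev invTrans.stmt : Stmt :=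
  .type fun A => .all A fun x => .all A fun y => .imp (eq A x y) fun p =>
    .concl (eq (eq A y y) (concat A y x y (inv A x y p) p) (rfl A y))
def invTrans := invTrans.stmt.thm 1 (by dsimp only [Stmt.Use])
def invTrans.proof : invTrans.stmt.Proof :=
  fun A _ _ p =>
    p.ind (fun x y p => eq (eq A y y) (concat A y x y (inv A x y p) p) (rfl A y)) fun _ => .rfl

def invTrans.context : List Tm := extend transRefl.context 6 [invTrans.stmt.decl invTrans.proof]

theorem invTrans.conservative : Conservative Modality.genericContext invTrans.context 2 :=
  transRefl.conservative.extend _ (by decide +kernel)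

abbrev transAssoc.stmt : Stmt :=
  .type fun A => .all A fun x => .all A fun y => .all A fun z => .all A fun w =>
    .imp (eq A x y) fun p => .imp (eq A y z) fun q => .imp (eq A z w) fun r =>
    .concl (eq (eq A x w) (concat A x z w (concat A x y z p q) r)
      (concat A x y w p (concat A y z w q r)))
def transAssoc := transAssoc.stmt.thm 2 (by dsimp only [Stmt.Use])
def transAssoc.proof : transAssoc.stmt.Proof :=
  fun A _ y z w p q r =>
    p.indR (fun x p => eq (eq A x w) (concat A x z w (concat A x y z p q) r)
      (concat A x y w p (concat A y z w q r))) .rfl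

def transAssoc.context : List Tm :=
  extend invTrans.context 7 [transAssoc.stmt.decl transAssoc.proof]

theorem transAssoc.conservative : Conservative Modality.genericContext transAssoc.context 3 :=
  invTrans.conservative.extend _ (by decide +kernel)

/-- Cancels `p` against its inverse. -/
abbrev transInvCancel.stmt : Stmt :=
  .type fun A => .all A fun x => .all A fun y => .all A fun z =>
    .imp (eq A x y) fun p => .imp (eq A x z) fun q =>
    .concl (eq (eq A x z) (concat A x y z p (concat A y x z (inv A x y p) q)) q)
def transInvCancel := transInvCancel.stmt.thm 3 (by dsimp only [Stmt.Use])
def transInvCancel.proof : transInvCancel.stmt.Proof :=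
  fun A x _ z p q =>
    p.indL (fun y p => eq (eq A x z) (concat A x y z p (concat A y x z (inv A x y p) q)) q) .rfl

def transInvCancel.context : List Tm :=
  extend transAssoc.context 8 [transInvCancel.stmt.decl transInvCancel.proof]

theorem transInvCancel.conservative : Conservative Modality.genericContext transInvCancel.context 4 :=
  transAssoc.conservative.extend _ (by decide +kernel)

/-- Equality of points of a fiber. -/
abbrev fibEq.stmt : Stmt :=
  .type fun A => .type fun B => .raw (arr A B) fun f => .all B fun y => .all A fun x =>
    .all A fun x' => .imp (eq B (f x) y) fun q => .imp (eq B (f x') y) fun q' =>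
    .imp (eq A x x') fun p =>
    .imp (eq (eq B (f x) y) q (concat B (f x) (f x') y (ap A B f x x' p) q')) fun _ =>
    .concl (eq (fib A B f y) (fibMk A B f y x q) (fibMk A B f y x' q'))
def fibEq := fibEq.stmt.thm 4 (by dsimp only [Stmt.Use])
def fibEq.proof : fibEq.stmt.Proof :=
  fun A B f y x x' q q' p r =>
    let C := fun x p => pi (eq B (f x) y) fun q =>
      arr (eq (eq B (f x) y) q (concat B (f x) (f x') y (ap A B f x x' p) q'))
        (eq (fib A B f y) (fibMk A B f y x q) (fibMk A B f y x' q'))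
    let d : Trm (C x' (rfl A x')) := .lam fun _ => .lam fun r =>
      (r.ap (B := fib A B f y) fun q => fibMk A B f y x' q).c
    (((p.indR C d).app q).c : Trm (arr _ _)).app r

def fibEq.context : List Tm := extend transInvCancel.context 9 [fibEq.stmt.decl fibEq.proof]

theorem fibEq.conservative : Conservative Modality.genericContext fibEq.context 5 :=
  transInvCancel.conservative.extend _ (by decide +kernel)

/-- Equality of pairs. -/
abbrev pairEq.stmt : Stmt :=
  .type fun A => .fam A 2 fun P => .all A fun a => .all A fun a' => .all (P a) fun b =>
    .all (P a') fun b' => .imp (eq A a a') fun p =>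
    .imp (eq (P a') (Trm.transport (A := A) (x := a) (y := a') ⟨p⟩ P ⟨b⟩).val b') fun _ =>
    .concl (eq (sig A P) (dpair A P a b) (dpair A P a' b'))
def pairEq := pairEq.stmt.thm 5 (by dsimp only [Stmt.Use])
def pairEq.proof : pairEq.stmt.Proof :=
  fun A P a a' b b' p r =>
    let C := fun a' p => pi (P a') fun b' =>
      arr (eq (P a') (Trm.transport (A := A) (x := a) (y := a') ⟨p⟩ P ⟨b⟩).val b')
        (eq (sig A P) (dpair A P a b) (dpair A P a' b'))
    let d : Trm (C a (rfl A a)) := .lam fun _ => .lam fun r => (r.ap (B := sig A P) fun b => dpair A P a b).c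
    (((p.indL C d).app ⟨b'⟩).c : Trm (arr _ _)).app r

def pairEq.context : List Tm := extend fibEq.context 10 [pairEq.stmt.decl pairEq.proof]

theorem pairEq.conservative : Conservative Modality.genericContext pairEq.context 6 :=
  fibEq.conservative.extend _ (by decide +kernel)

/-- Transport back and forth. -/
abbrev transportInv.stmt : Stmt :=
  .type fun A => .fam A 2 fun P => .all A fun a => .all A fun a' => .raw (P a') fun b =>
    .imp (eq A a a') fun p =>
    .concl (eq (P a') (Trm.transport (A := A) (x := a) (y := a') ⟨p⟩ P
      (Trm.transport (A := A) (x := a') (y := a) ⟨inv A a a' p⟩ P ⟨b⟩)).val b)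
def transportInv := transportInv.stmt.thm 6 (by dsimp only [Stmt.Use])
def transportInv.proof : transportInv.stmt.Proof :=
  fun A P a a' b p =>
    (p.indL (fun a' p => pi (P a') fun b => eq (P a') (Trm.transport (A := A) (x := a) (y := a') ⟨p⟩ P
      (Trm.transport (A := A) (x := a') (y := a) ⟨inv A a a' p⟩ P ⟨b⟩)).val b)
      (.lam fun _ => .rfl)).app ⟨b⟩

def transportInv.context : List Tm :=
  extend pairEq.context 11 [transportInv.stmt.decl transportInv.proof]

theorem transportInv.conservative : Conservative Modality.genericContext transportInv.context 7 :=
  pairEq.conservative.extend _ (by decide +kernel)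

/-! ### Contractibility and function extensionality -/

abbrev contrPath.stmt : Stmt :=
  .type fun A => .imp (isContr A) fun _ => .raw A fun x => .raw A fun y => .concl (eq A x y)
def contrPath := contrPath.stmt.thm 7 (by dsimp only [Stmt.Use])
def contrPath.proof : contrPath.stmt.Proof :=
  fun _ h x y => (h.contract ⟨x⟩).inv.trans (h.contract ⟨y⟩)

def contrPath.context : List Tm :=
  extend transportInv.context 12 [contrPath.stmt.decl contrPath.proof]

theorem contrPath.conservative : Conservative Modality.genericContext contrPath.context 8 :=
  transportInv.conservative.extend _ (by decide +kernel)

abbrev retractContr.stmt : Stmt :=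
  .type fun A => .type fun B => .imp (isContr A) fun _ => .imp (arr A B) fun r =>
    .imp (arr B A) fun s => .imp (pi B fun b => eq B (r (s b)) b) fun _ => .concl (isContr B)
def retractContr := retractContr.stmt.thm 8 (by dsimp only [Stmt.Use])
def retractContr.proof : retractContr.stmt.Proof :=
  fun _ _ h r s e => .contr (r h.center) fun b => ((h.contract (s b)).ap fun a => r.val a).trans (e b)

def retractContr.context : List Tm :=
  extend contrPath.context 13 [retractContr.stmt.decl retractContr.proof]

theorem retractContr.conservative : Conservative Modality.genericContext retractContr.context 9 :=
  contrPath.conservative.extend _ (by decide +kernel)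

abbrev singletonContr.stmt : Stmt :=
  .type fun A => .raw A fun x => .concl (isContr (sig A fun y => eq A x y))
def singletonContr := singletonContr.stmt.thm 9 (by dsimp only [Stmt.Use])
def singletonContr.proof : singletonContr.stmt.Proof :=
  fun A x =>
    let S := fun y => eq A x y
    .contr (.pair ⟨x⟩ .rfl) fun w =>
      w.split (fun w => eq (sig A S) (dpair A S x (rfl A x)) w) fun _ p =>
        p.indL (fun y p => eq (sig A S) (dpair A S x (rfl A x)) (dpair A S y p)) .rfl

def singletonContr.context : List Tm :=
  extend retractContr.context 14 [singletonContr.stmt.decl singletonContr.proof]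

theorem singletonContr.conservative : Conservative Modality.genericContext singletonContr.context 10 :=
  retractContr.conservative.extend _ (by decide +kernel)

abbrev singletonContr'.stmt : Stmt :=
  .type fun A => .raw A fun x => .concl (isContr (sig A fun y => eq A y x))
def singletonContr' := singletonContr'.stmt.thm 10 (by dsimp only [Stmt.Use])
def singletonContr'.proof : singletonContr'.stmt.Proof :=
  fun A x =>
    let S := fun y => eq A y x
    .contr (.pair ⟨x⟩ .rfl) fun w =>
      w.split (fun w => eq (sig A S) (dpair A S x (rfl A x)) w) fun _ p =>
        p.indR (fun y p => eq (sig A S) (dpair A S x (rfl A x)) (dpair A S y p)) .rfl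

def singletonContr'.context : List Tm :=
  extend singletonContr.context 15 [singletonContr'.stmt.decl singletonContr'.proof]

theorem singletonContr'.conservative : Conservative Modality.genericContext singletonContr'.context 11 :=
  singletonContr.conservative.extend _ (by decide +kernel)

abbrev funExt.stmt : Stmt :=
  .type fun A => .fam A 2 fun P => .all (pi A P) fun f => .all (pi A P) fun g =>
    .imp (pi A fun x => eq (P x) (f x) (g x)) fun _ => .concl (eq (pi A P) f g)
def funExt := funExt.stmt.thm 11 (by dsimp only [Stmt.Use])
def funExt.proof : funExt.stmt.Proof :=
  fun A P f g H =>
    Trm.preimage (A := eq (pi A P) f g) (f := happly A (Ex.lam A P) f g)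
      ⟨const .funext A (Ex.lam A P) f g⟩ H

def funExt.context : List Tm := extend singletonContr'.context 16 [funExt.stmt.decl funExt.proof]

theorem funExt.conservative : Conservative Modality.genericContext funExt.context 12 :=
  singletonContr'.conservative.extend _ (by decide +kernel)

abbrev piContr.stmt : Stmt :=
  .type fun A => .fam A 2 fun P => .imp (pi A fun x => isContr (P x)) fun _ =>
    .concl (isContr (pi A P))
def piContr := piContr.stmt.thm 12 (by dsimp only [Stmt.Use])
def piContr.proof : piContr.stmt.Proof :=
  fun _ _ h => .contr (.lam fun x => (h x).center) fun g =>
    funExt (.lam fun x => ((h x).contract (g.app x)).c)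

def piContr.context : List Tm := extend funExt.context 17 [piContr.stmt.decl piContr.proof]

theorem piContr.conservative : Conservative Modality.genericContext piContr.context 13 :=
  funExt.conservative.extend _ (by decide +kernel)

abbrev sigContr.stmt : Stmt :=
  .type fun A => .fam A 2 fun P => .imp (isContr A) fun _ =>
    .imp (pi A fun x => isContr (P x)) fun _ => .concl (isContr (sig A P))
def sigContr := sigContr.stmt.thm 13 (by dsimp only [Stmt.Use])
def sigContr.proof : sigContr.stmt.Proof :=
  fun A P h k =>
    let c := h.center
    let d := (k c).center
    .contr (.pair c d) fun w => w.split (fun w => eq (sig A P) (dpair A P c d) w) fun _ b =>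
      Trm.app (((h.contract _).indL
        (fun a p => pi (P a) fun b => eq (sig A P) (dpair A P c d) (dpair A P a b))
        (.lam fun b => (((k c).contract b).ap (B := sig A P) fun b => dpair A P c b).c))) b

def sigContr.context : List Tm := extend piContr.context 18 [sigContr.stmt.decl sigContr.proof]

theorem sigContr.conservative : Conservative Modality.genericContext sigContr.context 14 :=
  piContr.conservative.extend _ (by decide +kernel)

abbrev eqContr.stmt : Stmt :=
  .type fun A => .imp (isContr A) fun _ => .raw A fun x => .raw A fun y => .concl (isContr (eq A x y))
def eqContr := eqContr.stmt.thm 14 (by dsimp only [Stmt.Use])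
def eqContr.proof : eqContr.stmt.Proof :=
  fun A h x _ => .contr ((h.contract ⟨x⟩).inv.trans (h.contract _)) fun p =>
    p.indL (fun y p => eq (eq A x y) ((h.contract ⟨x⟩).inv.trans (h.contract ⟨y⟩)).val p)
      (invTrans (h.contract ⟨x⟩)).c

def eqContr.context : List Tm := extend sigContr.context 19 [eqContr.stmt.decl eqContr.proof]

theorem eqContr.conservative : Conservative Modality.genericContext eqContr.context 15 :=
  sigContr.conservative.extend _ (by decide +kernel)

abbrev isContrIsProp.stmt : Stmt :=
  .type fun A => .concl (isProp (isContr A))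
def isContrIsProp := isContrIsProp.stmt.thm 15 (by dsimp only [Stmt.Use])
def isContrIsProp.proof : isContrIsProp.stmt.Proof :=
  fun A => .lam fun x => .lam fun y =>
    -- One witness makes `A` contractible, hence also the Σ-type of all witnesses.
    (contrPath (sigContr (P := fun a => pi A fun x => eq A a x) x
      (.lam fun a => piContr (.lam fun y => eqContr x a.val y.val))) x.val y.val).c

def isContrIsProp.context : List Tm :=
  extend eqContr.context 20 [isContrIsProp.stmt.decl isContrIsProp.proof]

theorem isContrIsProp.conservative : Conservative Modality.genericContext isContrIsProp.context 16 :=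
  eqContr.conservative.extend _ (by decide +kernel)

abbrev piIsProp.stmt : Stmt :=
  .type fun A => .fam A 2 fun P => .imp (pi A fun x => isProp (P x)) fun _ => .concl (isProp (pi A P))
def piIsProp := piIsProp.stmt.thm 16 (by dsimp only [Stmt.Use])
def piIsProp.proof : piIsProp.stmt.Proof :=
  fun A P h => .lam fun f => .lam fun g => funExt (.lam fun x =>
    (h x).prop (f.app x) (g.app x))

def piIsProp.context : List Tm :=
  extend isContrIsProp.context 21 [piIsProp.stmt.decl piIsProp.proof]

theorem piIsProp.conservative : Conservative Modality.genericContext piIsProp.context 17 :=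
  isContrIsProp.conservative.extend _ (by decide +kernel)

abbrev isEquivIsProp.stmt : Stmt :=
  .type fun A => .type fun B => .raw (arr A B) fun f => .concl (isProp (isEquiv A B f))
def isEquivIsProp := isEquivIsProp.stmt.thm 17 (by dsimp only [Stmt.Use])
def isEquivIsProp.proof : isEquivIsProp.stmt.Proof :=
  fun A B f => piIsProp (.lam fun b => isContrIsProp)

def isEquivIsProp.context : List Tm :=
  extend piIsProp.context 22 [isEquivIsProp.stmt.decl isEquivIsProp.proof]

theorem isEquivIsProp.conservative : Conservative Modality.genericContext isEquivIsProp.context 18 :=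
  piIsProp.conservative.extend _ (by decide +kernel)

/-- In a proposition, points over a path are equal. -/
abbrev pairPropEq.stmt : Stmt :=
  .type fun A => .fam A 2 fun P => .imp (pi A fun x => isProp (P x)) fun _ => .all A fun a =>
    .all A fun a' => .all (P a) fun b => .all (P a') fun b' => .imp (eq A a a') fun _ =>
    .concl (eq (sig A P) (dpair A P a b) (dpair A P a' b'))
def pairPropEq := pairPropEq.stmt.thm 18 (by dsimp only [Stmt.Use])
def pairPropEq.proof : pairPropEq.stmt.Proof :=
  fun A P h a a' b b' p =>
    pairEq p ((h ⟨a'⟩).prop (p.transport P ⟨b⟩) ⟨b'⟩)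

def pairPropEq.context : List Tm :=
  extend isEquivIsProp.context 23 [pairPropEq.stmt.decl pairPropEq.proof]

theorem pairPropEq.conservative : Conservative Modality.genericContext pairPropEq.context 19 :=
  isEquivIsProp.conservative.extend _ (by decide +kernel)

/-! ### Equivalences -/

abbrev equivSec.stmt : Stmt :=
  .type fun A => .type fun B => .all (arr A B) fun f => .imp (isEquiv A B f) fun e => .raw B fun b =>
    .concl (eq B (f (equivInv A B f e b)) b)
def equivSec := equivSec.stmt.thm 19 (by dsimp only [Stmt.Use])
def equivSec.proof : equivSec.stmt.Proof :=
  fun _ _ _ e b => (e.fiber ⟨b⟩).center.path.c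

def equivSec.context : List Tm := extend pairPropEq.context 24 [equivSec.stmt.decl equivSec.proof]

theorem equivSec.conservative : Conservative Modality.genericContext equivSec.context 20 :=
  pairPropEq.conservative.extend _ (by decide +kernel)

abbrev equivRet.stmt : Stmt :=
  .type fun A => .type fun B => .all (arr A B) fun f => .imp (isEquiv A B f) fun e => .raw A fun a =>
    .concl (eq A (equivInv A B f e (f a)) a)
def equivRet := equivRet.stmt.thm 20 (by dsimp only [Stmt.Use])
def equivRet.proof : equivRet.stmt.Proof :=
  fun A B f e a =>
    (((e.fiber ⟨f a⟩).contract (.fibMk ⟨a⟩ .rfl)).ap (B := A) fun w => fibPt A B f (f a) w).c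

def equivRet.context : List Tm := extend equivSec.context 25 [equivRet.stmt.decl equivRet.proof]

theorem equivRet.conservative : Conservative Modality.genericContext equivRet.context 21 :=
  equivSec.conservative.extend _ (by decide +kernel)

/-- In continuation form the inverse is a variable in the rest of the proof, so the checker does not
unfold its construction. `modalExt` and `fibTot` have this form for the same reason. -/
abbrev isEquivElim.stmt : Stmt :=
  .type fun A => .type fun B => .all (arr A B) fun f => .imp (isEquiv A B f) fun _ =>
    .raw (univ 2) fun C =>
    .imp (pi (arr B A) fun g => arr (pi A fun a => eq A (g (f a)) a)
      (arr (pi B fun b => eq B (f (g b)) b) C)) fun _ => .concl C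
def isEquivElim := isEquivElim.stmt.thm 21 (by dsimp only [Stmt.Use])
def isEquivElim.proof : isEquivElim.stmt.Proof :=
  fun A B f e C d => ⟨d.val (Ex.lam B fun b => equivInv A B f e b) (Ex.lam A fun a => equivRet e a)
    (Ex.lam B fun b => equivSec e b)⟩

def isEquivElim.context : List Tm :=
  extend equivRet.context 26 [isEquivElim.stmt.decl isEquivElim.proof]

theorem isEquivElim.conservative : Conservative Modality.genericContext isEquivElim.context 22 :=
  equivRet.conservative.extend _ (by decide +kernel)

/-- A map with a two-sided inverse is an equivalence. -/
abbrev isEquivMk.stmt : Stmt :=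
  .type fun A => .type fun B => .all (arr A B) fun f => .imp (arr B A) fun g =>
    .imp (pi A fun a => eq A (g (f a)) a) fun _ => .imp (pi B fun b => eq B (f (g b)) b) fun _ =>
    .concl (isEquiv A B f)
def isEquivMk := isEquivMk.stmt.thm 22 (by dsimp only [Stmt.Use])
def isEquivMk.proof : isEquivMk.stmt.Proof :=
  fun A B f g h k => .lam fun b =>
    -- The fiber over `b` is a retract of the singleton at `b`. The section `s` corrects the path by
    -- `k` and `h` in such a way that `r ∘ s` is the identity without any coherence between `h` and
    -- `k`.
    let r : Trm (arr (sig B fun b' => eq B b' b) (fib A B f b)) := .lam fun w =>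
      .fibMk (g w.fst) ((k w.fst).trans w.snd)
    let s : Trm (arr (fib A B f b) (sig B fun b' => eq B b' b)) := .lam fun w =>
      .pair ⟨f w.pt⟩ ((k ⟨f w.pt⟩).inv.trans ((((h w.pt).ap (B := B) fun a => f a)).trans w.path))
    retractContr (singletonContr' b) r s <| .lam fun w =>
      w.fibInd (fun w => eq (fib A B f b) (r.val (s.val w)) w) fun x p =>
        let q := ((h x).ap (B := B) fun a => f a).trans p
        (fibEq f ((k ⟨f x⟩).trans ((k ⟨f x⟩).inv.trans q)) p (h x) (transInvCancel (k ⟨f x⟩) q).c).c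

def isEquivMk.context : List Tm :=
  extend isEquivElim.context 27 [isEquivMk.stmt.decl isEquivMk.proof]

theorem isEquivMk.conservative : Conservative Modality.genericContext isEquivMk.context 23 :=
  isEquivElim.conservative.extend _ (by decide +kernel)

abbrev isEquivOfHomotopy.stmt : Stmt :=
  .type fun A => .type fun B => .all (arr A B) fun f => .all (arr A B) fun g =>
    .imp (pi A fun a => eq B (f a) (g a)) fun _ => .imp (isEquiv A B f) fun _ => .concl (isEquiv A B g)
def isEquivOfHomotopy := isEquivOfHomotopy.stmt.thm 23 (by dsimp only [Stmt.Use])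
def isEquivOfHomotopy.proof : isEquivOfHomotopy.stmt.Proof :=
  fun A B f g H e =>
    ((funExt H : Trm (eq (arr A B) f g)).transport (fun f => isEquiv A B f) e)

def isEquivOfHomotopy.context : List Tm :=
  extend isEquivMk.context 28 [isEquivOfHomotopy.stmt.decl isEquivOfHomotopy.proof]

theorem isEquivOfHomotopy.conservative : Conservative Modality.genericContext isEquivOfHomotopy.context 24 :=
  isEquivMk.conservative.extend _ (by decide +kernel)

abbrev isEquivOfContr.stmt : Stmt :=
  .type fun A => .type fun B => .all (arr A B) fun f => .imp (isContr A) fun _ =>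
    .imp (isContr B) fun _ => .concl (isEquiv A B f)
def isEquivOfContr := isEquivOfContr.stmt.thm 24 (by dsimp only [Stmt.Use])
def isEquivOfContr.proof : isEquivOfContr.stmt.Proof :=
  fun _ _ _ h k => isEquivMk (.lam fun _ => h.center)
    (.lam fun a => (h.contract a).c) (.lam fun b => contrPath k _ b)

def isEquivOfContr.context : List Tm :=
  extend isEquivOfHomotopy.context 29 [isEquivOfContr.stmt.decl isEquivOfContr.proof]

theorem isEquivOfContr.conservative : Conservative Modality.genericContext isEquivOfContr.context 25 :=
  isEquivOfHomotopy.conservative.extend _ (by decide +kernel)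

abbrev contrOfEquiv'.stmt : Stmt :=
  .type fun A => .type fun B => .all (arr A B) fun f => .imp (isEquiv A B f) fun _ =>
    .imp (isContr B) fun _ => .concl (isContr A)
def contrOfEquiv' := contrOfEquiv'.stmt.thm 25 (by dsimp only [Stmt.Use])
def contrOfEquiv'.proof : contrOfEquiv'.stmt.Proof :=
  fun _ _ f e h => retractContr h (.lam fun b => e.preimage b) ⟨f⟩ (.lam fun a => (equivRet e a).c)

def contrOfEquiv'.context : List Tm :=
  extend isEquivOfContr.context 30 [contrOfEquiv'.stmt.decl contrOfEquiv'.proof]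

theorem contrOfEquiv'.conservative : Conservative Modality.genericContext contrOfEquiv'.context 26 :=
  isEquivOfContr.conservative.extend _ (by decide +kernel)

abbrev isEquivCancelRight.stmt : Stmt :=
  .type fun A => .type fun B => .type fun C => .all (arr A B) fun f => .all (arr B C) fun g =>
    .imp (isEquiv A B f) fun _ => .imp (isEquiv A C (lam A fun a => g (f a))) fun _ =>
    .concl (isEquiv B C g)
def isEquivCancelRight := isEquivCancelRight.stmt.thm 26 (by dsimp only [Stmt.Use])
def isEquivCancelRight.proof : isEquivCancelRight.stmt.Proof :=
  fun A B C f g e e' =>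
    isEquivElim e _ (.lam fun f' => .lam fun r => .lam fun s =>
      isEquivElim e' _ (.lam fun k => .lam fun p => .lam fun q =>
        isEquivMk (.lam fun c => ⟨f (k c)⟩) (.lam fun b =>
          ((((s b).inv.ap (B := B) fun b => f (k.val (g b))).trans
            (((p (f' b)).c : Trm (eq A (k.val (g (f (f'.val b)))) (f'.val b))).ap (B := B)
              fun a => f a)).trans (s b)).c)
          (.lam fun c => (q c).c)))

def isEquivCancelRight.context : List Tm :=
  extend contrOfEquiv'.context 31 [isEquivCancelRight.stmt.decl isEquivCancelRight.proof]

theorem isEquivCancelRight.conservative : Conservative Modality.genericContext isEquivCancelRight.context 27 :=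
  contrOfEquiv'.conservative.extend _ (by decide +kernel)

/-! ### Induction principles from contractible total spaces; univalence -/

/-- All points of the Σ-type are equal, so `C` can be transported between them. Inductions on
homotopies and on equivalences are instances of this. -/
abbrev contrSigInd.stmt : Stmt :=
  .type fun A => .fam A 2 fun P => .imp (isContr (sig A P)) fun _ =>
    .raw (pi A fun a => arr (P a) (univ 2)) fun C => .raw A fun a => .raw (P a) fun b =>
    .imp (C a b) fun _ => .raw A fun a' => .raw (P a') fun b' => .concl (C a' b')
def contrSigInd := contrSigInd.stmt.thm 27 (by dsimp only [Stmt.Use])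
def contrSigInd.proof : contrSigInd.stmt.Proof :=
  fun A P h C a b d a' b' =>
    ((contrPath h (dpair A P a b) (dpair A P a' b')).transport
      (fun w => C (fst A P w) (snd A P w)) d.c).c

def contrSigInd.context : List Tm :=
  extend isEquivCancelRight.context 32 [contrSigInd.stmt.decl contrSigInd.proof]

theorem contrSigInd.conservative : Conservative Modality.genericContext contrSigInd.context 28 :=
  isEquivCancelRight.conservative.extend _ (by decide +kernel)

/-- The type is a retract of `Π x, Σ y, Q x y`, a product of contractible types. -/
abbrev choiceContr.stmt : Stmt :=
  .type fun A => .fam A 2 fun P => .raw (pi A fun x => arr (P x) (univ 2)) fun Q =>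
    .imp (pi A fun x => isContr (sig (P x) fun y => Q x y)) fun _ =>
    .concl (isContr (sig (pi A P) fun f => pi A fun x => Q x (f x)))
def choiceContr := choiceContr.stmt.thm 28 (by dsimp only [Stmt.Use])
def choiceContr.proof : choiceContr.stmt.Proof :=
  fun A P Q h =>
    let S := sig (pi A P) fun f => pi A fun x => Q x (f x)
    let r : Trm (arr (pi A fun x => sig (P x) fun y => Q x y) S) := .lam fun t =>
      .pair (.lam fun x => (t.app x).fst) (.lam fun x => (t.app x).snd.c)
    let c := (piContr h).center
    .contr (r c) fun w => w.split (fun w => eq S (r.val c) w) fun f k =>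
      (((piContr h).contract (.lam fun x => .pair (f.app x) ((k.app x).c))).ap (B := S) fun t => r.val t).c

def choiceContr.context : List Tm :=
  extend contrSigInd.context 33 [choiceContr.stmt.decl choiceContr.proof]

theorem choiceContr.conservative : Conservative Modality.genericContext choiceContr.context 29 :=
  contrSigInd.conservative.extend _ (by decide +kernel)

/-- Induction on homotopies. -/
abbrev homotopyInd.stmt : Stmt :=
  .type fun A => .fam A 2 fun P => .all (pi A P) fun f =>
    .raw (pi (pi A P) fun g => arr (pi A fun x => eq (P x) (f x) (g x)) (univ 2)) fun C =>
    .imp (C f (lam A fun x => rfl (P x) (f x))) fun _ => .all (pi A P) fun g =>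
    .imp (pi A fun x => eq (P x) (f x) (g x)) fun H => .concl (C g H)
def homotopyInd := homotopyInd.stmt.thm 29 (by dsimp only [Stmt.Use])
def homotopyInd.proof : homotopyInd.stmt.Proof :=
  fun A P f C d g H =>
    -- Choice applied to singletons: the functions homotopic to `f` form a contractible type.
    let h := choiceContr (x := A) (P := P) (Ex.lam A fun x => Ex.lam (P x) fun y => eq (P x) (f x) y)
      (.lam fun x => (singletonContr (x := P x) (f x)).c)
    (contrSigInd (x := pi A P) (P := fun g => pi A fun x => eq (P x) (f x) (g x)) h.c C f (Ex.lam A fun x => rfl (P x) (f x)) d g H)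

def homotopyInd.context : List Tm :=
  extend choiceContr.context 34 [homotopyInd.stmt.decl homotopyInd.proof]

theorem homotopyInd.conservative : Conservative Modality.genericContext homotopyInd.context 30 :=
  choiceContr.conservative.extend _ (by decide +kernel)

abbrev sigContrOfEquiv.stmt : Stmt :=
  .type fun A => .fam A 2 fun P => .fam A 2 fun Q => .raw (pi A fun a => arr (P a) (Q a)) fun f =>
    .imp (pi A fun a => isEquiv (P a) (Q a) (f a)) fun _ => .imp (isContr (sig A P)) fun _ =>
    .concl (isContr (sig A Q))
def sigContrOfEquiv := sigContrOfEquiv.stmt.thm 30 (by dsimp only [Stmt.Use])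
def sigContrOfEquiv.proof : sigContrOfEquiv.stmt.Proof :=
  fun A P Q f e h =>
    let r : Trm (arr (sig A P) (sig A Q)) := .lam fun w => .pair w.fst ⟨f w.fst w.snd⟩
    .contr (r h.center) fun w => w.split (fun w => eq (sig A Q) (r.val h.center) w) fun a b =>
      isEquivElim (e a) _ (.lam fun g => .lam fun _ => .lam fun s =>
        (((h.contract (.pair a (g b))).ap (B := sig A Q) fun w => r.val w).trans
          (((s b).ap (B := sig A Q) fun b => dpair A Q a b).c)))

def sigContrOfEquiv.context : List Tm :=
  extend homotopyInd.context 35 [sigContrOfEquiv.stmt.decl sigContrOfEquiv.proof]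

theorem sigContrOfEquiv.conservative : Conservative Modality.genericContext sigContrOfEquiv.context 31 :=
  homotopyInd.conservative.extend _ (by decide +kernel)

/-- Univalence: `idToEquiv` is a fiberwise equivalence from the singleton at `A`. -/
abbrev equivContr.stmt : Stmt :=
  .raw (univ 0) fun A => .concl (isContr (sig (univ 0) fun B => equiv A B))
def equivContr := equivContr.stmt.thm 31 (by dsimp only [Stmt.Use])
def equivContr.proof : equivContr.stmt.Proof :=
  fun A => sigContrOfEquiv (P := fun B => eq (univ 0) A B) (Ex.lam (univ 0) fun B => idToEquiv 0 A B)
    (.lam fun B => ⟨const (.ua 0) A B⟩) (@singletonContr (univ 0) A)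

def equivContr.context : List Tm :=
  extend sigContrOfEquiv.context 36 [equivContr.stmt.decl equivContr.proof]

theorem equivContr.conservative : Conservative Modality.genericContext equivContr.context 32 :=
  sigContrOfEquiv.conservative.extend _ (by decide +kernel)

/-- Induction on equivalences with a fixed domain. -/
abbrev equivInd.stmt : Stmt :=
  .all (univ 0) fun A => .raw (pi (univ 0) fun B => arr (arr A B) (univ 2)) fun C =>
    .imp (C A (idFun A)) fun _ => .all (univ 0) fun B => .all (arr A B) fun f =>
    .imp (isEquiv A B f) fun _ => .concl (C B f)
def equivInd := equivInd.stmt.thm 32 (by dsimp only [Stmt.Use])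
def equivInd.proof : equivInd.stmt.Proof :=
  fun A C d B f e =>
    (contrSigInd (equivContr A) (Ex.lam (univ 0) fun B => Ex.lam (equiv A B) fun e =>
        C B (fst (arr A B) (fun f => isEquiv A B f) e)) A
      (dpair (arr A A) (fun f => isEquiv A A f) (idFun A) (idIsEquiv A)) d.c
      B (dpair (arr A B) (fun f => isEquiv A B f) f e)).c

def equivInd.context : List Tm := extend equivContr.context 37 [equivInd.stmt.decl equivInd.proof]

theorem equivInd.conservative : Conservative Modality.genericContext equivInd.context 33 :=
  equivContr.conservative.extend _ (by decide +kernel)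

/-- Equivalent types are equal. -/
abbrev equivPath.stmt : Stmt :=
  .raw (univ 0) fun A => .all (univ 0) fun B => .all (arr A B) fun f =>
    .imp (isEquiv A B f) fun _ => .concl (eq (univ 0) A B)
def equivPath := equivPath.stmt.thm 33 (by dsimp only [Stmt.Use])
def equivPath.proof : equivPath.stmt.Proof :=
  fun A _ _ e => (equivInd (Ex.lam (univ 0) fun B => Ex.lam (arr A B) fun _ => eq (univ 0) A B)
    (.c (.rfl : Trm (eq (univ 0) A A))) e).c

def equivPath.context : List Tm := extend equivInd.context 38 [equivPath.stmt.decl equivPath.proof]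

theorem equivPath.conservative : Conservative Modality.genericContext equivPath.context 34 :=
  equivInd.conservative.extend _ (by decide +kernel)

abbrev equivContr'.stmt : Stmt :=
  .raw (univ 0) fun B => .concl (isContr (sig (univ 0) fun A => equiv A B))
def equivContr' := equivContr'.stmt.thm 34 (by dsimp only [Stmt.Use])
def equivContr'.proof : equivContr'.stmt.Proof :=
  fun B => sigContrOfEquiv (P := fun A => eq (univ 0) A B) (Ex.lam (univ 0) fun A => idToEquiv 0 A B)
    (.lam fun A => ⟨const (.ua 0) A B⟩) (@singletonContr' (univ 0) B)

def equivContr'.context : List Tm :=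
  extend equivPath.context 39 [equivContr'.stmt.decl equivContr'.proof]

theorem equivContr'.conservative : Conservative Modality.genericContext equivContr'.context 35 :=
  equivPath.conservative.extend _ (by decide +kernel)

/-- Induction on equivalences with a fixed codomain. -/
abbrev equivInd'.stmt : Stmt :=
  .all (univ 0) fun B => .raw (pi (univ 0) fun A => arr (arr A B) (univ 2)) fun C =>
    .imp (C B (idFun B)) fun _ => .all (univ 0) fun A => .all (arr A B) fun f =>
    .imp (isEquiv A B f) fun _ => .concl (C A f)
def equivInd' := equivInd'.stmt.thm 35 (by dsimp only [Stmt.Use])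
def equivInd'.proof : equivInd'.stmt.Proof :=
  fun B C d A f e =>
    (contrSigInd (equivContr' B) (Ex.lam (univ 0) fun A => Ex.lam (equiv A B) fun e =>
        C A (fst (arr A B) (fun f => isEquiv A B f) e)) B
      (dpair (arr B B) (fun f => isEquiv B B f) (idFun B) (idIsEquiv B)) d.c
      A (dpair (arr A B) (fun f => isEquiv A B f) f e)).c

def equivInd'.context : List Tm :=
  extend equivContr'.context 40 [equivInd'.stmt.decl equivInd'.proof]

theorem equivInd'.conservative : Conservative Modality.genericContext equivInd'.context 36 :=
  equivContr'.conservative.extend _ (by decide +kernel)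

/-- Induction on families of equivalences. -/
abbrev equivFamInd.stmt : Stmt :=
  .all (univ 0) fun Y => .fam Y 0 fun P =>
    .raw (pi (arr Y (univ 0)) fun Q => arr (pi Y fun y => arr (P y) (Q y)) (univ 2)) fun C =>
    .imp (C (lam Y fun y => P y) (lam Y fun y => idFun (P y))) fun _ => .fam Y 0 fun Q =>
    .all (pi Y fun y => arr (P y) (Q y)) fun f =>
    .imp (pi Y fun y => isEquiv (P y) (Q y) (f y)) fun _ => .concl (C (lam Y fun y => Q y) f)
def equivFamInd := equivFamInd.stmt.thm 36 (by dsimp only [Stmt.Use])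
def equivFamInd.proof : equivFamInd.stmt.Proof :=
  fun Y P C d Q f e =>
    let k := fun y B f => isEquiv (P y) B f
    -- Univalence at each `y`, combined by choice.
    let h := choiceContr (x := Y) (P := fun _ => univ 0) (Ex.lam Y fun y => Ex.lam (univ 0) fun B => equiv (P y) B)
      (.lam fun y => (equivContr (P y)).c)
    (contrSigInd (x := arr Y (univ 0)) (P := fun Q => pi Y fun y => equiv (P y) (Q y)) h.c
      (Ex.lam (arr Y (univ 0)) fun Q => Ex.lam (pi Y fun y => equiv (P y) (Q y)) fun e =>
        C Q (Ex.lam Y fun y => fst (arr (P y) (Q y)) (k y (Q y)) (e y)))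
      (Ex.lam Y fun y => P y)
      (Ex.lam Y fun y => dpair (arr (P y) (P y)) (k y (P y)) (idFun (P y)) (idIsEquiv (P y))) d.c
      (Ex.lam Y fun y => Q y)
      (Ex.lam Y fun y => dpair (arr (P y) (Q y)) (k y (Q y)) (f y) (e.val y))).c

def equivFamInd.context : List Tm :=
  extend equivInd'.context 41 [equivFamInd.stmt.decl equivFamInd.proof]

theorem equivFamInd.conservative : Conservative Modality.genericContext equivFamInd.context 37 :=
  equivInd'.conservative.extend _ (by decide +kernel)

/-! ### Modal types -/

/-- The operator of the generic modality. -/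
def bang (A : Ex) : Ex := Modality.generic.bang A
def unitMap (A : Ex) : Ex := Modality.generic.unit A
def unit (A x : Ex) : Ex := unitMap A x
def isModal (A : Ex) : Ex := isEquiv A (bang A) (unitMap A)

/-- A retraction of the unit suffices: the other composite `!A → !A` agrees with the identity on
units, hence everywhere, because identity types of `!A` are modal. -/
abbrev modalMk.stmt : Stmt :=
  .small fun A => .imp (arr (bang A) A) fun r => .imp (pi A fun a => eq A (r (unit A a)) a) fun _ =>
    .concl (isModal A)
def modalMk := modalMk.stmt.thm 37 (by dsimp only [Stmt.Use])
def modalMk.proof : modalMk.stmt.Proof :=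
  fun A r h => isEquivMk r h.c (.lam fun u =>
    ⟨Modality.generic.extendPath A A (Ex.lam (bang A) fun u => unit A (r.val u))
      (Ex.lam (bang A) fun u => u)
      (Ex.lam A fun a => (h.app ⟨a⟩).ap (B := bang A) fun a => unit A a) u⟩)

def modalMk.context : List Tm := extend equivFamInd.context 42 [modalMk.stmt.decl modalMk.proof]

theorem modalMk.conservative : Conservative Modality.genericContext modalMk.context 38 :=
  equivFamInd.conservative.extend _ (by decide +kernel)

/-- Dependent elimination into modal types, with its computation rule. -/
abbrev modalExt.stmt : Stmt :=
  .small fun A => .fam (bang A) 0 fun P => .imp (pi (bang A) fun u => isModal (P u)) fun _ =>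
    .imp (pi A fun a => P (unit A a)) fun d => .raw (univ 2) fun C =>
    .imp (pi (pi (bang A) P) fun h =>
      arr (pi A fun a => eq (P (unit A a)) (h (unit A a)) (d a)) C) fun _ => .concl C
def modalExt := modalExt.stmt.thm 38 (by dsimp only [Stmt.Use])
def modalExt.proof : modalExt.stmt.Proof :=
  fun A P m d C k =>
    -- `ind` only reaches `!(P u)`; the inverse `J` of the unit of the modal type `P u` brings the
    -- value back.
    let I := fun u => Modality.generic.ind A (Ex.lam (bang A) P)
      (Ex.lam A fun a => unit (P (unit A a)) (d.val a)) u
    let J := fun u x => equivInv (P u) (bang (P u)) (unitMap (P u)) (m.val u) x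
    ⟨k.val (Ex.lam (bang A) fun u => J u (I u)) (Ex.lam A fun a =>
      ((⟨Modality.generic.comp A (Ex.lam (bang A) P)
        (Ex.lam A fun a => unit (P (unit A a)) (d.val a)) a⟩ :
          Trm (eq (bang (P (unit A a))) (I (unit A a)) (unit (P (unit A a)) (d.val a)))).ap
        (B := P (unit A a)) (J (unit A a))).trans
      (equivRet (m ⟨unit A a⟩) (d.val a)))⟩

def modalExt.context : List Tm := extend modalMk.context 43 [modalExt.stmt.decl modalExt.proof]

theorem modalExt.conservative : Conservative Modality.genericContext modalExt.context 39 :=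
  modalMk.conservative.extend _ (by decide +kernel)

abbrev modalElim.stmt : Stmt :=
  .small fun A => .fam (bang A) 0 fun P => .imp (pi (bang A) fun u => isModal (P u)) fun _ =>
    .imp (pi A fun a => P (unit A a)) fun _ => .concl (pi (bang A) P)
def modalElim := modalElim.stmt.thm 39 (by dsimp only [Stmt.Use])
def modalElim.proof : modalElim.stmt.Proof :=
  fun _ _ m d => modalExt m d _ (.lam fun h => .lam fun _ => h)

def modalElim.context : List Tm := extend modalExt.context 44 [modalElim.stmt.decl modalElim.proof]

theorem modalElim.conservative : Conservative Modality.genericContext modalElim.context 40 :=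
  modalExt.conservative.extend _ (by decide +kernel)

/-- Induction for the constant family with value `A` extends the identity of `!A` to a retraction
`!!A → !A`. -/
abbrev bangModal.stmt : Stmt :=
  .raw (univ 0) fun A => .concl (isModal (bang A))
def bangModal := bangModal.stmt.thm 40 (by dsimp only [Stmt.Use])
def bangModal.proof : bangModal.stmt.Proof :=
  fun A => modalMk
    ⟨Modality.generic.ind (bang A) (Ex.lam (bang (bang A)) fun _ => A) (Ex.lam (bang A) fun u => u)⟩
    ⟨Modality.generic.comp (bang A) (Ex.lam (bang (bang A)) fun _ => A) (Ex.lam (bang A) fun u => u)⟩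

def bangModal.context : List Tm := extend modalElim.context 45 [bangModal.stmt.decl bangModal.proof]

theorem bangModal.conservative : Conservative Modality.genericContext bangModal.context 41 :=
  modalElim.conservative.extend _ (by decide +kernel)

/-- The section, extended to `!B → A` and followed by `r`, is a retraction of the unit of `B`. -/
abbrev modalOfSection.stmt : Stmt :=
  .small fun A => .small fun B => .imp (isModal A) fun _ => .imp (arr A B) fun r =>
    .imp (arr B A) fun s => .imp (pi B fun b => eq B (r (s b)) b) fun _ => .concl (isModal B)
def modalOfSection := modalOfSection.stmt.thm 41 (by dsimp only [Stmt.Use])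
def modalOfSection.proof : modalOfSection.stmt.Proof :=
  fun A B m r s e => modalExt (P := fun _ => A) (.lam fun _ => m) s _ (.lam fun h => .lam fun β =>
    modalMk (.lam fun u => r (h.app u)) (.lam fun b =>
      (((β b).ap (B := B) fun a => r.val a).trans (e b)).c))

def modalOfSection.context : List Tm :=
  extend bangModal.context 46 [modalOfSection.stmt.decl modalOfSection.proof]

theorem modalOfSection.conservative : Conservative Modality.genericContext modalOfSection.context 42 :=
  bangModal.conservative.extend _ (by decide +kernel)

/-- For modal `A` the type `x = y` is a retract of `x^! = y^!`, which is modal by the definition of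
a higher modality. -/
abbrev modalEq.stmt : Stmt :=
  .small fun A => .imp (isModal A) fun _ => .raw A fun x => .raw A fun y => .concl (isModal (eq A x y))
def modalEq := modalEq.stmt.thm 42 (by dsimp only [Stmt.Use])
def modalEq.proof : modalEq.stmt.Proof :=
  fun A m x y => isEquivElim m _ (.lam fun g => .lam fun p => .lam fun _ =>
    let r x y (q : Ex) : Trm (eq A x y) := ((p.app ⟨x⟩).inv.trans
      (((⟨q⟩ : Trm (eq (bang A) (unit A x) (unit A y))).ap (B := A) fun u => g.val u).trans
        (p.app ⟨y⟩))).c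
    modalOfSection
      (⟨Modality.generic.idModal A (unit A x) (unit A y)⟩ : Trm (isModal (eq (bang A) (unit A x) (unit A y))))
      (.lam fun q => r x y q) (.lam fun q => q.ap fun a => unit A a)
      (Trm.lam (B := fun q => eq (eq A x y) (r x y ((⟨q⟩ : Trm (eq A x y)).ap (B := bang A) fun a => unit A a)) q)
        fun q => q.ind (fun x y q => eq (eq A x y)
          (r x y ((⟨q⟩ : Trm (eq A x y)).ap (B := bang A) fun a => unit A a)) q)
          fun x => (invTrans (p x)).c).c)

def modalEq.context : List Tm := extend modalOfSection.context 47 [modalEq.stmt.decl modalEq.proof]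

theorem modalEq.conservative : Conservative Modality.genericContext modalEq.context 43 :=
  modalOfSection.conservative.extend _ (by decide +kernel)

/-- Each evaluation at `a` extends to `!(Π a, P a) → P a`; together these form a retraction of the
unit. -/
abbrev modalPi.stmt : Stmt :=
  .small fun A => .fam A 0 fun P => .imp (pi A fun a => isModal (P a)) fun _ => .concl (isModal (pi A P))
def modalPi := modalPi.stmt.thm 43 (by dsimp only [Stmt.Use])
def modalPi.proof : modalPi.stmt.Proof :=
  fun A P m =>
    let E := fun a => sig (arr (bang (pi A P)) (P a)) fun h =>
      pi (pi A P) fun g => eq (P a) (h (unit (pi A P) g)) (g a)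
    let t : Trm (pi A E) := .lam fun a =>
      modalExt (P := fun _ => P a) (.lam fun _ => m a) (.lam fun g => g.app a) _
        (.lam fun h => .lam fun β => .pair h β.c)
    modalMk (.lam fun u => .lam fun a => (t.app a).fst.app u) (.lam fun g =>
      funExt (.lam fun a => ((t.app a).snd.app g).c))

def modalPi.context : List Tm := extend modalEq.context 48 [modalPi.stmt.decl modalPi.proof]

theorem modalPi.conservative : Conservative Modality.genericContext modalPi.context 44 :=
  modalEq.conservative.extend _ (by decide +kernel)

abbrev modalSig.stmt : Stmt :=
  .small fun A => .fam A 0 fun P => .imp (isModal A) fun _ => .imp (pi A fun a => isModal (P a)) fun _ =>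
    .concl (isModal (sig A P))
def modalSig := modalSig.stmt.thm 44 (by dsimp only [Stmt.Use])
def modalSig.proof : modalSig.stmt.Proof :=
  fun A P m k =>
    modalExt (x := sig A P) (P := fun _ => A) (.lam fun _ => m) (.lam fun w => w.fst) _
      (.lam fun r => .lam fun β =>
        -- The first projection has been extended to `r`. The second is extended as a section over
        -- `r`, after transport along the computation rule of `r`.
        modalExt (x := sig A P) (P := fun u => P (r.val u)) (.lam fun u => k (r u))
          (.lam fun w =>
            ((β.app w).c (T := eq A (r.val (unit (sig A P) w)) (fst A P w))).inv.transport P w.snd) _ (.lam fun s => .lam fun ε =>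
            modalMk (.lam fun u => .pair (r u) (s.app u)) (.lam fun w =>
              (w.split (fun w => eq (sig A P)
                (dpair A P (r.val (unit (sig A P) w)) (s.val (unit (sig A P) w))) w)
                fun a b =>
                  let p := (β.app ⟨dpair A P a b⟩).c (T := eq A (r.val (unit (sig A P) (dpair A P a b))) a)
                  pairEq p (((ε.app ⟨dpair A P a b⟩).ap (B := P a) fun x =>
                    (p.transport P ⟨x⟩).val).trans (transportInv (P := P) b p).c)).c)))

def modalSig.context : List Tm := extend modalPi.context 49 [modalSig.stmt.decl modalSig.proof]

theorem modalSig.conservative : Conservative Modality.genericContext modalSig.context 45 :=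
  modalPi.conservative.extend _ (by decide +kernel)

/-! ### Localizations -/

/-- The map `m : A → T` exhibits `T` as `!A`. -/
def loc (A T m : Ex) : Ex :=
  (lam (univ 0) fun A => lam (univ 0) fun T => lam (arr A T) fun m =>
    sig (arr (bang A) T) fun k =>
      prod (isEquiv (bang A) T k) (pi A fun a => eq T (k (unit A a)) (m a))) A T m

def _root_.HoTT.Trm.locMk {A T m : Ex} (k : Trm (arr (bang A) T)) (e : Trm (isEquiv (bang A) T k.val))
    (β : Trm (pi A fun a => eq T (k.val (unit A a)) (m a))) : Trm (loc A T m) :=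
  (Trm.pair (P := fun k => prod (isEquiv (bang A) T k) (pi A fun a => eq T (k (unit A a)) (m a)))
    k (.pair e β : Trm (prod _ _))).c

def _root_.HoTT.Trm.locSplit {A T m : Ex} (l : Trm (loc A T m)) (C : Ex) (d : (k : Trm (arr (bang A) T)) →
    Trm (isEquiv (bang A) T k.val) → Trm (pi A fun a => eq T (k.val (unit A a)) (m a)) → Trm C) :
    Trm C :=
  (l.c : Trm (sig (arr (bang A) T) fun k =>
    prod (isEquiv (bang A) T k) (pi A fun a => eq T (k (unit A a)) (m a)))).split (fun _ => C)
    fun k p => p.split (fun _ => C) fun e β => d k e β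

abbrev fibModal.stmt : Stmt :=
  .small fun A => .small fun B => .raw (arr A B) fun f => .raw B fun y => .imp (isModal A) fun _ =>
    .imp (isModal B) fun _ => .concl (isModal (fib A B f y))
def fibModal := fibModal.stmt.thm 45 (by dsimp only [Stmt.Use])
def fibModal.proof : fibModal.stmt.Proof :=
  fun A B f y m k => modalSig m (.lam fun x => modalEq k (f x) y)

def fibModal.context : List Tm := extend modalSig.context 50 [fibModal.stmt.decl fibModal.proof]

theorem fibModal.conservative : Conservative Modality.genericContext fibModal.context 46 :=
  modalSig.conservative.extend _ (by decide +kernel)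

abbrev isContrModal.stmt : Stmt :=
  .small fun A => .imp (isModal A) fun _ => .concl (isModal (isContr A))
def isContrModal := isContrModal.stmt.thm 46 (by dsimp only [Stmt.Use])
def isContrModal.proof : isContrModal.stmt.Proof :=
  fun A m => modalSig m (.lam fun x => modalPi (.lam fun y => modalEq m x y))

def isContrModal.context : List Tm :=
  extend fibModal.context 51 [isContrModal.stmt.decl isContrModal.proof]

theorem isContrModal.conservative : Conservative Modality.genericContext isContrModal.context 47 :=
  fibModal.conservative.extend _ (by decide +kernel)

abbrev bangContr.stmt : Stmt :=
  .small fun A => .imp (isContr A) fun _ => .concl (isContr (bang A))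
def bangContr := bangContr.stmt.thm 47 (by dsimp only [Stmt.Use])
def bangContr.proof : bangContr.stmt.Proof :=
  fun A h => .contr ⟨unit A h.center⟩ fun u =>
    (modalElim (P := fun u => eq (bang A) (unit A h.center) u)
      (.lam fun u => modalEq (bangModal A) (unit A h.center) u)
      (.lam fun a => (h.contract a).ap fun a => unit A a)).app u

def bangContr.context : List Tm :=
  extend isContrModal.context 52 [bangContr.stmt.decl bangContr.proof]

theorem bangContr.conservative : Conservative Modality.genericContext bangContr.context 48 :=
  isContrModal.conservative.extend _ (by decide +kernel)

abbrev eqOfTransInv.stmt : Stmt :=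
  .type fun A => .all A fun x => .all A fun y => .imp (eq A x y) fun p => .imp (eq A x y) fun q =>
    .imp (eq (eq A x x) (rfl A x) (concat A x y x p (inv A x y q))) fun _ => .concl (eq (eq A x y) p q)
def eqOfTransInv := eqOfTransInv.stmt.thm 48 (by dsimp only [Stmt.Use])
def eqOfTransInv.proof : eqOfTransInv.stmt.Proof :=
  fun A x y p q r =>
    let C := fun y q => pi (eq A x y) fun p =>
      arr (eq (eq A x x) (rfl A x) (concat A x y x p (inv A x y q))) (eq (eq A x y) p q)
    let d : Trm (C x (rfl A x)) := .lam fun p => .lam fun r => (transRefl p).inv.trans (r.inv.c)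
    (((q.indL C d).app p).c : Trm (arr _ _)) r

def eqOfTransInv.context : List Tm :=
  extend bangContr.context 53 [eqOfTransInv.stmt.decl eqOfTransInv.proof]

theorem eqOfTransInv.conservative : Conservative Modality.genericContext eqOfTransInv.context 49 :=
  bangContr.conservative.extend _ (by decide +kernel)

/-- Extensions of a map into a modal type along the unit are unique. -/
abbrev extContr.stmt : Stmt :=
  .small fun A => .small fun T => .imp (isModal T) fun _ => .raw (arr A T) fun m =>
    .concl (isContr (sig (arr (bang A) T) fun h => pi A fun a => eq T (h (unit A a)) (m a)))
def extContr := extContr.stmt.thm 49 (by dsimp only [Stmt.Use])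
def extContr.proof : extContr.stmt.Proof :=
  fun A T t m =>
    let E := fun h => pi A fun a => eq T (h (unit A a)) (m a)
    let S := sig (arr (bang A) T) E
    modalExt (P := fun _ => T) (.lam fun _ => t) ⟨m⟩ _ (.lam fun h => .lam fun β =>
      .contr (.pair h β.c) fun w => w.split (fun w => eq S (dpair (arr (bang A) T) E h β) w)
        fun h' β' =>
          -- The homotopy `K` between two extensions equals `β · β'⁻¹` on units, as `κ` records.
          -- After induction on `K` this says `rfl = β · β'⁻¹`, whence `β = β'`.
          modalExt (P := fun u => eq T (h.val u) (h'.val u))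
            (.lam fun u => modalEq t (h.val u) (h'.val u))
            (.lam fun a => (β a).trans (β'.app a).inv) _ (.lam fun K => .lam fun κ =>
              let D := fun h' K => pi (E h') fun β' =>
                arr (pi A fun a => eq (eq T (h.val (unit A a)) (h' (unit A a))) (K (unit A a))
                  (concat T (h.val (unit A a)) (m a) (h' (unit A a)) (β.val a)
                    (inv T (h' (unit A a)) (m a) (β'  a))))
                  (eq S (dpair (arr (bang A) T) E h β) (dpair (arr (bang A) T) E h' β'))
              let d : Trm (D h (Ex.lam (bang A) fun u => rfl T (h.val u))) :=
                .lam fun β' => .lam fun γ =>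
                  (funExt (.lam fun a => eqOfTransInv (β a) (β'.app a) (γ.app a).c) :
                    Trm (eq (E h) β β')).ap fun β => dpair (arr (bang A) T) E h β
              (homotopyInd (P := fun _ => T)
                (Ex.lam (arr (bang A) T) fun h' =>
                  Ex.lam (pi (bang A) fun u => eq T (h.val u) (h' u)) fun K => D h' K)
                (d.c) K).apps [β', κ]))

def extContr.context : List Tm := extend eqOfTransInv.context 54 [extContr.stmt.decl extContr.proof]

theorem extContr.conservative : Conservative Modality.genericContext extContr.context 50 :=
  eqOfTransInv.conservative.extend _ (by decide +kernel)

/-- Induction on the equivalence `!A → T` and then on the homotopy identifies `(T, m)` with `!A` and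
its unit. Properties of localizations need therefore be proved for units only. -/
abbrev locInd.stmt : Stmt :=
  .small fun A => .raw (pi (univ 0) fun T => arr (arr A T) (univ 2)) fun C =>
    .imp (C (bang A) (unitMap A)) fun _ => .small fun T => .all (arr A T) fun m =>
    .imp (loc A T m) fun _ => .concl (C T m)
def locInd := locInd.stmt.thm 50 (by dsimp only [Stmt.Use])
def locInd.proof : locInd.stmt.Proof :=
  fun A C d T m l => l.locSplit (C T m) fun k e β =>
      let D := fun T k => pi (arr A T) fun m => arr (pi A fun a => eq T (k (unit A a)) (m a)) (C T m)
      let c : Trm (D (bang A) (idFun (bang A))) := .lam fun m => .lam fun β =>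
        (homotopyInd (x := A) (P := fun _ => bang A)
          (Ex.lam (arr A (bang A)) fun m => Ex.lam (pi A fun a => eq (bang A) (unitMap A a) (m a)) fun _ =>
            C (bang A) m) d.c
          (β.c : Trm (pi A fun a => eq (bang A) (unitMap A a) (m.val a)))).c
      (equivInd (Ex.lam (univ 0) fun T => Ex.lam (arr (bang A) T) fun k => D T k) c.c e).apps [m, β]

def locInd.context : List Tm := extend extContr.context 55 [locInd.stmt.decl locInd.proof]

theorem locInd.conservative : Conservative Modality.genericContext locInd.context 51 :=
  extContr.conservative.extend _ (by decide +kernel)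

abbrev locModal.stmt : Stmt :=
  .small fun A => .small fun T => .all (arr A T) fun m => .imp (loc A T m) fun _ => .concl (isModal T)
def locModal := locModal.stmt.thm 51 (by dsimp only [Stmt.Use])
def locModal.proof : locModal.stmt.Proof :=
  fun A _ _ l => (locInd (Ex.lam (univ 0) fun T => Ex.lam (arr A T) fun _ => isModal T)
    (bangModal A).c l).c

def locModal.context : List Tm := extend locInd.context 56 [locModal.stmt.decl locModal.proof]

theorem locModal.conservative : Conservative Modality.genericContext locModal.context 52 :=
  locInd.conservative.extend _ (by decide +kernel)

abbrev unitLoc.stmt : Stmt :=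
  .raw (univ 0) fun A => .concl (loc A (bang A) (unitMap A))
def unitLoc := unitLoc.stmt.thm 52 (by dsimp only [Stmt.Use])
def unitLoc.proof : unitLoc.stmt.Proof :=
  fun A => Trm.locMk ⟨idFun (bang A)⟩ ⟨idIsEquiv (bang A)⟩ (.lam fun _ => .rfl)

def unitLoc.context : List Tm := extend locModal.context 57 [unitLoc.stmt.decl unitLoc.proof]

theorem unitLoc.conservative : Conservative Modality.genericContext unitLoc.context 53 :=
  locModal.conservative.extend _ (by decide +kernel)

abbrev locOfContr.stmt : Stmt :=
  .small fun A => .small fun T => .all (arr A T) fun m => .imp (isContr A) fun _ =>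
    .imp (isContr T) fun _ => .concl (loc A T m)
def locOfContr := locOfContr.stmt.thm 53 (by dsimp only [Stmt.Use])
def locOfContr.proof : locOfContr.stmt.Proof :=
  fun _ _ m h k => Trm.locMk (.lam fun _ => k.center) (isEquivOfContr (bangContr h) k)
    (.lam fun a => contrPath k _ (m a))

def locOfContr.context : List Tm :=
  extend unitLoc.context 58 [locOfContr.stmt.decl locOfContr.proof]

theorem locOfContr.conservative : Conservative Modality.genericContext locOfContr.context 54 :=
  unitLoc.conservative.extend _ (by decide +kernel)

/-- The map `h` and the equivalence contained in `loc` both extend `m`, and extensions are unique.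
-/
abbrev isEquivOfLoc.stmt : Stmt :=
  .small fun A => .small fun T => .all (arr A T) fun m => .raw (arr (bang A) T) fun h =>
    .imp (pi A fun a => eq T (h (unit A a)) (m a)) fun _ => .imp (loc A T m) fun _ =>
    .concl (isEquiv (bang A) T h)
def isEquivOfLoc := isEquivOfLoc.stmt.thm 54 (by dsimp only [Stmt.Use])
def isEquivOfLoc.proof : isEquivOfLoc.stmt.Proof :=
  fun A T m h H l => l.locSplit (isEquiv (bang A) T h) fun k e β =>
      (contrSigInd (extContr (x := A) (locModal l) m)
        (Ex.lam (arr (bang A) T) fun h => Ex.lam (pi A fun a => eq T (h (unit A a)) (m a)) fun _ =>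
          isEquiv (bang A) T h) k β e.c h H).c

def isEquivOfLoc.context : List Tm :=
  extend locOfContr.context 59 [isEquivOfLoc.stmt.decl isEquivOfLoc.proof]

theorem isEquivOfLoc.conservative : Conservative Modality.genericContext isEquivOfLoc.context 55 :=
  locOfContr.conservative.extend _ (by decide +kernel)

abbrev locOfHomotopy.stmt : Stmt :=
  .small fun A => .small fun T => .all (arr A T) fun m => .all (arr A T) fun m' =>
    .imp (pi A fun a => eq T (m a) (m' a)) fun _ => .imp (loc A T m) fun _ => .concl (loc A T m')
def locOfHomotopy := locOfHomotopy.stmt.thm 55 (by dsimp only [Stmt.Use])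
def locOfHomotopy.proof : locOfHomotopy.stmt.Proof :=
  fun A T m m' H l => (funExt H : Trm (eq (arr A T) m m')).transport (fun m => loc A T m) l

def locOfHomotopy.context : List Tm :=
  extend isEquivOfLoc.context 60 [locOfHomotopy.stmt.decl locOfHomotopy.proof]

theorem locOfHomotopy.conservative : Conservative Modality.genericContext locOfHomotopy.context 56 :=
  isEquivOfLoc.conservative.extend _ (by decide +kernel)

abbrev locPost.stmt : Stmt :=
  .small fun A => .small fun T => .small fun S => .all (arr A T) fun m => .all (arr T S) fun h =>
    .imp (isEquiv T S h) fun _ => .imp (loc A T m) fun _ => .concl (loc A S (lam A fun a => h (m a)))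
def locPost := locPost.stmt.thm 56 (by dsimp only [Stmt.Use])
def locPost.proof : locPost.stmt.Proof :=
  fun A T _ m _ e l =>
    (equivInd (Ex.lam (univ 0) fun S => Ex.lam (arr T S) fun h => loc A S (Ex.lam A fun a => h (m a)))
      l.c e).c

def locPost.context : List Tm := extend locOfHomotopy.context 61 [locPost.stmt.decl locPost.proof]

theorem locPost.conservative : Conservative Modality.genericContext locPost.context 57 :=
  locOfHomotopy.conservative.extend _ (by decide +kernel)

abbrev locPostCancel.stmt : Stmt :=
  .small fun A => .small fun T => .small fun S => .all (arr A T) fun m => .all (arr T S) fun h =>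
    .imp (isEquiv T S h) fun _ => .imp (loc A S (lam A fun a => h (m a))) fun _ => .concl (loc A T m)
def locPostCancel := locPostCancel.stmt.thm 57 (by dsimp only [Stmt.Use])
def locPostCancel.proof : locPostCancel.stmt.Proof :=
  fun A T _ m _ e l =>
    (equivInd (Ex.lam (univ 0) fun S => Ex.lam (arr T S) fun h =>
      arr (loc A S (Ex.lam A fun a => h (m a))) (loc A T m))
      (.c (.lam fun l => l : Trm (arr (loc A T m) (loc A T m)))) e).apps [l]

def locPostCancel.context : List Tm :=
  extend locPost.context 62 [locPostCancel.stmt.decl locPostCancel.proof]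

theorem locPostCancel.conservative : Conservative Modality.genericContext locPostCancel.context 58 :=
  locPost.conservative.extend _ (by decide +kernel)

abbrev locPre.stmt : Stmt :=
  .small fun A => .small fun T => .small fun S => .all (arr A T) fun m => .all (arr S A) fun h =>
    .imp (isEquiv S A h) fun _ => .imp (loc A T m) fun _ => .concl (loc S T (lam S fun a => m (h a)))
def locPre := locPre.stmt.thm 58 (by dsimp only [Stmt.Use])
def locPre.proof : locPre.stmt.Proof :=
  fun A T _ m _ e l =>
    (equivInd' (Ex.lam (univ 0) fun S => Ex.lam (arr S A) fun h => loc S T (Ex.lam S fun a => m (h a)))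
      l.c e).c

def locPre.context : List Tm := extend locPostCancel.context 63 [locPre.stmt.decl locPre.proof]

theorem locPre.conservative : Conservative Modality.genericContext locPre.context 59 :=
  locPostCancel.conservative.extend _ (by decide +kernel)

/-- Two localizations of one type are compared by an equivalence: if `m` is the unit, then `d`
extends the localization `d ∘ m`. -/
abbrev locCancel.stmt : Stmt :=
  .small fun A => .small fun T => .small fun S => .all (arr A T) fun m => .all (arr T S) fun d =>
    .imp (loc A T m) fun _ => .imp (loc A S (lam A fun a => d (m a))) fun _ => .concl (isEquiv T S d)
def locCancel := locCancel.stmt.thm 59 (by dsimp only [Stmt.Use])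
def locCancel.proof : locCancel.stmt.Proof :=
  fun A T S m d l k =>
    let D := fun T m => pi (arr T S) fun d =>
      arr (loc A S (Ex.lam A fun a => d (m a))) (isEquiv T S d)
    let c : Trm (D (bang A) (unitMap A)) := .lam fun d => .lam fun k =>
      isEquivOfLoc d (.lam fun _ => .rfl) k
    (locInd (Ex.lam (univ 0) fun T => Ex.lam (arr A T) fun m => D T m) c.c l).apps [d, k]

def locCancel.context : List Tm := extend locPre.context 64 [locCancel.stmt.decl locCancel.proof]

theorem locCancel.conservative : Conservative Modality.genericContext locCancel.context 60 :=
  locPre.conservative.extend _ (by decide +kernel)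

abbrev locElim.stmt : Stmt :=
  .small fun A => .small fun T => .all (arr A T) fun m => .fam T 0 fun P => .imp (loc A T m) fun _ =>
    .imp (pi T fun t => isModal (P t)) fun _ => .imp (pi A fun a => P (m a)) fun _ => .concl (pi T P)
def locElim := locElim.stmt.thm 60 (by dsimp only [Stmt.Use])
def locElim.proof : locElim.stmt.Proof :=
  fun A T m P l k d =>
    let D := fun T m => pi (arr T (univ 0)) fun P => arr (pi T fun t => isModal (P t))
      (arr (pi A fun a => P (m a)) (pi T fun t => P t))
    let c : Trm (D (bang A) (unitMap A)) := .lam fun P => .lam fun k => .lam fun d =>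
      modalElim (P := fun u => P.val u) k d.c
    (locInd (Ex.lam (univ 0) fun T => Ex.lam (arr A T) fun m => D T m) c.c l).apps
      [Ex.lam T P, k, d]

def locElim.context : List Tm := extend locCancel.context 65 [locElim.stmt.decl locElim.proof]

theorem locElim.conservative : Conservative Modality.genericContext locElim.context 61 :=
  locCancel.conservative.extend _ (by decide +kernel)

abbrev locRec.stmt : Stmt :=
  .small fun A => .small fun T => .small fun S => .all (arr A T) fun m => .imp (loc A T m) fun _ =>
    .imp (isModal S) fun _ => .raw (arr A S) fun g =>
    .concl (sig (arr T S) fun h => pi A fun a => eq S (h (m a)) (g a))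
def locRec := locRec.stmt.thm 61 (by dsimp only [Stmt.Use])
def locRec.proof : locRec.stmt.Proof :=
  fun A T S m l k g =>
    let D := fun T m => sig (arr T S) fun h => pi A fun a => eq S (h (m a)) (g a)
    ((locInd (Ex.lam (univ 0) fun T => Ex.lam (arr A T) fun m => D T m)
      ((extContr (x := A) k g).center.c) l).c)

def locRec.context : List Tm := extend locElim.context 66 [locRec.stmt.decl locRec.proof]

theorem locRec.conservative : Conservative Modality.genericContext locRec.context 62 :=
  locElim.conservative.extend _ (by decide +kernel)

/-- The extension `k` of `m` has inverse `j`. Elimination shows that `j ∘ k` is the identity, and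
the last hypothesis applies to `k ∘ j`, which fixes `m`. -/
abbrev locIntro.stmt : Stmt :=
  .small fun A => .small fun T => .all (arr A T) fun m => .imp (isModal T) fun _ =>
    .imp (arr T (bang A)) fun j => .imp (pi A fun a => eq (bang A) (j (m a)) (unit A a)) fun _ =>
    .imp (pi (arr T T) fun p => arr (pi A fun a => eq T (p (m a)) (m a)) (pi T fun t => eq T (p t) t)) fun _ =>
    .concl (loc A T m)
def locIntro := locIntro.stmt.thm 62 (by dsimp only [Stmt.Use])
def locIntro.proof : locIntro.stmt.Proof :=
  fun A T m t j jm uniq => modalExt (P := fun _ => T) (.lam fun _ => t) ⟨m⟩ _ (.lam fun k => .lam fun β =>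
    Trm.locMk k (isEquivMk j
      (modalElim (P := fun u => eq (bang A) (j.val (k.val u)) u)
        (.lam fun u => modalEq (bangModal A) (j.val (k.val u)) u)
        (.lam fun a => ((β a).ap (B := bang A) fun t => j.val t).trans (jm a)))
      ((uniq (.lam fun t => k (j t))).apps
        [Ex.lam A fun a => ((jm ⟨a⟩).ap (B := T) fun u => k.val u).trans (β ⟨a⟩)]))
      β.c)

def locIntro.context : List Tm := extend locRec.context 67 [locIntro.stmt.decl locIntro.proof]

theorem locIntro.conservative : Conservative Modality.genericContext locIntro.context 63 :=
  locRec.conservative.extend _ (by decide +kernel)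

/-- Maps `E v → !(Σ P)` are found by eliminating `v` to a point `b^!`, where `P b → E (b^!)` is a
localization. The same double elimination shows that an endomap of `Σ E` fixing the image of `Σ P`
is the identity. -/
abbrev totSigUnit.stmt : Stmt :=
  .small fun B => .fam B 0 fun P => .fam (bang B) 0 fun E =>
    .imp (pi (bang B) fun v => isModal (E v)) fun _ =>
    .raw (pi B fun b => arr (P b) (E (unit B b))) fun q =>
    .imp (pi B fun b => loc (P b) (E (unit B b)) (q b)) fun _ =>
    .concl (loc (sig B P) (sig (bang B) E) (lam (sig B P) fun w =>
      dpair (bang B) E (unit B (fst B P w)) (q (fst B P w) (snd B P w))))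
def totSigUnit := totSigUnit.stmt.thm 63 (by dsimp only [Stmt.Use])
def totSigUnit.proof : totSigUnit.stmt.Proof :=
  fun B P E m q l =>
    let S := sig B P
    let T := sig (bang B) E
    let R b := locRec (l b) (bangModal S) (Ex.lam (P b) fun e => unit S (dpair B P b e))
    modalExt (P := fun v => arr (E v) (bang S)) (.lam fun _ => modalPi (.lam fun _ => bangModal S))
      (.lam fun b => (R b).fst.c) _ (.lam fun J => .lam fun β =>
        locIntro (modalSig (bangModal B) m) (.lam fun t => ⟨J.val t.fst t.snd⟩)
          (.lam fun w => (w.split (fun w => eq (bang S)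
              (J.val (unit B (fst B P w)) (q (fst B P w) (snd B P w))) (unit S w)) fun b e =>
            ((((β.app b).ap (B := bang S) fun g => g (q b e))).trans' ((R b).snd.app e)).c).c)
          (.lam fun p => .lam fun H => .lam fun t =>
            let D v e := eq T (p.val (dpair (bang B) E v e)) (dpair (bang B) E v e)
            let k v e : Trm (isModal (D v e)) := modalEq (modalSig (bangModal B) m)
              (p.val (dpair (bang B) E v e)) (dpair (bang B) E v e)
            t.split (fun t => eq T (p.val t) t) fun v e =>
              (modalElim (P := fun v => pi (E v) fun e => D v e)
                (.lam fun v => modalPi (.lam fun e => k v e))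
                (.lam fun b => locElim (P := fun e => D (unit B b) e) (l b)
                  (.lam fun e => k (unit B b) e)
                  (.lam fun w => (H.app ⟨dpair B P b w⟩).c)) v).apps [e]))

def totSigUnit.context : List Tm :=
  extend locIntro.context 68 [totSigUnit.stmt.decl totSigUnit.proof]

theorem totSigUnit.conservative : Conservative Modality.genericContext totSigUnit.context 64 :=
  locIntro.conservative.extend _ (by decide +kernel)

/-- Localizations of the base and of the fibers give a localization of the total space. -/
abbrev totSig.stmt : Stmt :=
  .small fun B => .small fun B' => .all (arr B B') fun b => .fam B 0 fun P => .fam B' 0 fun E =>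
    .imp (loc B B' b) fun _ => .imp (pi B' fun v => isModal (E v)) fun _ =>
    .raw (pi B fun y => arr (P y) (E (b y))) fun q =>
    .imp (pi B fun y => loc (P y) (E (b y)) (q y)) fun _ =>
    .concl (loc (sig B P) (sig B' E) (lam (sig B P) fun w =>
      dpair B' E (b (fst B P w)) (q (fst B P w) (snd B P w))))
def totSig := totSig.stmt.thm 64 (by dsimp only [Stmt.Use])
def totSig.proof : totSig.stmt.Proof :=
  fun B B' b P E l m q k =>
    let D B' b := pi (arr B' (univ 0)) fun E => arr (pi B' fun v => isModal (E v))
      (pi (pi B fun y => arr (P y) (E (b y))) fun q =>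
        arr (pi B fun y => loc (P y) (E (b y)) (q y))
          (loc (sig B P) (sig B' fun v => E v) (Ex.lam (sig B P) fun w =>
            dpair B' (fun v => E v) (b (fst B P w)) (q (fst B P w) (snd B P w)))))
    -- By `locInd` the base localization may be taken to be the unit.
    let d : Trm (D (bang B) (unitMap B)) := .lam fun E => .lam fun m => .lam fun q => .lam fun k =>
      totSigUnit (P := P) m q k
    (locInd (Ex.lam (univ 0) fun B' => Ex.lam (arr B B') fun b => D B' b) d.c l).apps
      [Ex.lam B' E, m, q, k]

def totSig.context : List Tm := extend totSigUnit.context 69 [totSig.stmt.decl totSig.proof]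

theorem totSig.conservative : Conservative Modality.genericContext totSig.context 65 :=
  totSigUnit.conservative.extend _ (by decide +kernel)

/-- The domain of a map is the total space of its fibers. -/
abbrev sigFib.stmt : Stmt :=
  .raw (univ 0) fun X => .raw (univ 0) fun Y => .raw (arr X Y) fun f =>
    .concl (isEquiv X (sig Y fun y => fib X Y f y) (lam X fun x =>
      dpair Y (fun y => fib X Y f y) (f x) (fibMk X Y f (f x) x (rfl Y (f x)))))
def sigFib := sigFib.stmt.thm 65 (by dsimp only [Stmt.Use])
def sigFib.proof : sigFib.stmt.Proof :=
  fun X Y f =>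
    let P y := fib X Y f y
    let h x := dpair Y P (f x) (fibMk X Y f (f x) x (rfl Y (f x)))
    isEquivMk (.lam fun z => ⟨fibPt X Y f (fst Y P z.val) (snd Y P z.val)⟩) (.lam fun _ => .rfl)
      (.lam fun z => (z.split (fun z => eq (sig Y P) (h (fibPt X Y f (fst Y P z) (snd Y P z))) z)
        fun y w => (w.fibInd (fun w => eq (sig Y P) (h (fibPt X Y f y w)) (dpair Y P y w)) fun x p =>
          p.indL (fun y p => eq (sig Y P) (h x) (dpair Y P y (fibMk X Y f y x p))) .rfl |>.c).c).c)

def sigFib.context : List Tm := extend totSig.context 70 [sigFib.stmt.decl sigFib.proof]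

theorem sigFib.conservative : Conservative Modality.genericContext sigFib.context 66 :=
  totSig.conservative.extend _ (by decide +kernel)

/-- If all `q y` are localizations, so is the induced map into the total space. -/
abbrev totLoc.stmt : Stmt :=
  .small fun X => .small fun B => .raw (arr X B) fun f => .fam (bang B) 0 fun E =>
    .imp (pi (bang B) fun v => isModal (E v)) fun _ =>
    .raw (pi B fun y => arr (fib X B f y) (E (unit B y))) fun q =>
    .imp (pi B fun y => loc (fib X B f y) (E (unit B y)) (q y)) fun _ =>
    .concl (loc X (sig (bang B) E) (lam X fun x =>
      dpair (bang B) E (unit B (f x)) (q (f x) (fibMk X B f (f x) x (rfl B (f x))))))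
def totLoc := totLoc.stmt.thm 66 (by dsimp only [Stmt.Use])
def totLoc.proof : totLoc.stmt.Proof :=
  fun X B f E m q l =>
    (locPre (sigFib X B f) (totSigUnit (P := fun y => fib X B f y) m q l)).c

def totLoc.context : List Tm := extend sigFib.context 71 [totLoc.stmt.decl totLoc.proof]

theorem totLoc.conservative : Conservative Modality.genericContext totLoc.context 67 :=
  sigFib.conservative.extend _ (by decide +kernel)

abbrev fibFst.stmt : Stmt :=
  .small fun A => .fam A 0 fun P => .raw A fun a =>
    .concl (isEquiv (P a) (fib (sig A P) A (lam (sig A P) fun w => fst A P w) a)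
      (lam (P a) fun e => fibMk (sig A P) A (lam (sig A P) fun w => fst A P w) a
        (dpair A P a e) (rfl A a)))
def fibFst := fibFst.stmt.thm 67 (by dsimp only [Stmt.Use])
def fibFst.proof : fibFst.stmt.Proof :=
  fun A P a =>
    let π := Ex.lam (sig A P) fun w => fst A P w
    let h a e := fibMk (sig A P) A π a (dpair A P a e) (rfl A a)
    let g : Trm (arr (fib (sig A P) A π a) (P a)) := .lam fun w =>
      (w.path.c (T := eq A (fst A P (fibPt (sig A P) A π a w)) a)).transport P w.pt.snd
    isEquivMk g (.lam fun _ => .rfl) (.lam fun w =>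
      (w.fibInd (fun w => eq (fib (sig A P) A π a) (h a (g.val w)) w) fun z r =>
        (z.split (fun z => pi (eq A (π z) a) fun r => eq (fib (sig A P) A π a)
            (h a (g.val (fibMk (sig A P) A π a z r))) (fibMk (sig A P) A π a z r))
          fun b e => .lam fun r =>
            ((r.c : Trm (eq A b.val a)).indR (fun b r => pi (P b) fun e => eq (fib (sig A P) A π a)
              (h a (g.val (fibMk (sig A P) A π a (dpair A P b e) r)))
              (fibMk (sig A P) A π a (dpair A P b e) r)) (.lam fun _ => .rfl)).apps [e]).apps [r]).c)

def fibFst.context : List Tm := extend totLoc.context 72 [fibFst.stmt.decl fibFst.proof]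

theorem fibFst.conservative : Conservative Modality.genericContext fibFst.context 68 :=
  totLoc.conservative.extend _ (by decide +kernel)

/-! ### The comparison map `δ` and the main criterion -/

/-- Abstraction over a square of `f : X → Y` and `n : T → !Y` with `m : X → T` and the unit. -/
def lamSquare (b : Ex → Ex → Ex → Ex → Ex → Ex → Ex → Ex) (X Y f T m n nn : Ex) : Ex :=
  (lam (univ 0) fun X => lam (univ 0) fun Y => lam (arr X Y) fun f => lam (univ 0) fun T =>
    lam (arr X T) fun m => lam (arr T (bang Y)) fun n =>
      lam (pi X fun x => eq (bang Y) (n (m x)) (unit Y (f x))) fun nn => b X Y f T m n nn)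
    X Y f T m n nn

/-- The map `fib_f(y) → fib_n(y^!)` induced by such a square. -/
def deltaMap (X Y f T m n nn y : Ex) : Ex :=
  lamSquare (fun X Y f T m n nn => lam Y fun y => lam (fib X Y f y) fun w =>
    let x := fibPt X Y f y w
    fibMk T (bang Y) n (unit Y y) (m x)
      (concat (bang Y) (n (m x)) (unit Y (f x)) (unit Y y) (nn x)
        (ap Y (bang Y) (unitMap Y) (f x) y (fibPath X Y f y w)))) X Y f T m n nn y

/-- The maps `fib_f(y) → fib_n(y^!)` are localizations. -/
def locFibers (X Y f T m n nn : Ex) : Ex :=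
  lamSquare (fun X Y f T m n nn => pi Y fun y =>
    loc (fib X Y f y) (fib T (bang Y) n (unit Y y)) (deltaMap X Y f T m n nn y)) X Y f T m n nn

def bmap (X Y f : Ex) : Ex := Modality.generic.map X Y f
def bnat (X Y f : Ex) : Ex := lam X fun x => Modality.generic.nat X Y f x

/-- Up to equivalence `deltaMap` does not depend on the square, if `m` is a localization. -/
abbrev deltaInvariance.stmt : Stmt :=
  .small fun X => .raw (univ 0) fun Y => .raw (arr X Y) fun f => .small fun T =>
    .all (arr X T) fun m => .imp (loc X T m) fun _ => .raw (arr T (bang Y)) fun n =>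
    .raw (pi X fun x => eq (bang Y) (n (m x)) (unit Y (f x))) fun nn =>
    .raw (arr (bang X) (bang Y)) fun n' =>
    .raw (pi X fun x => eq (bang Y) (n' (unit X x)) (unit Y (f x))) fun nn' => .raw Y fun y =>
    .raw (pi (univ 0) fun T => arr (arr (fib X Y f y) T) (univ 2)) fun C =>
    .concl (iff (C (fib T (bang Y) n (unit Y y)) (deltaMap X Y f T m n nn y))
      (C (fib (bang X) (bang Y) n' (unit Y y)) (deltaMap X Y f (bang X) (unitMap X) n' nn' y)))
def deltaInvariance := deltaInvariance.stmt.thm 68 (by dsimp only [Stmt.Use])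
def deltaInvariance.proof : deltaInvariance.stmt.Proof :=
  fun X Y f T m l n nn n' nn' y C =>
    let C' := C (fib (bang X) (bang Y) n' (unit Y y)) (deltaMap X Y f (bang X) (unitMap X) n' nn' y)
    let G T m n nn := iff (C (fib T (bang Y) n (unit Y y)) (deltaMap X Y f T m n nn y)) C'
    let D T m := pi (arr T (bang Y)) fun n =>
      pi (pi X fun x => eq (bang Y) (n (m x)) (unit Y (f x))) fun nn => G T m n nn
    let i : Trm (iff C' C') := .pair (.lam fun c => c : Trm (arr _ _)) (.lam fun c => c : Trm (arr _ _))
    let d : Trm (D (bang X) (unitMap X)) := .lam fun n => .lam fun nn =>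
      -- Once `m` is the unit, `(n, nn)` and `(n', nn')` are two extensions of `x ↦ (f x)^!` to
      -- `!X`, and the type of these is contractible.
      (contrSigInd (extContr (x := X) (bangModal Y) (Ex.lam X fun x => unit Y (f x)))
        (Ex.lam (arr (bang X) (bang Y)) fun n =>
          Ex.lam (pi X fun x => eq (bang Y) (n (unit X x)) (unit Y (f x))) fun nn => G (bang X) (unitMap X) n nn)
        n' nn' i.c n nn).c
    (locInd (Ex.lam (univ 0) fun T => Ex.lam (arr X T) fun m => D T m) d.c l).apps [n, nn]

def deltaInvariance.context : List Tm :=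
  extend fibFst.context 73 [deltaInvariance.stmt.decl deltaInvariance.proof]

theorem deltaInvariance.conservative : Conservative Modality.genericContext deltaInvariance.context 69 :=
  fibFst.conservative.extend _ (by decide +kernel)

abbrev locFibersInvariance.stmt : Stmt :=
  .small fun X => .small fun Y => .all (arr X Y) fun f => .small fun T =>
    .all (arr X T) fun m => .all (arr T (bang Y)) fun n =>
    .all (pi X fun x => eq (bang Y) (n (m x)) (unit Y (f x))) fun nn => .imp (loc X T m) fun _ =>
    .imp (locFibers X Y f T m n nn) fun _ => .raw (arr (bang X) (bang Y)) fun n' =>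
    .raw (pi X fun x => eq (bang Y) (n' (unit X x)) (unit Y (f x))) fun nn' =>
    .concl (locFibers X Y f (bang X) (unitMap X) n' nn')
def locFibersInvariance := locFibersInvariance.stmt.thm 69 (by dsimp only [Stmt.Use])
def locFibersInvariance.proof : locFibersInvariance.stmt.Proof :=
  fun X Y f T m n nn l h n' nn' =>
    (.lam fun y => (deltaInvariance Y f l n nn n' nn' y
      (Ex.lam (univ 0) fun S => Ex.lam (arr (fib X Y f y) S) fun d => loc (fib X Y f y) S d)).fst.apps
        [h.val y] : Trm (pi Y fun y => loc (fib X Y f y) (fib (bang X) (bang Y) n' (unit Y y))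
          (deltaMap X Y f (bang X) (unitMap X) n' nn' y))).c

def locFibersInvariance.context : List Tm :=
  extend deltaInvariance.context 74 [locFibersInvariance.stmt.decl locFibersInvariance.proof]

theorem locFibersInvariance.conservative : Conservative Modality.genericContext locFibersInvariance.context 70 :=
  deltaInvariance.conservative.extend _ (by decide +kernel)

/-- `f` is a fibration if its modal fibers extend to a family of modal types over `!Y`. -/
abbrev fibOfFamily.stmt : Stmt :=
  .small fun X => .small fun Y => .all (arr X Y) fun f => .fam (bang Y) 0 fun E =>
    .imp (pi (bang Y) fun v => isModal (E v)) fun _ =>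
    .raw (pi Y fun y => arr (fib X Y f y) (E (unit Y y))) fun q =>
    .imp (pi Y fun y => loc (fib X Y f y) (E (unit Y y)) (q y)) fun _ =>
    .raw (arr (bang X) (bang Y)) fun n =>
    .raw (pi X fun x => eq (bang Y) (n (unit X x)) (unit Y (f x))) fun nn =>
    .concl (locFibers X Y f (bang X) (unitMap X) n nn)
def fibOfFamily := fibOfFamily.stmt.thm 70 (by dsimp only [Stmt.Use])
def fibOfFamily.proof : fibOfFamily.stmt.Proof :=
  fun X Y f E m q l n nn =>
    -- The projection `π : S → !Y` stands in for `!f`: by `totLoc` the map `M : X → S` is a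
    -- localization over `!Y`. The fiber of `π` over `y^!` is `E (y^!)`, and `H` identifies
    -- `deltaMap` with `q y` under this equivalence.
    let S := sig (bang Y) E
    let π := Ex.lam S fun w => fst (bang Y) E w
    let ρ := Ex.lam X fun x => rfl (bang Y) (unit Y (f x))
    let M := Ex.lam X fun x =>
      dpair (bang Y) E (unit Y (f x)) (q (f x) (fibMk X Y f (f x) x (rfl Y (f x))))
    let h y e := fibMk S (bang Y) π (unit Y y) (dpair (bang Y) E (unit Y y) e) (rfl (bang Y) (unit Y y))
    let H (y : Trm Y) : Trm (pi (fib X Y f y) fun w => eq (fib S (bang Y) π (unit Y y))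
        ((Ex.lam (fib X Y f y) fun w => h y (q y w)) w) (deltaMap X Y f S M π ρ y w)) :=
      .lam fun w => (w.fibInd (fun w => eq (fib S (bang Y) π (unit Y y)) (h y (q y w))
          (deltaMap X Y f S M π ρ y w)) fun x p =>
        p.indL (fun y p => eq (fib S (bang Y) π (unit Y y)) (h y (q y (fibMk X Y f y x p)))
          (deltaMap X Y f S M π ρ y (fibMk X Y f y x p))) .rfl).c
    let L : Trm (pi Y fun y => loc (fib X Y f y) (fib S (bang Y) π (unit Y y))
        (deltaMap X Y f S M π ρ y)) := .lam fun y =>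
      locOfHomotopy (H y) (locPost (fibFst (x := bang Y) (P := E) (unit Y y)) (l y)).c
    locFibersInvariance (totLoc f m q l) (L.c : Trm (locFibers X Y f S M π ρ)) n nn

def fibOfFamily.context : List Tm :=
  extend locFibersInvariance.context 75 [fibOfFamily.stmt.decl fibOfFamily.proof]

theorem fibOfFamily.conservative : Conservative Modality.genericContext fibOfFamily.context 71 :=
  locFibersInvariance.conservative.extend _ (by decide +kernel)

/-! ### Connected maps -/

/-- All types `!fib_f(y)` are contractible. -/
abbrev conn (X Y f : Ex) : Ex := pi Y fun y => isContr (bang (fib X Y f y))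

abbrev bangContrOfEquiv.stmt : Stmt :=
  .small fun A => .small fun B => .all (arr A B) fun f => .imp (isEquiv A B f) fun _ =>
    .imp (isContr (bang A)) fun _ => .concl (isContr (bang B))
def bangContrOfEquiv := bangContrOfEquiv.stmt.thm 71 (by dsimp only [Stmt.Use])
def bangContrOfEquiv.proof : bangContrOfEquiv.stmt.Proof :=
  fun A B f e h => (equivInd (Ex.lam (univ 0) fun B => Ex.lam (arr A B) fun _ => isContr (bang B)) h.c e).c

def bangContrOfEquiv.context : List Tm :=
  extend fibOfFamily.context 76 [bangContrOfEquiv.stmt.decl bangContrOfEquiv.proof]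

theorem bangContrOfEquiv.conservative : Conservative Modality.genericContext bangContrOfEquiv.context 72 :=
  fibOfFamily.conservative.extend _ (by decide +kernel)

abbrev bangContrOfEquiv'.stmt : Stmt :=
  .small fun A => .small fun B => .all (arr A B) fun f => .imp (isEquiv A B f) fun _ =>
    .imp (isContr (bang B)) fun _ => .concl (isContr (bang A))
def bangContrOfEquiv' := bangContrOfEquiv'.stmt.thm 72 (by dsimp only [Stmt.Use])
def bangContrOfEquiv'.proof : bangContrOfEquiv'.stmt.Proof :=
  fun A B f e h => (equivInd' (Ex.lam (univ 0) fun A => Ex.lam (arr A B) fun _ => isContr (bang A)) h.c e).c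

def bangContrOfEquiv'.context : List Tm :=
  extend bangContrOfEquiv.context 77 [bangContrOfEquiv'.stmt.decl bangContrOfEquiv'.proof]

theorem bangContrOfEquiv'.conservative : Conservative Modality.genericContext bangContrOfEquiv'.context 73 :=
  bangContrOfEquiv.conservative.extend _ (by decide +kernel)

/-- The types `!fib(v)` are modal, so a center is needed only over points `a^!`, where it is `(a,
rfl)^!`. Path induction on a point of the fiber shows that everything agrees with the center. -/
abbrev unitConn.stmt : Stmt :=
  .raw (univ 0) fun A => .concl (conn A (bang A) (unitMap A))
def unitConn := unitConn.stmt.thm 73 (by dsimp only [Stmt.Use])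
def unitConn.proof : unitConn.stmt.Proof :=
  fun A =>
    let F v := fib A (bang A) (unitMap A) v
    modalExt (x := A) (P := fun v => bang (F v)) (.lam fun v => bangModal (F v))
      (.lam fun a => ⟨unit (F (unit A a)) (fibMk A (bang A) (unitMap A) (unit A a) a (rfl (bang A) (unit A a)))⟩)
      _ (.lam fun h => .lam fun β => .lam fun v => .contr ⟨h.val v⟩ fun u =>
        (modalElim (x := F v) (P := fun u => eq (bang (F v)) (h.val v) u)
          (.lam fun u => modalEq (bangModal (F v)) (h.val v) u)
          (.lam fun w => (w.fibInd (fun w => eq (bang (F v)) (h.val v) (unit (F v) w)) fun x p =>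
            p.indL (fun v p => eq (bang (F v)) (h.val v) (unit (F v) (fibMk A (bang A) (unitMap A) v x p)))
              (β x).c))).app u)

def unitConn.context : List Tm :=
  extend bangContrOfEquiv'.context 78 [unitConn.stmt.decl unitConn.proof]

theorem unitConn.conservative : Conservative Modality.genericContext unitConn.context 74 :=
  bangContrOfEquiv'.conservative.extend _ (by decide +kernel)

abbrev connOfLoc.stmt : Stmt :=
  .small fun A => .small fun T => .all (arr A T) fun m => .imp (loc A T m) fun _ => .concl (conn A T m)
def connOfLoc := connOfLoc.stmt.thm 74 (by dsimp only [Stmt.Use])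
def connOfLoc.proof : connOfLoc.stmt.Proof :=
  fun A T m l => (locInd (Ex.lam (univ 0) fun T => Ex.lam (arr A T) fun m => conn A T m) (unitConn A).c l).c

def connOfLoc.context : List Tm := extend unitConn.context 79 [connOfLoc.stmt.decl connOfLoc.proof]

theorem connOfLoc.conservative : Conservative Modality.genericContext connOfLoc.context 75 :=
  unitConn.conservative.extend _ (by decide +kernel)

/-- Abbreviates a proof in a proof. -/
def _root_.HoTT.Trm.bind {A B : Ex} (t : Trm A) (b : Trm A → Trm B) : Trm B :=
  ⟨Ex.lam A (fun x => (b ⟨x⟩).val) t.val⟩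

/-- A map `fib_m(t) → P t` into a modal type extends to `!fib_m(t)`, which has a point. -/
abbrev connElim.stmt : Stmt :=
  .small fun A => .small fun T => .all (arr A T) fun m => .fam T 0 fun P => .imp (conn A T m) fun _ =>
    .imp (pi T fun t => isModal (P t)) fun _ => .imp (pi A fun a => P (m a)) fun _ => .concl (pi T P)
def connElim := connElim.stmt.thm 75 (by dsimp only [Stmt.Use])
def connElim.proof : connElim.stmt.Proof :=
  fun A T m P h k d => .lam fun t =>
    (modalElim (x := fib A T m t) (P := fun _ => P t) (.lam fun _ => k t)
      (.lam fun w => (w.fibInd (fun _ => P t) fun a q => q.indL (fun t _ => P t) (d a).c))).app (h t).center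

def connElim.context : List Tm := extend connOfLoc.context 80 [connElim.stmt.decl connElim.proof]

theorem connElim.conservative : Conservative Modality.genericContext connElim.context 76 :=
  connOfLoc.conservative.extend _ (by decide +kernel)

abbrev connRec.stmt : Stmt :=
  .small fun A => .small fun T => .small fun S => .all (arr A T) fun m => .imp (conn A T m) fun _ =>
    .imp (isModal S) fun _ => .raw (arr A S) fun g =>
    .concl (sig (arr T S) fun h => pi A fun a => eq S (h (m a)) (g a))
def connRec := connRec.stmt.thm 76 (by dsimp only [Stmt.Use])
def connRec.proof : connRec.stmt.Proof :=
  fun A T S m h k g =>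
    let F t := fib A T m t
    let r t := Ex.lam (F t) fun w => g (fibPt A T m t w)
    Trm.bind (.lam fun t => locRec (unitLoc (F t)) k (r t) : Trm (pi T fun t =>
      sig (arr (bang (F t)) S) fun h => pi (F t) fun w => eq S (h (unitMap (F t) w)) (r t w))) fun R =>
    let R t := R.app ⟨t⟩
    -- Over `t = m a` the center equals `(a, rfl)^!`, on which the extension has the value `g a`.
    .pair (.lam fun t => (R t).fst.app (h t).center) (.c (.lam fun a =>
        let u : Trm (F (m a)) := .fibMk ⟨a⟩ .rfl
        ((((h ⟨m a⟩).contract ⟨unit (F (m a)) u⟩).ap (B := S) fun u => (R (m a)).fst.val u).trans'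
          ((R (m a)).snd.app u)).c :
      Trm (pi A fun a => eq S ((R (m a)).fst.val (h ⟨m a⟩).center) (g a))))

def connRec.context : List Tm := extend connElim.context 81 [connRec.stmt.decl connRec.proof]

theorem connRec.conservative : Conservative Modality.genericContext connRec.context 77 :=
  connElim.conservative.extend _ (by decide +kernel)

/-- Connected maps have the elimination into modal types, with its uniqueness, that `locIntro` asks
for. -/
abbrev locOfConn.stmt : Stmt :=
  .small fun A => .small fun T => .all (arr A T) fun m => .imp (isModal T) fun _ =>
    .imp (conn A T m) fun _ => .concl (loc A T m)
def locOfConn := locOfConn.stmt.thm 77 (by dsimp only [Stmt.Use])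
def locOfConn.proof : locOfConn.stmt.Proof :=
  fun A T m k h => Trm.bind (connRec h (bangModal A) (unitMap A)) fun R =>
    locIntro k R.fst R.snd.c (.lam fun p => .lam fun H =>
      connElim (P := fun t => eq T (p.val t) t) h (.lam fun t => modalEq k (p.val t) t) H)

def locOfConn.context : List Tm := extend connRec.context 82 [locOfConn.stmt.decl locOfConn.proof]

theorem locOfConn.conservative : Conservative Modality.genericContext locOfConn.context 78 :=
  connRec.conservative.extend _ (by decide +kernel)

/-- Maps from a connected type to a modal type are constant. -/
abbrev connConst.stmt : Stmt :=
  .small fun A => .small fun T => .imp (isContr (bang A)) fun _ => .imp (isModal T) fun _ =>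
    .raw (arr A T) fun g => .raw A fun a => .raw A fun a' => .concl (eq T (g a) (g a'))
def connConst := connConst.stmt.thm 78 (by dsimp only [Stmt.Use])
def connConst.proof : connConst.stmt.Proof :=
  fun A T h k g a a' => modalExt (x := A) (P := fun _ => T) (.lam fun _ => k) ⟨g⟩ _
    (.lam fun G => .lam fun β => ((β.app ⟨a⟩).inv.trans
      ((contrPath h (unit A a) (unit A a')).ap (B := T) fun u => G.val u)).trans (β.app ⟨a'⟩))

def connConst.context : List Tm := extend locOfConn.context 83 [connConst.stmt.decl connConst.proof]

theorem connConst.conservative : Conservative Modality.genericContext connConst.context 79 :=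
  locOfConn.conservative.extend _ (by decide +kernel)

/-- The map `x ↦ (f x, d (x, refl))` into the total space of `Q` for a map `d : fib_f(y) → Q y`. -/
def totMap (X Y f : Ex) (Q : Ex → Ex) (d : Ex) : Ex :=
  lam X fun x => dpair Y Q (f x) (d (f x) (fibMk X Y f (f x) x (rfl Y (f x))))

/-- The fiber of the total map over `z = (y, e)` is the fiber of `d y` over `e`: both are generated
by points `(x, rfl)`, and path inductions in the two directions are mutually inverse. -/
abbrev fibTot.stmt : Stmt :=
  .raw (univ 0) fun X => .raw (univ 0) fun Y => .raw (arr X Y) fun f => .fam Y 0 fun Q =>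
    .raw (pi Y fun y => arr (fib X Y f y) (Q y)) fun d => .raw (sig Y Q) fun z =>
    .raw (univ 2) fun C =>
    .imp (pi (arr (fib X (sig Y Q) (totMap X Y f Q d) z)
        (fib (fib X Y f (fst Y Q z)) (Q (fst Y Q z)) (d (fst Y Q z)) (snd Y Q z))) fun k =>
      arr (isEquiv (fib X (sig Y Q) (totMap X Y f Q d) z)
        (fib (fib X Y f (fst Y Q z)) (Q (fst Y Q z)) (d (fst Y Q z)) (snd Y Q z)) k) C) fun _ =>
    .concl C
def fibTot := fibTot.stmt.thm 79 (by dsimp only [Stmt.Use])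
def fibTot.proof : fibTot.stmt.Proof :=
  fun X Y f Q d z C K =>
    let S := sig Y Q
    let m := totMap X Y f Q d
    let F z := fib X S m z
    let G y e := fib (fib X Y f y) (Q y) (d y) e
    let H z := G (fst Y Q z) (snd Y Q z)
    let g (x : Ex) : Trm (G (f x) (d (f x) (fibMk X Y f (f x) x (rfl Y (f x))))) :=
      .fibMk (.fibMk ⟨x⟩ .rfl) .rfl
    let ψ : Trm (pi S fun z => arr (F z) (H z)) := .lam fun z => .lam fun w =>
      w.fibInd (fun _ => H z) fun x r => r.indL (fun z _ => H z) (g x).c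
    let φ : Trm (pi S fun z => arr (H z) (F z)) := .lam fun z => z.split (fun z => arr (H z) (F z))
      fun y e => (.lam fun w => w.fibInd (fun _ => F (dpair Y Q y e)) fun v q =>
        q.indL (fun e _ => F (dpair Y Q y e)) (v.fibInd (fun v => F (dpair Y Q y (d y v))) fun x p =>
          p.indL (fun y p => F (dpair Y Q y (d y (fibMk X Y f y x p))))
            (.fibMk x .rfl : Trm (fib X S m (m x))).c) :
        Trm (arr (G y e) (F (dpair Y Q y e)))).c
    let η : Trm (pi S fun z => pi (F z) fun w => eq (F z) (φ.val z (ψ.val z w)) w) :=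
      .lam fun z => .lam fun w => w.fibInd (fun w => eq (F z) (φ.val z (ψ.val z w)) w) fun x r =>
        r.indL (fun z r => eq (F z) (φ.val z (ψ.val z (fibMk X S m z x r))) (fibMk X S m z x r)) .rfl
    let ε : Trm (pi S fun z => pi (H z) fun w => eq (H z) (ψ.val z (φ.val z w)) w) :=
      .lam fun z => z.split (fun z => pi (H z) fun w => eq (H z) (ψ.val z (φ.val z w)) w)
      fun y e => (.lam fun w =>
        let E e w := eq (G y e) (ψ.val (dpair Y Q y e) (φ.val (dpair Y Q y e) w)) w
        w.fibInd (E e) fun v q =>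
          q.indL (fun e q => E e (fibMk (fib X Y f y) (Q y) (d y) e v q))
            (v.fibInd (fun v => E (d y v) (fibMk (fib X Y f y) (Q y) (d y) (d y v) v (rfl (Q y) (d y v))))
              fun x p => p.indL (fun y p => let v := fibMk X Y f y x p
                eq (G y (d y v)) (ψ.val (dpair Y Q y (d y v)) (φ.val (dpair Y Q y (d y v))
                  (fibMk (fib X Y f y) (Q y) (d y) (d y v) v (rfl (Q y) (d y v)))))
                  (fibMk (fib X Y f y) (Q y) (d y) (d y v) v (rfl (Q y) (d y v)))) .rfl) :
        Trm (pi (G y e) fun w => eq (G y e) (ψ.val (dpair Y Q y e) (φ.val (dpair Y Q y e) w)) w)).c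
    let e : Trm (isEquiv (F z) (H z) (ψ.val z)) := isEquivMk ⟨φ.val z⟩ ⟨η.val z⟩ ⟨ε.val z⟩
    K.apps [ψ.val z, e]

def fibTot.context : List Tm := extend connConst.context 84 [fibTot.stmt.decl fibTot.proof]

theorem fibTot.conservative : Conservative Modality.genericContext fibTot.context 80 :=
  connConst.conservative.extend _ (by decide +kernel)

abbrev connTot.stmt : Stmt :=
  .raw (univ 0) fun X => .raw (univ 0) fun Y => .raw (arr X Y) fun f => .fam Y 0 fun Q =>
    .raw (pi Y fun y => arr (fib X Y f y) (Q y)) fun d =>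
    .imp (pi Y fun y => conn (fib X Y f y) (Q y) (d y)) fun _ =>
    .concl (conn X (sig Y Q) (totMap X Y f Q d))
def connTot := connTot.stmt.thm 80 (by dsimp only [Stmt.Use])
def connTot.proof : connTot.stmt.Proof :=
  fun X Y f Q d h => .lam fun z =>
    fibTot X Y f d z _ (.lam fun k => .lam fun e => bangContrOfEquiv' e ⟨h.val (fst Y Q z) (snd Y Q z)⟩)

def connTot.context : List Tm := extend fibTot.context 85 [connTot.stmt.decl connTot.proof]

theorem connTot.conservative : Conservative Modality.genericContext connTot.context 81 :=
  fibTot.conservative.extend _ (by decide +kernel)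

abbrev connOfTot.stmt : Stmt :=
  .raw (univ 0) fun X => .raw (univ 0) fun Y => .raw (arr X Y) fun f => .fam Y 0 fun Q =>
    .raw (pi Y fun y => arr (fib X Y f y) (Q y)) fun d =>
    .imp (conn X (sig Y Q) (totMap X Y f Q d)) fun _ =>
    .concl (pi Y fun y => conn (fib X Y f y) (Q y) (d y))
def connOfTot := connOfTot.stmt.thm 81 (by dsimp only [Stmt.Use])
def connOfTot.proof : connOfTot.stmt.Proof :=
  fun X Y f Q d h => .lam fun y => .lam fun e =>
    (fibTot X Y f (P := Q) d (dpair Y Q y e) _ (.lam fun k => .lam fun u =>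
      bangContrOfEquiv u ⟨h.val (dpair Y Q y e)⟩)).c

def connOfTot.context : List Tm := extend connTot.context 86 [connOfTot.stmt.decl connOfTot.proof]

theorem connOfTot.conservative : Conservative Modality.genericContext connOfTot.context 82 :=
  connTot.conservative.extend _ (by decide +kernel)

/-! ### Fibrations in terms of `δ` -/

def bangFib (X Y f y : Ex) : Ex := fib (bang X) (bang Y) (bmap X Y f) (unit Y y)
def delta (X Y f y : Ex) : Ex := deltaMap X Y f (bang X) (unitMap X) (bmap X Y f) (bnat X Y f) y
def gamma (X Y f y : Ex) : Ex := Modality.generic.gamma X Y f y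
def isFib (X Y f : Ex) : Ex := Modality.generic.isFibration X Y f
/-- The maps `δ` are localizations. -/
def locDelta (X Y f : Ex) : Ex :=
  locFibers X Y f (bang X) (unitMap X) (bmap X Y f) (bnat X Y f)

/-- The path over `a^!` is computed by `comp`, followed by cancelling the unit against its inverse.
-/
abbrev extendPathBeta.stmt : Stmt :=
  .raw (univ 0) fun A => .raw (univ 0) fun Y => .raw (arr (bang A) (bang Y)) fun p =>
    .raw (arr (bang A) (bang Y)) fun q =>
    .raw (pi A fun a => eq (bang Y) (p (unit A a)) (q (unit A a))) fun b => .raw A fun a =>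
    .concl (eq (eq (bang Y) (p (unit A a)) (q (unit A a)))
      (Modality.generic.extendPath A Y p q b (unit A a)) (b a))
def extendPathBeta := extendPathBeta.stmt.thm 82 (by dsimp only [Stmt.Use])
def extendPathBeta.proof : extendPathBeta.stmt.Proof :=
  fun A Y p q b a =>
    let E u := eq (bang Y) (p u) (q u)
    let t := Ex.lam A fun a => unit (E (unit A a)) (b a)
    let T := Ex.lam (bang A) E
    let m : Trm (isModal (E (unit A a))) := ⟨Modality.generic.idModal Y (p (unit A a)) (q (unit A a))⟩
    (((⟨Modality.generic.comp A T t a⟩ : Trm (eq (bang (E (unit A a)))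
        (Modality.generic.ind A T t (unit A a)) (unit (E (unit A a)) (b a)))).ap (B := E (unit A a))
      fun x => equivInv (E (unit A a)) (bang (E (unit A a))) (unitMap (E (unit A a))) m x).trans'
      (equivRet m (b a))).c

def extendPathBeta.context : List Tm :=
  extend connOfTot.context 87 [extendPathBeta.stmt.decl extendPathBeta.proof]

theorem extendPathBeta.conservative : Conservative Modality.genericContext extendPathBeta.context 83 :=
  connOfTot.conservative.extend _ (by decide +kernel)

/-- The points are joined by naturality for the map `fib_f(y) → X`. By `extendPathBeta` the path
stored in `γ (w^!)` is exactly the image of this path under `!f` followed by the path in `δ w`, as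
equality in a fiber demands. -/
abbrev gammaBeta.stmt : Stmt :=
  .raw (univ 0) fun X => .raw (univ 0) fun Y => .raw (arr X Y) fun f => .raw Y fun y =>
    .raw (fib X Y f y) fun w =>
    .concl (eq (bangFib X Y f y) (gamma X Y f y (unit (fib X Y f y) w)) (delta X Y f y w))
def gammaBeta := gammaBeta.stmt.thm 83 (by dsimp only [Stmt.Use])
def gammaBeta.proof : gammaBeta.stmt.Proof :=
  fun X Y f y w =>
    let F := fib X Y f y
    let π := Ex.lam F fun w => fibPt X Y f y w
    let n := bmap X Y f
    let q w : Trm (eq (bang Y) (n (unit X (π w))) (unit Y y)) :=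
      (⟨bnat X Y f (π w)⟩ : Trm (eq (bang Y) (n (unit X (π w))) (unit Y (f (π w))))).trans
        ((⟨fibPath X Y f y w⟩ : Trm (eq Y (f (π w)) y)).ap fun y => unit Y y)
    let p w : Trm (eq (bang X) (bmap F X π (unit F w)) (unit X (π w))) := ⟨bnat F X π w⟩
    let b w : Trm (eq (bang Y) (n (bmap F X π (unit F w))) (unit Y y)) :=
      ((p w).ap fun u => n u).trans (q w)
    let P := Ex.lam (bang F) fun u => n (bmap F X π u)
    let Q := Ex.lam (bang F) fun _ => unit Y y
    (fibEq n (⟨Modality.generic.extendPath F Y P Q (Ex.lam F fun w => b w) (unit F w)⟩ :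
      Trm (eq (bang Y) (n (bmap F X π (unit F w))) (unit Y y))) (q w) (p w)
      (extendPathBeta F Y P Q (Ex.lam F fun w => b w) w).c).c

def gammaBeta.context : List Tm :=
  extend extendPathBeta.context 88 [gammaBeta.stmt.decl gammaBeta.proof]

theorem gammaBeta.conservative : Conservative Modality.genericContext gammaBeta.context 84 :=
  extendPathBeta.conservative.extend _ (by decide +kernel)

/-- With the converse `fibOfLocDelta` this replaces `γ` by `δ` in all later arguments; `γ` is an
extension of `δ` by `gammaBeta`. -/
abbrev locDeltaOfFib.stmt : Stmt :=
  .small fun X => .small fun Y => .raw (arr X Y) fun f => .imp (isFib X Y f) fun _ => .concl (locDelta X Y f)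
def locDeltaOfFib := locDeltaOfFib.stmt.thm 84 (by dsimp only [Stmt.Use])
def locDeltaOfFib.proof : locDeltaOfFib.stmt.Proof :=
  fun X Y f h => (Trm.lam fun y => Trm.locMk ⟨gamma X Y f y⟩ (h.apps [y]) (.lam fun w => gammaBeta X Y f y w) :
    Trm (pi Y fun y => loc (fib X Y f y) (bangFib X Y f y) (delta X Y f y))).c

def locDeltaOfFib.context : List Tm :=
  extend gammaBeta.context 89 [locDeltaOfFib.stmt.decl locDeltaOfFib.proof]

theorem locDeltaOfFib.conservative : Conservative Modality.genericContext locDeltaOfFib.context 85 :=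
  gammaBeta.conservative.extend _ (by decide +kernel)

abbrev fibOfLocDelta.stmt : Stmt :=
  .small fun X => .small fun Y => .raw (arr X Y) fun f => .imp (locDelta X Y f) fun _ => .concl (isFib X Y f)
def fibOfLocDelta := fibOfLocDelta.stmt.thm 85 (by dsimp only [Stmt.Use])
def fibOfLocDelta.proof : fibOfLocDelta.stmt.Proof :=
  fun X Y f h => (.lam fun y => isEquivOfLoc (gamma X Y f y) (.lam fun w => gammaBeta X Y f y w)
    ⟨h.val y⟩ : Trm (pi Y fun y => isEquiv (bang (fib X Y f y)) (bangFib X Y f y) (gamma X Y f y))).c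

def fibOfLocDelta.context : List Tm :=
  extend locDeltaOfFib.context 90 [fibOfLocDelta.stmt.decl fibOfLocDelta.proof]

theorem fibOfLocDelta.conservative : Conservative Modality.genericContext fibOfLocDelta.context 86 :=
  locDeltaOfFib.conservative.extend _ (by decide +kernel)

abbrev bangFibModal.stmt : Stmt :=
  .raw (univ 0) fun X => .raw (univ 0) fun Y => .raw (arr X Y) fun f => .raw Y fun y =>
    .concl (isModal (bangFib X Y f y))
def bangFibModal := bangFibModal.stmt.thm 86 (by dsimp only [Stmt.Use])
def bangFibModal.proof : bangFibModal.stmt.Proof :=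
  fun X Y f y => fibModal (bmap X Y f) (unit Y y) (bangModal X) (bangModal Y)

def bangFibModal.context : List Tm :=
  extend fibOfLocDelta.context 91 [bangFibModal.stmt.decl bangFibModal.proof]

theorem bangFibModal.conservative : Conservative Modality.genericContext bangFibModal.context 87 :=
  fibOfLocDelta.conservative.extend _ (by decide +kernel)

abbrev iffMk.stmt : Stmt :=
  .type fun A => .type fun B => .imp (arr A B) fun _ => .imp (arr B A) fun _ => .concl (iff A B)
def iffMk := iffMk.stmt.thm 87 (by dsimp only [Stmt.Use])
def iffMk.proof : iffMk.stmt.Proof :=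
  fun _ _ f g => .pair f g

def iffMk.context : List Tm := extend bangFibModal.context 92 [iffMk.stmt.decl iffMk.proof]

theorem iffMk.conservative : Conservative Modality.genericContext iffMk.context 88 :=
  bangFibModal.conservative.extend _ (by decide +kernel)

abbrev iffMp.stmt : Stmt :=
  .type fun A => .type fun B => .imp (iff A B) fun _ => .imp A fun _ => .concl B
def iffMp := iffMp.stmt.thm 88 (by dsimp only [Stmt.Use])
def iffMp.proof : iffMp.stmt.Proof :=
  fun _ _ s a => s.fst.app a

def iffMp.context : List Tm := extend iffMk.context 93 [iffMp.stmt.decl iffMp.proof]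

theorem iffMp.conservative : Conservative Modality.genericContext iffMp.context 89 :=
  iffMk.conservative.extend _ (by decide +kernel)

abbrev iffMpr.stmt : Stmt :=
  .type fun A => .type fun B => .imp (iff A B) fun _ => .imp B fun _ => .concl A
def iffMpr := iffMpr.stmt.thm 89 (by dsimp only [Stmt.Use])
def iffMpr.proof : iffMpr.stmt.Proof :=
  fun _ _ s b => s.snd.app b

def iffMpr.context : List Tm := extend iffMp.context 94 [iffMpr.stmt.decl iffMpr.proof]

theorem iffMpr.conservative : Conservative Modality.genericContext iffMpr.context 90 :=
  iffMp.conservative.extend _ (by decide +kernel)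

abbrev iffTrans.stmt : Stmt :=
  .type fun A => .type fun B => .type fun C => .imp (iff A B) fun _ => .imp (iff B C) fun _ =>
    .concl (iff A C)
def iffTrans := iffTrans.stmt.thm 90 (by dsimp only [Stmt.Use])
def iffTrans.proof : iffTrans.stmt.Proof :=
  fun _ _ _ s t => iffMk (.lam fun a => iffMp t (iffMp s a)) (.lam fun c => iffMpr s (iffMpr t c))

def iffTrans.context : List Tm := extend iffMpr.context 95 [iffTrans.stmt.decl iffTrans.proof]

theorem iffTrans.conservative : Conservative Modality.genericContext iffTrans.context 91 :=
  iffMpr.conservative.extend _ (by decide +kernel)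

/-! ### Fibers of composites, pullbacks and total spaces -/

/-- The map `(a, p) ↦ (a, p · r)` between fibers. -/
def postFib (A B f y y' r : Ex) : Ex :=
  lam (fib A B f y) fun w => fibMk A B f y' (fibPt A B f y w)
    (concat B (f (fibPt A B f y w)) y y' (fibPath A B f y w) r)

abbrev postFibEquiv.stmt : Stmt :=
  .small fun A => .small fun B => .raw (arr A B) fun f => .all B fun y => .all B fun y' =>
    .imp (eq B y y') fun r => .concl (isEquiv (fib A B f y) (fib A B f y') (postFib A B f y y' r))
def postFibEquiv := postFibEquiv.stmt.thm 91 (by dsimp only [Stmt.Use])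
def postFibEquiv.proof : postFibEquiv.stmt.Proof :=
  fun A B f y y' r =>
    let F := fib A B f y
    let H : Trm (pi F fun w => eq F (idFun F w) (postFib A B f y y (rfl B y) w)) := .lam fun w =>
      (w.fibInd (fun w => eq F w (postFib A B f y y (rfl B y) w)) fun x p =>
        ((transRefl p).inv.ap (B := F) fun p => fibMk A B f y x p).c).c
    r.indL (fun y' r => isEquiv F (fib A B f y') (postFib A B f y y' r))
      (isEquivOfHomotopy H ⟨idIsEquiv F⟩)

def postFibEquiv.context : List Tm :=
  extend iffTrans.context 96 [postFibEquiv.stmt.decl postFibEquiv.proof]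

theorem postFibEquiv.conservative : Conservative Modality.genericContext postFibEquiv.context 92 :=
  iffTrans.conservative.extend _ (by decide +kernel)

/-- The total space over a contractible type is equivalent to any fiber. -/
abbrev sigContrBase.stmt : Stmt :=
  .small fun B => .fam B 0 fun P => .imp (isContr B) fun _ => .raw B fun b =>
    .concl (isEquiv (P b) (sig B P) (lam (P b) fun e => dpair B P b e))
def sigContrBase := sigContrBase.stmt.thm 92 (by dsimp only [Stmt.Use])
def sigContrBase.proof : sigContrBase.stmt.Proof :=
  fun B P h b =>
    let r x y : Trm (eq B x y) := (h.contract ⟨x⟩).inv.trans (h.contract ⟨y⟩)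
    isEquivMk (.lam fun w => (r (fst B P w.val) b).transport P w.snd)
      (.lam fun e => ((invTrans (h.contract ⟨b⟩)).ap (B := P b) fun p =>
        (Trm.transport (A := B) (x := b) (y := b) ⟨p⟩ P e).val).c)
      (.lam fun w => (w.split (fun w => eq (sig B P)
          (dpair B P b ((r (fst B P w) b).transport P (.snd ⟨w⟩))) w) fun a e =>
        (((r a b).indL (fun b p => eq (sig B P) (dpair B P b (Trm.transport (A := B) (x := a) (y := b) ⟨p⟩ P e))
          (dpair B P a e)) .rfl).c)).c)

def sigContrBase.context : List Tm :=
  extend postFibEquiv.context 97 [sigContrBase.stmt.decl sigContrBase.proof]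

theorem sigContrBase.conservative : Conservative Modality.genericContext sigContrBase.context 93 :=
  postFibEquiv.conservative.extend _ (by decide +kernel)

/-- The total space of the fibers of `f` over a fiber of `g`. -/
def sigFibers (A B C f g z : Ex) : Ex := sig (fib B C g z) fun v => fib A B f (fibPt B C g z v)

/-- The inverse is `fibCompMap`. Both are written by elimination, so that on canonical points the
composites reduce to the identity by computation. -/
def compFibMap (A B C f g z : Ex) : Ex :=
  let h := lam A fun x => g (f x)
  let P v := fib A B f (fibPt B C g z v)
  lam (sigFibers A B C f g z) fun w =>
    ((Trm.mk w : Trm (sig (fib B C g z) P)).split (fun _ => fib A C h z) fun v u =>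
      (v.fibInd (fun v => arr (P v) (fib A C h z)) fun y p =>
        (.lam fun u => u.fibInd (fun _ => fib A C h z) fun x r =>
          .fibMk x (((r.ap fun y => g y).trans p).c) : Trm (arr (fib A B f y) (fib A C h z))).c).app u).val

def fibCompMap (A B C f g z : Ex) : Ex :=
  let h := lam A fun x => g (f x)
  lam (fib A C h z) fun w =>
    ((Trm.mk w : Trm (fib A C h z)).fibInd (fun _ => sigFibers A B C f g z) fun x p =>
      ⟨dpair (fib B C g z) (fun v => fib A B f (fibPt B C g z v)) (fibMk B C g z (f x) p)
        (fibMk A B f (f x) x (rfl B (f x)))⟩).val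

abbrev compFibRet.stmt : Stmt :=
  .raw (univ 0) fun A => .raw (univ 0) fun B => .raw (univ 0) fun C => .raw (arr A B) fun f =>
    .raw (arr B C) fun g => .raw C fun z => .concl (pi (fib A C (lam A fun x => g (f x)) z) fun w =>
      eq (fib A C (lam A fun x => g (f x)) z) (compFibMap A B C f g z (fibCompMap A B C f g z w)) w)
def compFibRet := compFibRet.stmt.thm 93 (by dsimp only [Stmt.Use])
def compFibRet.proof : compFibRet.stmt.Proof :=
  fun A B C f g z => .lam fun w => w.fibInd (fun w => eq (fib A C (Ex.lam A fun x => g (f x)) z)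
    (compFibMap A B C f g z (fibCompMap A B C f g z w)) w) fun _ _ => .rfl

def compFibRet.context : List Tm :=
  extend sigContrBase.context 98 [compFibRet.stmt.decl compFibRet.proof]

theorem compFibRet.conservative : Conservative Modality.genericContext compFibRet.context 94 :=
  sigContrBase.conservative.extend _ (by decide +kernel)

abbrev compFibSec.stmt : Stmt :=
  .raw (univ 0) fun A => .raw (univ 0) fun B => .raw (univ 0) fun C => .raw (arr A B) fun f =>
    .raw (arr B C) fun g => .raw C fun z => .concl (pi (sigFibers A B C f g z) fun w =>
      eq (sigFibers A B C f g z) (fibCompMap A B C f g z (compFibMap A B C f g z w)) w)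
def compFibSec := compFibSec.stmt.thm 94 (by dsimp only [Stmt.Use])
def compFibSec.proof : compFibSec.stmt.Proof :=
  fun A B C f g z =>
    let P v := fib A B f (fibPt B C g z v)
    let G := fib B C g z
    let E w := eq (sig G P) (fibCompMap A B C f g z (compFibMap A B C f g z w)) w
    (.lam fun w => w.split E fun v u =>
      (v.fibInd (fun v => pi (P v) fun u => E (dpair G P v u)) fun y p =>
        (.lam fun u => u.fibInd (fun u => E (dpair G P (fibMk B C g z y p) u)) fun x r =>
          (r.indL (fun y r => pi (eq C (g y) z) fun p =>
            E (dpair G P (fibMk B C g z y p) (fibMk A B f y x r))) (.lam fun _ => .rfl)).apps [p] :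
          Trm (pi (fib A B f y) fun u => E (dpair G P (fibMk B C g z y p) u))).c).apps [u] :
      Trm (pi (sig G P) fun w => E w)).c

def compFibSec.context : List Tm :=
  extend compFibRet.context 99 [compFibSec.stmt.decl compFibSec.proof]

theorem compFibSec.conservative : Conservative Modality.genericContext compFibSec.context 95 :=
  compFibRet.conservative.extend _ (by decide +kernel)

abbrev compFibEquiv.stmt : Stmt :=
  .raw (univ 0) fun A => .raw (univ 0) fun B => .raw (univ 0) fun C => .raw (arr A B) fun f =>
    .raw (arr B C) fun g => .raw C fun z => .concl (isEquiv (sigFibers A B C f g z)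
      (fib A C (lam A fun x => g (f x)) z) (compFibMap A B C f g z))
def compFibEquiv := compFibEquiv.stmt.thm 95 (by dsimp only [Stmt.Use])
def compFibEquiv.proof : compFibEquiv.stmt.Proof :=
  fun A B C f g z => isEquivMk ⟨fibCompMap A B C f g z⟩ (compFibSec A B C f g z) (compFibRet A B C f g z)

def compFibEquiv.context : List Tm :=
  extend compFibSec.context 100 [compFibEquiv.stmt.decl compFibEquiv.proof]

theorem compFibEquiv.conservative : Conservative Modality.genericContext compFibEquiv.context 96 :=
  compFibSec.conservative.extend _ (by decide +kernel)

abbrev fibCompEquiv.stmt : Stmt :=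
  .raw (univ 0) fun A => .raw (univ 0) fun B => .raw (univ 0) fun C => .raw (arr A B) fun f =>
    .raw (arr B C) fun g => .raw C fun z => .concl (isEquiv (fib A C (lam A fun x => g (f x)) z)
      (sigFibers A B C f g z) (fibCompMap A B C f g z))
def fibCompEquiv := fibCompEquiv.stmt.thm 96 (by dsimp only [Stmt.Use])
def fibCompEquiv.proof : fibCompEquiv.stmt.Proof :=
  fun A B C f g z => isEquivMk ⟨compFibMap A B C f g z⟩ (compFibRet A B C f g z) (compFibSec A B C f g z)

def fibCompEquiv.context : List Tm :=
  extend compFibEquiv.context 101 [fibCompEquiv.stmt.decl fibCompEquiv.proof]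

theorem fibCompEquiv.conservative : Conservative Modality.genericContext fibCompEquiv.context 97 :=
  compFibEquiv.conservative.extend _ (by decide +kernel)

abbrev sigEquiv.stmt : Stmt :=
  .small fun Y => .fam Y 0 fun P => .fam Y 0 fun Q => .all (pi Y fun y => arr (P y) (Q y)) fun k =>
    .imp (pi Y fun y => isEquiv (P y) (Q y) (k y)) fun _ =>
    .concl (isEquiv (sig Y P) (sig Y Q) (lam (sig Y P) fun z => dpair Y Q (fst Y P z) (k (fst Y P z) (snd Y P z))))
def sigEquiv := sigEquiv.stmt.thm 97 (by dsimp only [Stmt.Use])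
def sigEquiv.proof : sigEquiv.stmt.Proof :=
  fun Y P Q k e =>
    let S := sig Y P
    let H : Trm (pi S fun z => eq S (idFun S z) ((Ex.lam S fun z => dpair Y P (fst Y P z) (snd Y P z)) z)) :=
      .lam fun z => (z.split (fun z => eq S z (dpair Y P (fst Y P z) (snd Y P z))) fun _ _ => .rfl).c
    (equivFamInd (P := P) (Ex.lam (arr Y (univ 0)) fun Q => Ex.lam (pi Y fun y => arr (P y) (Q y)) fun k =>
      isEquiv S (sig Y fun y => Q y) (Ex.lam S fun z =>
        dpair Y (fun y => Q y) (fst Y P z) (k (fst Y P z) (snd Y P z))))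
      (isEquivOfHomotopy H ⟨idIsEquiv S⟩ |>.c) e).c

def sigEquiv.context : List Tm :=
  extend fibCompEquiv.context 102 [sigEquiv.stmt.decl sigEquiv.proof]

theorem sigEquiv.conservative : Conservative Modality.genericContext sigEquiv.context 98 :=
  fibCompEquiv.conservative.extend _ (by decide +kernel)

def pullback (B X Y y f : Ex) : Ex := sig B fun b => fib X Y f (y b)

/-- The map `fib_g(b) → fib_f(y b)` for a square with `x`, `y` and `H`. -/
def pullFibMap (A B X Y g x y f H b : Ex) : Ex :=
  lam (fib A B g b) fun w => ((Trm.mk w : Trm (fib A B g b)).path.indL (fun b _ => fib X Y f (y b))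
    (⟨fibMk X Y f (y (g (fibPt A B g b w))) (x (fibPt A B g b w)) (H (fibPt A B g b w))⟩ :
      Trm (fib X Y f (y (g (fibPt A B g b w)))))).val

/-- Induction on the gap equivalence replaces `A` by the pullback itself and `g` by the projection,
whose fiber over `b` is `fib_f(y b)`. -/
abbrev pullFibEquiv.stmt : Stmt :=
  .raw (univ 0) fun A => .raw (univ 0) fun B => .raw (univ 0) fun X => .raw (univ 0) fun Y =>
    .raw (arr A B) fun g => .raw (arr A X) fun x => .raw (arr B Y) fun y => .raw (arr X Y) fun f =>
    .raw (pi A fun a => eq Y (f (x a)) (y (g a))) fun H =>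
    .imp (Square.isPullback ⟨A, B, X, Y, g, x, y, f, H⟩) fun _ => .raw B fun b =>
    .concl (isEquiv (fib A B g b) (fib X Y f (y b)) (pullFibMap A B X Y g x y f H b))
def pullFibEquiv := pullFibEquiv.stmt.thm 98 (by dsimp only [Stmt.Use])
def pullFibEquiv.proof : pullFibEquiv.stmt.Proof :=
  fun A B X Y g x y f H e b =>
    let P b := fib X Y f (y b)
    let S := sig B P
    let π := Ex.lam S fun z => fst B P z
    let M A k := pullFibMap A B X Y (Ex.lam A fun a => fst B P (k a))
      (Ex.lam A fun a => fibPt X Y f (y (fst B P (k a))) (snd B P (k a))) y f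
      (Ex.lam A fun a => fibPath X Y f (y (fst B P (k a))) (snd B P (k a))) b
    let C A k := isEquiv (fib A B (Ex.lam A fun a => fst B P (k a)) b) (P b) (M A k)
    let h w := fibMk S B π b (dpair B P b w) (rfl B b)
    let η : Trm (pi (P b) fun w => eq (P b) (idFun (P b) w)
        ((Ex.lam (P b) fun w => M S (idFun S) ((Ex.lam (P b) h) w)) w)) :=
      .lam fun w => (w.fibInd (fun w => eq (P b) w (M S (idFun S) (h w))) fun _ _ => .rfl).c
    let d : Trm (C S (idFun S)) := (isEquivCancelRight (fibFst (x := B) (P := P) b)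
      (isEquivOfHomotopy η ⟨idIsEquiv (P b)⟩) : Trm (isEquiv (fib S B π b) (P b) (M S (idFun S)))).c
    (equivInd' (Ex.lam (univ 0) fun A => Ex.lam (arr A S) fun k => C A k) d.c
      (e.c : Trm (isEquiv A S (Square.gap ⟨A, B, X, Y, g, x, y, f, H⟩)))).c

def pullFibEquiv.context : List Tm :=
  extend sigEquiv.context 103 [pullFibEquiv.stmt.decl pullFibEquiv.proof]

theorem pullFibEquiv.conservative : Conservative Modality.genericContext pullFibEquiv.context 99 :=
  sigEquiv.conservative.extend _ (by decide +kernel)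

/-- The map `(x, p) ↦ ((f x, d (x, refl)), p)` from `fib_f(y)` to the fiber of `Σ Q → Y`. -/
def totFib (X Y f : Ex) (Q : Ex → Ex) (d y : Ex) : Ex :=
  lam (fib X Y f y) fun w => fibMk (sig Y Q) Y (lam (sig Y Q) fun z => fst Y Q z) y
    (totMap X Y f Q d (fibPt X Y f y w)) (fibPath X Y f y w)

abbrev totFibEq.stmt : Stmt :=
  .raw (univ 0) fun X => .raw (univ 0) fun Y => .raw (arr X Y) fun f => .fam Y 0 fun Q =>
    .raw (pi Y fun y => arr (fib X Y f y) (Q y)) fun d => .raw Y fun y =>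
    .concl (pi (fib X Y f y) fun w => eq (fib (sig Y Q) Y (lam (sig Y Q) fun z => fst Y Q z) y)
      (fibMk (sig Y Q) Y (lam (sig Y Q) fun z => fst Y Q z) y (dpair Y Q y (d y w)) (rfl Y y))
      (totFib X Y f Q d y w))
def totFibEq := totFibEq.stmt.thm 99 (by dsimp only [Stmt.Use])
def totFibEq.proof : totFibEq.stmt.Proof :=
  fun X Y f Q d y => .lam fun w =>
    let π := Ex.lam (sig Y Q) fun z => fst Y Q z
    let E y w := eq (fib (sig Y Q) Y π y) (fibMk (sig Y Q) Y π y (dpair Y Q y (d y w)) (rfl Y y))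
      (totFib X Y f Q d y w)
    w.fibInd (fun w => E y w) fun x p => p.indL (fun y p => E y (fibMk X Y f y x p)) .rfl

def totFibEq.context : List Tm :=
  extend pullFibEquiv.context 104 [totFibEq.stmt.decl totFibEq.proof]

theorem totFibEq.conservative : Conservative Modality.genericContext totFibEq.context 100 :=
  pullFibEquiv.conservative.extend _ (by decide +kernel)

abbrev locTotFib.stmt : Stmt :=
  .raw (univ 0) fun X => .raw (univ 0) fun Y => .raw (arr X Y) fun f => .fam Y 0 fun Q =>
    .raw (pi Y fun y => arr (fib X Y f y) (Q y)) fun d => .raw Y fun y =>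
    .imp (loc (fib X Y f y) (Q y) (d y)) fun _ =>
    .concl (loc (fib X Y f y) (fib (sig Y Q) Y (lam (sig Y Q) fun z => fst Y Q z) y) (totFib X Y f Q d y))
def locTotFib := locTotFib.stmt.thm 100 (by dsimp only [Stmt.Use])
def locTotFib.proof : locTotFib.stmt.Proof :=
  fun X Y f Q d y l => locOfHomotopy ((totFibEq X Y f (P := Q) d y).c) (locPost (fibFst (x := Y) (P := Q) y) l)

def locTotFib.context : List Tm := extend totFibEq.context 105 [locTotFib.stmt.decl locTotFib.proof]

theorem locTotFib.conservative : Conservative Modality.genericContext locTotFib.context 101 :=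
  totFibEq.conservative.extend _ (by decide +kernel)

abbrev locOfTotFib.stmt : Stmt :=
  .raw (univ 0) fun X => .raw (univ 0) fun Y => .raw (arr X Y) fun f => .fam Y 0 fun Q =>
    .raw (pi Y fun y => arr (fib X Y f y) (Q y)) fun d => .raw Y fun y =>
    .imp (loc (fib X Y f y) (fib (sig Y Q) Y (lam (sig Y Q) fun z => fst Y Q z) y) (totFib X Y f Q d y)) fun _ =>
    .concl (loc (fib X Y f y) (Q y) (d y))
def locOfTotFib := locOfTotFib.stmt.thm 101 (by dsimp only [Stmt.Use])
def locOfTotFib.proof : locOfTotFib.stmt.Proof :=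
  fun X Y f Q d y l =>
    let H : Trm (pi (fib X Y f y) fun w => eq (fib (sig Y Q) Y (Ex.lam (sig Y Q) fun z => fst Y Q z) y)
      (totFib X Y f Q d y w)
      ((Ex.lam (fib X Y f y) fun w => (Ex.lam (Q y) fun e => fibMk (sig Y Q) Y (Ex.lam (sig Y Q) fun z => fst Y Q z) y
        (dpair Y Q y e) (rfl Y y)) (d y w)) w)) := .lam fun w => ((totFibEq X Y f (P := Q) d y).app w).inv.c
    locPostCancel (fibFst (x := Y) (P := Q) y) (locOfHomotopy H l)

def locOfTotFib.context : List Tm :=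
  extend locTotFib.context 106 [locOfTotFib.stmt.decl locOfTotFib.proof]

theorem locOfTotFib.conservative : Conservative Modality.genericContext locOfTotFib.context 102 :=
  locTotFib.conservative.extend _ (by decide +kernel)

/-- A connected map followed by a localization is a localization. -/
abbrev locConnComp.stmt : Stmt :=
  .small fun X => .small fun Z => .small fun T => .all (arr X Z) fun c => .all (arr Z T) fun m =>
    .imp (conn X Z c) fun _ => .imp (loc Z T m) fun _ => .concl (loc X T (lam X fun x => m (c x)))
def locConnComp := locConnComp.stmt.thm 102 (by dsimp only [Stmt.Use])
def locConnComp.proof : locConnComp.stmt.Proof :=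
  fun X Z T c m h l =>
    Trm.bind (locModal l) fun k =>
    Trm.bind (connRec h (bangModal X) (unitMap X)) fun R =>
    Trm.bind (locRec l (bangModal X) R.fst) fun J =>
    locIntro k J.fst (.lam fun x => (((J.snd.app ⟨c x⟩).c : Trm (eq (bang X) (J.fst.val (m (c x)))
        (R.fst.val (c x)))).trans
        ((R.snd.app x).c : Trm (eq (bang X) (R.fst.val (c x)) (unitMap X x)))).c)
      (.lam fun p => .lam fun H => locElim (P := fun t => eq T (p.val t) t) l
        (.lam fun t => modalEq k (p.val t) t)
        (connElim (P := fun z => eq T (p.val (m z)) (m z)) h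
          (.lam fun z => modalEq k (p.val (m z)) (m z)) H.c))

def locConnComp.context : List Tm :=
  extend locOfTotFib.context 107 [locConnComp.stmt.decl locConnComp.proof]

theorem locConnComp.conservative : Conservative Modality.genericContext locConnComp.context 103 :=
  locOfTotFib.conservative.extend _ (by decide +kernel)

/-! ### Equality of the two factorizations -/

/-- If `γ` is an equivalence, induction on the family `γ` identifies the factorizations. Conversely,
equality transports along itself the property that the induced map from `fib_f(y)` to the fiber of
the right factor is a localization. -/
abbrev fibIffFactorizationsAgree.stmt : Stmt :=
  .raw (univ 0) fun X => .raw (univ 0) fun Y => .raw (arr X Y) fun f =>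
    .concl (iff (isFib X Y f) (Modality.generic.factorizationsAgree X Y f))
def fibIffFactorizationsAgree := fibIffFactorizationsAgree.stmt.thm 103 (by dsimp only [Stmt.Use])
def fibIffFactorizationsAgree.proof : fibIffFactorizationsAgree.stmt.Proof :=
  fun X Y f => iffMk
    (.lam fun h =>
    let F y := fib X Y f y
    let u x := unit (F (f x)) (fibMk X Y f (f x) x (rfl Y (f x)))
    let A := Modality.generic.factorization X Y f
    let a := Modality.generic.connectedModalFactorization X Y f
    let b (Q d : Ex) := Modality.generic.factorizationMk X Y f (sig Y fun y => Q y)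
      (Ex.lam X fun x => dpair Y (fun y => Q y) (f x) (d x))
      (Ex.lam (sig Y fun y => Q y) fun z => fst Y (fun y => Q y) z) (Ex.lam X fun x => rfl Y (f x))
    -- The motive allows any `d` that agrees with `k` on the points `u x`. For `k = γ` the values of
    -- `δ` are admissible by `gammaBeta`; for `k` the identity, induction on the homotopy leaves
    -- reflexivity.
    let D (Q k : Ex) := pi (pi X fun x => Q (f x)) fun d =>
      arr (pi X fun x => eq (Q (f x)) (k (f x) (u x)) (d x)) (eq A a (b Q d))
    let c : Trm (pi (pi X fun x => bang (F (f x))) fun d =>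
        arr (pi X fun x => eq (bang (F (f x))) (u x) (d x)) (eq A a (b (Ex.lam Y fun y => bang (F y)) d))) :=
      .lam fun d => .lam fun H =>
        (homotopyInd (P := fun x => bang (F (f x)))
          (Ex.lam (pi X fun x => bang (F (f x))) fun d =>
            Ex.lam (pi X fun x => eq (bang (F (f x))) (u x) (d x)) fun _ => eq A a (b (Ex.lam Y fun y => bang (F y)) d))
          (.c (.rfl : Trm (eq A a a)))
          (H.c : Trm (pi X fun x => eq (bang (F (f x))) ((Ex.lam X fun x => u x) x) (d.val x)))).c
    ((equivFamInd (P := fun y => bang (F y))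
      (Ex.lam (arr Y (univ 0)) fun Q => Ex.lam (pi Y fun y => arr (bang (F y)) (Q y)) fun k => D Q k)
      c.c (h.c : Trm (pi Y fun y =>
        isEquiv (bang (F y)) (bangFib X Y f y) ((Ex.lam Y fun y => gamma X Y f y) y)))).apps
      [Ex.lam X fun x => delta X Y f (f x) (fibMk X Y f (f x) x (rfl Y (f x))),
       Ex.lam X fun x => gammaBeta X Y f (f x) (fibMk X Y f (f x) x (rfl Y (f x)))]))
    (.lam fun p => fibOfLocDelta f (.lam fun y =>
    let F y := fib X Y f y
    let E3 Z l := fun r => pi X fun x => eq Y (r (l x)) (f x)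
    let E2 Z := fun l => sig (arr Z Y) (E3 Z l)
    let E1 := fun Z => sig (arr X Z) (E2 Z)
    -- The property to transport. It holds for the connected/modal factorization because there the
    -- fiber over `y` is `!fib_f(y)`.
    let W φ := ((Trm.mk φ : Trm (sig (univ 0) E1)).split (fun _ => univ 0) fun Z w =>
      w.split (fun _ => univ 0) fun l w => w.split (fun _ => univ 0) fun r h =>
        ⟨loc (F y) (fib Z Y r y) (Ex.lam (F y) fun w =>
          let x := fibPt X Y f y w
          fibMk Z Y r y (l.val x) (concat Y (r.val (l.val x)) (f x) y (h.val x) (fibPath X Y f y w)))⟩).val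
    locOfTotFib X Y f (P := fun y => bangFib X Y f y) (Ex.lam Y fun y => delta X Y f y) y
      ((Trm.transport (A := sig (univ 0) E1) (x := Modality.generic.connectedModalFactorization X Y f)
        (y := Modality.generic.equivalenceEtaleFactorization X Y f) p.c W
        (locTotFib X Y f (P := fun y => bang (F y)) (Ex.lam Y fun y => unitMap (F y)) y
          (unitLoc (F y)).c).c).c) |>.c :
    Trm (pi Y fun y => loc (fib X Y f y) (bangFib X Y f y) (delta X Y f y))).c)

def fibIffFactorizationsAgree.context : List Tm :=
  extend locConnComp.context 108 [fibIffFactorizationsAgree.stmt.decl fibIffFactorizationsAgree.proof]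

theorem fibIffFactorizationsAgree.conservative : Conservative Modality.genericContext fibIffFactorizationsAgree.context 104 :=
  locConnComp.conservative.extend _ (by decide +kernel)

/-! ### The modal factor and the equivalence factor -/

def modalMid (X Y f : Ex) : Ex := sig Y fun y => bang (fib X Y f y)
def modalFactor (X Y f : Ex) : Ex := lam (modalMid X Y f) fun z => fst Y (fun y => bang (fib X Y f y)) z
def connectedFactor (X Y f : Ex) : Ex :=
  totMap X Y f (fun y => bang (fib X Y f y)) (lam Y fun y => unitMap (fib X Y f y))

abbrev connectedFactorConn.stmt : Stmt :=
  .raw (univ 0) fun X => .raw (univ 0) fun Y => .raw (arr X Y) fun f =>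
    .concl (conn X (modalMid X Y f) (connectedFactor X Y f))
def connectedFactorConn := connectedFactorConn.stmt.thm 104 (by dsimp only [Stmt.Use])
def connectedFactorConn.proof : connectedFactorConn.stmt.Proof :=
  fun X Y f => connTot X Y f (P := fun y => bang (fib X Y f y)) (Ex.lam Y fun y => unitMap (fib X Y f y))
    (.lam fun y => (unitConn (fib X Y f y)).c)

def connectedFactorConn.context : List Tm :=
  extend fibIffFactorizationsAgree.context 109 [connectedFactorConn.stmt.decl connectedFactorConn.proof]

theorem connectedFactorConn.conservative : Conservative Modality.genericContext connectedFactorConn.context 105 :=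
  fibIffFactorizationsAgree.conservative.extend _ (by decide +kernel)

/-- Hence `!` of the domain of the modal factor serves as a localization of `X`. -/
abbrev connectedFactorLoc.stmt : Stmt :=
  .raw (univ 0) fun X => .raw (univ 0) fun Y => .raw (arr X Y) fun f =>
    .concl (loc X (bang (modalMid X Y f))
      (lam X fun x => unitMap (modalMid X Y f) (connectedFactor X Y f x)))
def connectedFactorLoc := connectedFactorLoc.stmt.thm 105 (by dsimp only [Stmt.Use])
def connectedFactorLoc.proof : connectedFactorLoc.stmt.Proof :=
  fun X Y f => locConnComp (connectedFactorConn X Y f) (unitLoc (modalMid X Y f))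

def connectedFactorLoc.context : List Tm :=
  extend connectedFactorConn.context 110 [connectedFactorLoc.stmt.decl connectedFactorLoc.proof]

theorem connectedFactorLoc.conservative : Conservative Modality.genericContext connectedFactorLoc.context 106 :=
  connectedFactorConn.conservative.extend _ (by decide +kernel)

/-- The square of `f` and the image of its modal factor. -/
def modalNat (X Y f : Ex) : Ex :=
  lam X fun x => bnat (modalMid X Y f) Y (modalFactor X Y f) (connectedFactor X Y f x)
def modalDelta (X Y f y : Ex) : Ex :=
  deltaMap X Y f (bang (modalMid X Y f))
    (lam X fun x => unitMap (modalMid X Y f) (connectedFactor X Y f x))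
    (bmap (modalMid X Y f) Y (modalFactor X Y f)) (modalNat X Y f) y
def modalFib (X Y f y : Ex) : Ex :=
  totFib X Y f (fun y => bang (fib X Y f y)) (lam Y fun y => unitMap (fib X Y f y)) y

abbrev modalFibLoc.stmt : Stmt :=
  .raw (univ 0) fun X => .raw (univ 0) fun Y => .raw (arr X Y) fun f => .raw Y fun y =>
    .concl (loc (fib X Y f y) (fib (modalMid X Y f) Y (modalFactor X Y f) y) (modalFib X Y f y))
def modalFibLoc := modalFibLoc.stmt.thm 106 (by dsimp only [Stmt.Use])
def modalFibLoc.proof : modalFibLoc.stmt.Proof :=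
  fun X Y f y => locTotFib X Y f (P := fun y => bang (fib X Y f y))
    (Ex.lam Y fun y => unitMap (fib X Y f y)) y (unitLoc (fib X Y f y)).c

def modalFibLoc.context : List Tm :=
  extend connectedFactorLoc.context 111 [modalFibLoc.stmt.decl modalFibLoc.proof]

theorem modalFibLoc.conservative : Conservative Modality.genericContext modalFibLoc.context 107 :=
  connectedFactorLoc.conservative.extend _ (by decide +kernel)

/-- Instance of `deltaInvariance`: the image of the modal factor under `!` plays the role of `!f`.
-/
abbrev modalDeltaLoc.stmt : Stmt :=
  .raw (univ 0) fun X => .raw (univ 0) fun Y => .raw (arr X Y) fun f => .raw Y fun y =>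
    .concl (iff (loc (fib X Y f y) (bangFib (modalMid X Y f) Y (modalFactor X Y f) y) (modalDelta X Y f y))
      (loc (fib X Y f y) (bangFib X Y f y) (delta X Y f y)))
def modalDeltaLoc := modalDeltaLoc.stmt.thm 107 (by dsimp only [Stmt.Use])
def modalDeltaLoc.proof : modalDeltaLoc.stmt.Proof :=
  fun X Y f y => (deltaInvariance Y f (connectedFactorLoc X Y f)
    (bmap (modalMid X Y f) Y (modalFactor X Y f)) (modalNat X Y f) (bmap X Y f) (bnat X Y f) y
    (Ex.lam (univ 0) fun S => Ex.lam (arr (fib X Y f y) S) fun d => loc (fib X Y f y) S d)).c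

def modalDeltaLoc.context : List Tm :=
  extend modalFibLoc.context 112 [modalDeltaLoc.stmt.decl modalDeltaLoc.proof]

theorem modalDeltaLoc.conservative : Conservative Modality.genericContext modalDeltaLoc.context 108 :=
  modalFibLoc.conservative.extend _ (by decide +kernel)

/-- The `δ` of the modal factor, precomposed with the localization of `modalFibLoc`, is
`modalDelta`. It is thus an equivalence exactly if `modalDelta` is a localization, that is, if the
`δ` of `f` is one. -/
abbrev fibIffModalFactorEtale.stmt : Stmt :=
  .raw (univ 0) fun X => .raw (univ 0) fun Y => .raw (arr X Y) fun f =>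
    .concl (iff (isFib X Y f) (Modality.generic.modalFactorIsEtale X Y f))
def fibIffModalFactorEtale := fibIffModalFactorEtale.stmt.thm 108 (by dsimp only [Stmt.Use])
def fibIffModalFactorEtale.proof : fibIffModalFactorEtale.stmt.Proof :=
  fun X Y f => iffMk
    (.lam fun h =>
    let h := locDeltaOfFib f h
    let F y := fib X Y f y
    let Z := modalMid X Y f
    let r := modalFactor X Y f
    let l y : Trm (loc (F y) (bangFib Z Y r y) (Ex.lam (F y) fun w => delta Z Y r y (modalFib X Y f y w))) :=
      (iffMpr (modalDeltaLoc X Y f y) ⟨h.val y⟩).c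
    (.lam fun y => locCancel (modalFibLoc X Y f y) (l y) :
      Trm (pi Y fun y => isEquiv (fib Z Y r y) (bangFib Z Y r y) (delta Z Y r y))).c)
    (.lam fun h =>
    let Z := modalMid X Y f
    let r := modalFactor X Y f
    let e y : Trm (isEquiv (fib Z Y r y) (bangFib Z Y r y) (delta Z Y r y)) := h.apps [y]
    fibOfLocDelta f (.lam fun y => iffMp (modalDeltaLoc X Y f y) (locPost (e y) (modalFibLoc X Y f y)).c :
      Trm (pi Y fun y => loc (fib X Y f y) (bangFib X Y f y) (delta X Y f y))).c)

def fibIffModalFactorEtale.context : List Tm :=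
  extend modalDeltaLoc.context 113 [fibIffModalFactorEtale.stmt.decl fibIffModalFactorEtale.proof]

theorem fibIffModalFactorEtale.conservative : Conservative Modality.genericContext fibIffModalFactorEtale.context 109 :=
  modalDeltaLoc.conservative.extend _ (by decide +kernel)

def etaleMid (X Y f : Ex) : Ex := sig Y fun y => bangFib X Y f y

/-- The equivalence factor is connected exactly if all `δ` are, by `fibTot`; and as `fib_{!f}(y^!)`
is modal, `δ` is connected exactly if it is a localization. -/
abbrev fibIffEquivalenceFactorConn.stmt : Stmt :=
  .raw (univ 0) fun X => .raw (univ 0) fun Y => .raw (arr X Y) fun f =>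
    .concl (iff (isFib X Y f) (Modality.generic.equivalenceFactorIsConnected X Y f))
def fibIffEquivalenceFactorConn := fibIffEquivalenceFactorConn.stmt.thm 109 (by dsimp only [Stmt.Use])
def fibIffEquivalenceFactorConn.proof : fibIffEquivalenceFactorConn.stmt.Proof :=
  fun X Y f => iffMk
    (.lam fun h =>
    let h := locDeltaOfFib f h
    (connTot X Y f (P := fun y => bangFib X Y f y) (Ex.lam Y fun y => delta X Y f y)
    (.lam fun y =>
      let l : Trm (loc (fib X Y f y) (bangFib X Y f y) (delta X Y f y)) := ⟨h.val y⟩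
      (connOfLoc l).c)).c)
    (.lam fun h => fibOfLocDelta f (.lam fun y => locOfConn (bangFibModal X Y f y)
      ((connOfTot X Y f (P := fun y => bangFib X Y f y) (Ex.lam Y fun y => delta X Y f y) h.c).app y).c :
    Trm (pi Y fun y => loc (fib X Y f y) (bangFib X Y f y) (delta X Y f y))).c)

def fibIffEquivalenceFactorConn.context : List Tm :=
  extend fibIffModalFactorEtale.context 114 [fibIffEquivalenceFactorConn.stmt.decl fibIffEquivalenceFactorConn.proof]

theorem fibIffEquivalenceFactorConn.conservative : Conservative Modality.genericContext fibIffEquivalenceFactorConn.context 110 :=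
  fibIffModalFactorEtale.conservative.extend _ (by decide +kernel)

/-! ### The connecting map `tot(γ)` -/

/-- The argument of `unitConn` for fibers with reversed paths, in which form they occur in Σ-types
over `!X`. -/
abbrev unitConn'.stmt : Stmt :=
  .raw (univ 0) fun A => .concl (pi (bang A) fun v => isContr (bang (sig A fun a => eq (bang A) v (unit A a))))
def unitConn' := unitConn'.stmt.thm 110 (by dsimp only [Stmt.Use])
def unitConn'.proof : unitConn'.stmt.Proof :=
  fun A =>
    let Q v a := eq (bang A) v (unit A a)
    let F v := sig A (Q v)
    modalExt (x := A) (P := fun v => bang (F v)) (.lam fun v => bangModal (F v))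
      (.lam fun a => ⟨unit (F (unit A a)) (dpair A (Q (unit A a)) a (rfl (bang A) (unit A a)))⟩)
      _ (.lam fun h => .lam fun β => .lam fun v => .contr ⟨h.val v⟩ fun u =>
        (modalElim (x := F v) (P := fun u => eq (bang (F v)) (h.val v) u)
          (.lam fun u => modalEq (bangModal (F v)) (h.val v) u)
          (.lam fun w => (w.split (fun w => eq (bang (F v)) (h.val v) (unit (F v) w)) fun x p =>
            p.indR (fun v p => eq (bang (F v)) (h.val v) (unit (F v) (dpair A (Q v) x p)))
              (β x).c))).app u)

def unitConn'.context : List Tm :=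
  extend fibIffEquivalenceFactorConn.context 115 [unitConn'.stmt.decl unitConn'.proof]

theorem unitConn'.conservative : Conservative Modality.genericContext unitConn'.context 111 :=
  fibIffEquivalenceFactorConn.conservative.extend _ (by decide +kernel)

/-- The first factor of the equivalence/étale factorization is an equivalence after `!`. -/
abbrev equivalenceFactorLoc.stmt : Stmt :=
  .raw (univ 0) fun X => .raw (univ 0) fun Y => .raw (arr X Y) fun f => .raw (arr (bang X) (bang Y)) fun n =>
    .raw (pi X fun x => eq (bang Y) (n (unit X x)) (unit Y (f x))) fun nn =>
    .concl (loc X (bang (sig Y fun y => fib (bang X) (bang Y) n (unit Y y)))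
      (lam X fun x => unit (sig Y fun y => fib (bang X) (bang Y) n (unit Y y))
        (dpair Y (fun y => fib (bang X) (bang Y) n (unit Y y)) (f x)
          (fibMk (bang X) (bang Y) n (unit Y (f x)) (unit X x) (nn x)))))
def equivalenceFactorLoc := equivalenceFactorLoc.stmt.thm 111 (by dsimp only [Stmt.Use])
def equivalenceFactorLoc.proof : equivalenceFactorLoc.stmt.Proof :=
  fun X Y f n nn =>
    let Q y := fib (bang X) (bang Y) n (unit Y y)
    let W := sig Y Q
    let e x := dpair Y Q (f x) (fibMk (bang X) (bang Y) n (unit Y (f x)) (unit X x) (nn x))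
    let pr y u s := unit W (dpair Y Q y (fibMk (bang X) (bang Y) n (unit Y y) u s))
    Trm.bind (locRec (unitLoc W) (bangModal X) (Ex.lam W fun w =>
      fibPt (bang X) (bang Y) n (unit Y (fst Y Q w)) (snd Y Q w))) fun J =>
    Trm.bind (locRec (unitLoc X) (bangModal W) (Ex.lam X fun x => unit W (e x))) fun I =>
    let i u := I.fst.val u
    let β x : Trm (eq (bang W) (i (unit X x)) (unit W (e x))) := (I.snd.app ⟨x⟩).c
    let km u v : Trm (isModal (eq (bang W) u v)) := modalEq (bangModal W) u v
    -- `K` shows that `(y, (u, s))^!` depends on `u` alone. At `u = x^!`, the pairs `(y, s)` form a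
    -- connected type, on which maps to modal types are constant; it contains `(f x, nn x)`.
    Trm.bind (modalElim (x := X) (P := fun u => pi Y fun y => pi (eq (bang Y) (n u) (unit Y y)) fun s =>
        eq (bang W) (i u) (pr y u s))
      (.lam fun u => modalPi (.lam fun y => modalPi (.lam fun s => km (i u) (pr y u s))))
      (.lam fun x =>
        let R y := eq (bang Y) (n (unit X x)) (unit Y y)
        .lam fun y => .lam fun s => (β x).trans
          (connConst ((unitConn' Y).app ⟨n (unit X x)⟩) (bangModal W)
            (Ex.lam (sig Y R) fun w => pr (fst Y R w) (unit X x) (snd Y R w))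
            (dpair Y R (f x) (nn x))
            (dpair Y R y s)).c)) fun K =>
    locIntro (bangModal W) J.fst (.lam fun x => (J.snd.app ⟨e x⟩).c)
      (.lam fun p => .lam fun H =>
        -- An endomap that fixes the image of `X` fixes all `i u`, and by `K` every unit of `W` is
        -- of this form.
        let M : Trm (pi (bang X) fun u => eq (bang W) (p.val (i u)) (i u)) :=
          modalElim (P := fun u => eq (bang W) (p.val (i u)) (i u)) (.lam fun u => km (p.val (i u)) (i u))
            (.lam fun x => (((β x).ap fun t => p.val t).trans (H.app x).c).trans (β x).inv)
        modalElim (x := W) (P := fun t => eq (bang W) (p.val t) t) (.lam fun t => km (p.val t) t)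
          (.lam fun w => w.split (fun w => eq (bang W) (p.val (unit W w)) (unit W w)) fun y v =>
            v.fibInd (fun v => eq (bang W) (p.val (unit W (dpair Y Q y v))) (unit W (dpair Y Q y v))) fun u s =>
              let k : Trm (eq (bang W) (i u) (pr y u s)) := K.apps [u, y, s]
              ((k.inv.ap fun t => p.val t).trans (M.app u)).trans k))

def equivalenceFactorLoc.context : List Tm :=
  extend unitConn'.context 116 [equivalenceFactorLoc.stmt.decl equivalenceFactorLoc.proof]

theorem equivalenceFactorLoc.conservative : Conservative Modality.genericContext equivalenceFactorLoc.context 112 :=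
  unitConn'.conservative.extend _ (by decide +kernel)

/-- Equivalences are fibrations. -/
abbrev fibOfEquiv.stmt : Stmt :=
  .raw (univ 0) fun X => .raw (univ 0) fun Y => .raw (arr X Y) fun f => .imp (isEquiv X Y f) fun _ =>
    .concl (isFib X Y f)
def fibOfEquiv := fibOfEquiv.stmt.thm 112 (by dsimp only [Stmt.Use])
def fibOfEquiv.proof : fibOfEquiv.stmt.Proof :=
  fun X Y f e =>
    let i := idFun X
    -- After induction on the equivalence, `f` is the identity. Since `!` of it is homotopic to the
    -- identity, `δ` is a map between contractible types.
    let H : Trm (pi (bang X) fun u => eq (bang X) (idFun (bang X) u) (bmap X X i u)) :=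
      modalElim (P := fun u => eq (bang X) u (bmap X X i u))
        (.lam fun u => modalEq (bangModal X) u (bmap X X i u))
        (.lam fun x => (⟨bnat X X i x⟩ : Trm (eq (bang X) (bmap X X i (unit X x)) (unit X x))).inv) |>.c
    let h : Trm (locDelta X X i) := (.lam fun y => locOfContr ⟨idIsEquiv X y⟩
        ((isEquivOfHomotopy H ⟨idIsEquiv (bang X)⟩).fiber ⟨unit X y⟩) :
      Trm (pi X fun y => loc (fib X X i y) (bangFib X X i y) (delta X X i y))).c
    (equivInd (Ex.lam (univ 0) fun Y => Ex.lam (arr X Y) fun f => isFib X Y f)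
      (fibOfLocDelta i h).c e).c

def fibOfEquiv.context : List Tm :=
  extend equivalenceFactorLoc.context 117 [fibOfEquiv.stmt.decl fibOfEquiv.proof]

theorem fibOfEquiv.conservative : Conservative Modality.genericContext fibOfEquiv.context 113 :=
  equivalenceFactorLoc.conservative.extend _ (by decide +kernel)

abbrev contrOfRetract.stmt : Stmt :=
  .small fun C => .small fun D => .imp (isModal D) fun _ => .imp (isContr (bang C)) fun _ =>
    .imp (arr C D) fun r => .imp (arr D C) fun s => .imp (pi D fun d => eq D (r (s d)) d) fun _ =>
    .concl (isContr D)
def contrOfRetract := contrOfRetract.stmt.thm 113 (by dsimp only [Stmt.Use])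
def contrOfRetract.proof : contrOfRetract.stmt.Proof :=
  fun C D m h r s e => modalExt (x := C) (P := fun _ => D) (.lam fun _ => m) r _ (.lam fun R => .lam fun β =>
    retractContr h R (.lam fun d => ⟨unit C (s d)⟩) (.lam fun d => ((β.app (s d)).trans (e d)).c))

def contrOfRetract.context : List Tm :=
  extend fibOfEquiv.context 118 [contrOfRetract.stmt.decl contrOfRetract.proof]

theorem contrOfRetract.conservative : Conservative Modality.genericContext contrOfRetract.context 114 :=
  fibOfEquiv.conservative.extend _ (by decide +kernel)

def totalMap (Y : Ex) (P Q : Ex → Ex) (k : Ex) : Ex :=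
  lam (sig Y P) fun z => dpair Y Q (fst Y P z) (k (fst Y P z) (snd Y P z))

/-- The fiber of `k y` over `e` is a retract of the fiber of the total map over `(y, e)`; a modal
retract of a connected type is contractible. -/
abbrev contrFibOfTotal.stmt : Stmt :=
  .raw (univ 0) fun Y => .fam Y 0 fun P => .fam Y 0 fun Q => .raw (pi Y fun y => arr (P y) (Q y)) fun k =>
    .raw Y fun y => .raw (Q y) fun e => .imp (isModal (fib (P y) (Q y) (k y) e)) fun _ =>
    .imp (isContr (bang (fib (sig Y P) (sig Y Q) (totalMap Y P Q k) (dpair Y Q y e)))) fun _ =>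
    .concl (isContr (fib (P y) (Q y) (k y) e))
def contrFibOfTotal := contrFibOfTotal.stmt.thm 114 (by dsimp only [Stmt.Use])
def contrFibOfTotal.proof : contrFibOfTotal.stmt.Proof :=
  fun Y P Q k y e m h =>
    let Z := sig Y P
    let W := sig Y Q
    let t := totalMap Y P Q k
    let G z := fib (P (fst Y Q z)) (Q (fst Y Q z)) (k (fst Y Q z)) (snd Y Q z)
    let r : Trm (pi W fun z => arr (fib Z W t z) (G z)) := .lam fun z => .lam fun w =>
      w.fibInd (fun _ => G z) fun x q => q.indL (fun z _ => G z)
        (.fibMk x.snd .rfl : Trm (fib (P (fst Y P x.val)) (Q (fst Y P x.val)) (k (fst Y P x.val))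
          (k (fst Y P x.val) (snd Y P x.val)))).c
    let s e w := (Trm.mk w : Trm (fib (P y) (Q y) (k y) e)).fibInd (fun _ => fib Z W t (dpair Y Q y e)) fun u q =>
        q.indL (fun e _ => fib Z W t (dpair Y Q y e))
          (⟨fibMk Z W t (dpair Y Q y (k y u)) (dpair Y P y u) (rfl W (dpair Y Q y (k y u)))⟩ :
            Trm (fib Z W t (dpair Y Q y (k y u))))
    contrOfRetract m h ((r.app ⟨dpair Y Q y e⟩).c) (.lam fun w => s e w) (.lam fun w =>
      (w.fibInd (fun w => eq (fib (P y) (Q y) (k y) e) (r.val (dpair Y Q y e) (s e w).val) w) fun u q =>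
        q.indL (fun e q => eq (fib (P y) (Q y) (k y) e) (r.val (dpair Y Q y e) (s e (fibMk (P y) (Q y) (k y) e u q)).val)
          (fibMk (P y) (Q y) (k y) e u q)) .rfl).c)

def contrFibOfTotal.context : List Tm :=
  extend contrOfRetract.context 119 [contrFibOfTotal.stmt.decl contrFibOfTotal.proof]

theorem contrFibOfTotal.conservative : Conservative Modality.genericContext contrFibOfTotal.context 115 :=
  contrOfRetract.conservative.extend _ (by decide +kernel)

/-- A fibration between localizations of a type is connected. -/
abbrev connOfFib.stmt : Stmt :=
  .raw (univ 0) fun X => .raw (univ 0) fun Z => .raw (univ 0) fun W => .raw (arr Z W) fun t =>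
    .raw (arr X Z) fun c => .raw (arr X W) fun e =>
    .imp (loc X (bang Z) (lam X fun x => unitMap Z (c x))) fun _ =>
    .imp (loc X (bang W) (lam X fun x => unit W (e x))) fun _ =>
    .imp (pi X fun x => eq W (e x) (t (c x))) fun _ =>
    .imp (isFib Z W t) fun _ => .raw W fun w => .concl (isContr (bang (fib Z W t w)))
def connOfFib := connOfFib.stmt.thm 115 (by dsimp only [Stmt.Use])
def connOfFib.proof : connOfFib.stmt.Proof :=
  fun X Z W t c e lc le H h w =>
    let H : Trm (pi X fun x => eq (bang W) ((Ex.lam X fun x => unit W (e x)) x)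
        ((Ex.lam X fun x => bmap Z W t ((Ex.lam X fun x => unitMap Z (c x)) x)) x)) := .lam fun x =>
      (((H.app x).ap (B := bang W) fun v => unit W v).trans'
        (⟨bnat Z W t (c x)⟩ : Trm (eq (bang W) (bmap Z W t (unit Z (c x))) (unit W (t (c x))))).inv).c
    -- By naturality `!t` carries one localization of `X` to the other, so it is an equivalence. As
    -- `t` is a fibration, `!fib_t(w)` is a fiber of `!t`.
    let γ : Trm (isEquiv (bang (fib Z W t w)) (bangFib Z W t w) (gamma Z W t w)) := h.apps [w]
    (contrOfEquiv' γ ((locCancel lc (locOfHomotopy H le)).fiber ⟨unit W w⟩).c).c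

def connOfFib.context : List Tm :=
  extend contrFibOfTotal.context 120 [connOfFib.stmt.decl connOfFib.proof]

theorem connOfFib.conservative : Conservative Modality.genericContext connOfFib.context 116 :=
  contrFibOfTotal.conservative.extend _ (by decide +kernel)

abbrev totGammaFactor.stmt : Stmt :=
  .raw (univ 0) fun X => .raw (univ 0) fun Y => .raw (arr X Y) fun f => .concl (pi X fun x =>
    eq (etaleMid X Y f) (dpair Y (fun y => bangFib X Y f y) (f x) (delta X Y f (f x) (fibMk X Y f (f x) x (rfl Y (f x)))))
      (Modality.generic.totGamma X Y f (connectedFactor X Y f x)))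
def totGammaFactor := totGammaFactor.stmt.thm 116 (by dsimp only [Stmt.Use])
def totGammaFactor.proof : totGammaFactor.stmt.Proof :=
  fun X Y f => .lam fun x => (((gammaBeta X Y f (f x) (fibMk X Y f (f x) x (rfl Y (f x)))).inv.ap
    (B := etaleMid X Y f) fun v => dpair Y (fun y => bangFib X Y f y) (f x) v)).c

def totGammaFactor.context : List Tm :=
  extend connOfFib.context 121 [totGammaFactor.stmt.decl totGammaFactor.proof]

theorem totGammaFactor.conservative : Conservative Modality.genericContext totGammaFactor.context 117 :=
  connOfFib.conservative.extend _ (by decide +kernel)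

/-- Equivalences are fibrations, which gives one direction. Conversely, both factors out of `X`
become localizations after the units, so `connOfFib` makes `tot(γ)` connected; fibers of `γ` are
modal and hence contractible. -/
abbrev fibIffTotGammaFib.stmt : Stmt :=
  .raw (univ 0) fun X => .raw (univ 0) fun Y => .raw (arr X Y) fun f =>
    .concl (iff (isFib X Y f) (Modality.generic.totGammaIsFibration X Y f))
def fibIffTotGammaFib := fibIffTotGammaFib.stmt.thm 117 (by dsimp only [Stmt.Use])
def fibIffTotGammaFib.proof : fibIffTotGammaFib.stmt.Proof :=
  fun X Y f => iffMk
    (.lam fun h =>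
    let e := sigEquiv (P := fun y => bang (fib X Y f y)) (h.c : Trm (pi Y fun y =>
      isEquiv (bang (fib X Y f y)) (bangFib X Y f y) ((Ex.lam Y fun y => gamma X Y f y) y)))
    (fibOfEquiv (Modality.generic.modalMid X Y f) (Modality.generic.etaleMid X Y f)
      (Modality.generic.totGamma X Y f) e.c).c)
    (.lam fun h =>
    let F y := fib X Y f y
    let Q y := bangFib X Y f y
    let w x := fibMk X Y f (f x) x (rfl Y (f x))
    let W := etaleMid X Y f
    let l : Trm (loc X (bang W) (Ex.lam X fun x => unit W (dpair Y Q (f x) (delta X Y f (f x) (w x))))) :=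
      (equivalenceFactorLoc X Y f (bmap X Y f)
        -- The naturality path is followed by `rfl`, since that is what `δ (x, rfl)` computes to.
        (Ex.lam X fun x => concat (bang Y) (bmap X Y f (unit X x)) (unit Y (f x)) (unit Y (f x))
          (bnat X Y f x) (rfl (bang Y) (unit Y (f x))))).c
    (.lam fun y => .lam fun e => contrFibOfTotal Y (P := fun y => bang (F y)) (Ex.lam Y fun y => gamma X Y f y) y e
        (fibModal (gamma X Y f y) e (bangModal (F y)) (bangFibModal X Y f y)).c
        ((connOfFib X (modalMid X Y f) W (Modality.generic.totGamma X Y f)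
          (connectedFactor X Y f) (Ex.lam X fun x => dpair Y Q (f x) (delta X Y f (f x) (w x))) (connectedFactorLoc X Y f).c l.c
          (totGammaFactor X Y f).c h.c (dpair Y Q y e))).c :
      Trm (pi Y fun y => pi (bangFib X Y f y) fun e =>
        isContr (fib (bang (F y)) (bangFib X Y f y) ((Ex.lam Y fun y => gamma X Y f y) y) e))).c)

def fibIffTotGammaFib.context : List Tm :=
  extend totGammaFactor.context 122 [fibIffTotGammaFib.stmt.decl fibIffTotGammaFib.proof]

theorem fibIffTotGammaFib.conservative : Conservative Modality.genericContext fibIffTotGammaFib.context 118 :=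
  totGammaFactor.conservative.extend _ (by decide +kernel)

/-! ### Fiber sequences and locally constant fibers -/

/-- Induction on the equivalence reduces an arbitrary fiber sequence to the fiber itself, for which
the induced map is `γ`. -/
abbrev fibIffPreservesFibers.stmt : Stmt :=
  .raw (univ 0) fun X => .raw (univ 0) fun Y => .raw (arr X Y) fun f =>
    .concl (iff (isFib X Y f) (Modality.generic.preservesFibers X Y f))
def fibIffPreservesFibers := fibIffPreservesFibers.stmt.thm 118 (by dsimp only [Stmt.Use])
def fibIffPreservesFibers.proof : fibIffPreservesFibers.stmt.Proof :=
  fun X Y f => iffMk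
    (.lam fun h => ⟨Ex.lam Y fun y => Ex.lam (univ 0) fun F => Ex.lam (arr F X) fun j =>
      Ex.lam (pi F fun t => eq Y (f (j t)) y) fun H =>
      Ex.lam (isEquiv F (fib X Y f y) (Modality.fiberGap F X Y j f y H)) fun e =>
        let γ : Trm (isEquiv (bang (fib X Y f y)) (bangFib X Y f y) (gamma X Y f y)) := h.apps [y]
        equivInd' (Ex.lam (univ 0) fun F => Ex.lam (arr F (fib X Y f y)) fun k =>
          isEquiv (bang F) (bangFib X Y f y) (Modality.generic.bangFiberGap F X Y
            (Ex.lam F fun t => fibPt X Y f y (k t)) f y (Ex.lam F fun t => fibPath X Y f y (k t))))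
          γ.c (Trm.mk e : Trm (isEquiv F (fib X Y f y) (Modality.fiberGap F X Y j f y H)))⟩)
    (.lam fun h => (.lam fun y =>
    let F := fib X Y f y
    let j := Ex.lam F fun w => fibPt X Y f y w
    let H := Ex.lam F fun w => fibPath X Y f y w
    let K : Trm (pi F fun w => eq F (idFun F w) (Modality.fiberGap F X Y j f y H w)) := .lam fun w =>
      (w.fibInd (fun w => eq F w (Modality.fiberGap F X Y j f y H w)) fun _ _ => .rfl).c
    h.apps [y, F, j, H, isEquivOfHomotopy K ⟨idIsEquiv F⟩] :
    Trm (pi Y fun y => isEquiv (bang (fib X Y f y)) (bangFib X Y f y) (gamma X Y f y))).c)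

def fibIffPreservesFibers.context : List Tm :=
  extend fibIffTotGammaFib.context 123 [fibIffPreservesFibers.stmt.decl fibIffPreservesFibers.proof]

theorem fibIffPreservesFibers.conservative : Conservative Modality.genericContext fibIffPreservesFibers.context 119 :=
  fibIffTotGammaFib.conservative.extend _ (by decide +kernel)

def modalUniv : Ex := sig (univ 0) fun A => isModal A
def locallyConstantSig (X Y f m : Ex) : Ex :=
  sig (arr (bang Y) modalUniv) fun E => pi Y fun y => eq modalUniv (E (unit Y y))
    (dpair (univ 0) (fun A => isModal A) (bang (fib X Y f y)) (m (fib X Y f y)))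

/-- For a fibration, `E v = fib_{!f}(v)` works by univalence, modality being a proposition.
Conversely, transporting the units of the fibers along the given identifications produces
localizations, and `fibOfFamily` applies. -/
abbrev fibIffLocallyConstant.stmt : Stmt :=
  .raw (univ 0) fun X => .raw (univ 0) fun Y => .raw (arr X Y) fun f =>
    .concl (iff (isFib X Y f) (Modality.generic.locallyConstantFibers X Y f))
def fibIffLocallyConstant := fibIffLocallyConstant.stmt.thm 119 (by dsimp only [Stmt.Use])
def fibIffLocallyConstant.proof : fibIffLocallyConstant.stmt.Proof :=
  fun X Y f => iffMk
    (.lam fun h =>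
    let n := bmap X Y f
    let D v := fib (bang X) (bang Y) n v
    let m : Trm (pi (univ 0) fun A => isModal (bang A)) := .lam fun A => bangModal A
    let k v := fibModal n v (bangModal X) (bangModal Y)
    let E := Ex.lam (bang Y) fun v => dpair (univ 0) (fun A => isModal A) (D v) (k v)
    let p (y : Trm Y) : Trm (eq modalUniv
        (dpair (univ 0) (fun A => isModal A) (D (unit Y y)) (k (unit Y y)))
        (dpair (univ 0) (fun A => isModal A) (bang (fib X Y f y)) (m.val (fib X Y f y)))) :=
      let γ : Trm (isEquiv (bang (fib X Y f y)) (D (unit Y y)) (gamma X Y f y)) := h.apps [y]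
      pairPropEq (P := fun A => isModal A) (.lam fun A => isEquivIsProp (unitMap A))
        (equivPath (bang (fib X Y f y)) γ).inv
    (Trm.pair (P := locallyConstantSig X Y f) m (.c (Trm.pair (P := fun E => pi Y fun y =>
        eq modalUniv (E (unit Y y))
          (dpair (univ 0) (fun A => isModal A) (bang (fib X Y f y)) (m.val (fib X Y f y))))
      (⟨E⟩ : Trm (arr (bang Y) modalUniv)) (.lam fun y => (p y).c)))).c)
    (.lam fun h => fibOfLocDelta f (
    let F y := fib X Y f y
    (h.c : Trm (sig (pi (univ 0) fun A => isModal (bang A)) (locallyConstantSig X Y f))).split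
      (fun _ => locDelta X Y f) fun m w => w.split (fun _ => locDelta X Y f) fun E π =>
        let D z := fst (univ 0) (fun A => isModal A) z
        let v y := dpair (univ 0) (fun A => isModal A) (bang (F y)) (m.val (F y))
        let p (y : Ex) : Trm (eq modalUniv (v y) (E.val (unit Y y))) := (π.app ⟨y⟩).inv
        let t (y z p : Ex) := Ex.lam (F y) fun w =>
          (Trm.transport (A := modalUniv) (x := v y) (y := z) ⟨p⟩ D ⟨unit (F y) w⟩).val
        fibOfFamily (P := fun v => D (E.val v))
          (.lam fun u => ⟨snd (univ 0) (fun A => isModal A) (E.val u)⟩)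
          (Ex.lam Y fun y => t y (E.val (unit Y y)) (p y))
          (.lam fun y => ((p y).indL (fun z p => loc (F y) (D z) (t y z p)) (unitLoc (F y)).c).c)
          (bmap X Y f) (bnat X Y f)))

def fibIffLocallyConstant.context : List Tm :=
  extend fibIffPreservesFibers.context 124 [fibIffLocallyConstant.stmt.decl fibIffLocallyConstant.proof]

theorem fibIffLocallyConstant.conservative : Conservative Modality.genericContext fibIffLocallyConstant.context 120 :=
  fibIffPreservesFibers.conservative.extend _ (by decide +kernel)

/-- `γ` is the only extension of `δ`. -/
abbrev prism.stmt : Stmt :=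
  .raw (univ 0) fun X => .raw (univ 0) fun Y => .raw (arr X Y) fun f =>
    .concl (Modality.generic.prism X Y f)
def prism := prism.stmt.thm 120 (by dsimp only [Stmt.Use])
def prism.proof : prism.stmt.Proof :=
  fun X Y f => (.lam fun y => .pair (.lam fun w => gammaBeta X Y f y w)
      (extContr (bangFibModal X Y f y) (delta X Y f y)) :
    Trm (pi Y fun y => prod
      (pi (fib X Y f y) fun w => eq (bangFib X Y f y) (gamma X Y f y (unit (fib X Y f y) w)) (delta X Y f y w))
      (isContr (sig (arr (bang (fib X Y f y)) (bangFib X Y f y)) fun h =>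
        pi (fib X Y f y) fun w => eq (bangFib X Y f y) (h (unit (fib X Y f y) w)) (delta X Y f y w))))).c

def prism.context : List Tm :=
  extend fibIffLocallyConstant.context 125 [prism.stmt.decl prism.proof]

theorem prism.conservative : Conservative Modality.genericContext prism.context 121 :=
  fibIffLocallyConstant.conservative.extend _ (by decide +kernel)

/-! ### Pullbacks -/

/-- The map `fib_g(b) → fib_{!f}(!y (b^!))` for a square with `x`, `y` and `H`. -/
def pullDelta (A B X Y g x y f H n nn m mm b : Ex) : Ex :=
  lam (fib A B g b) fun w =>
    postFib (bang X) (bang Y) n (unit Y (y b)) (m (unit B b))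
      (inv (bang Y) (m (unit B b)) (unit Y (y b)) (mm b))
      (deltaMap X Y f (bang X) (unitMap X) n nn (y b) (pullFibMap A B X Y g x y f H b w))

/-- This is the localization `δ` of `f` at `y b`, between the equivalence of fibers in a pullback
and a change of base point by naturality. -/
abbrev pullLoc.stmt : Stmt :=
  .raw (univ 0) fun A => .raw (univ 0) fun B => .raw (univ 0) fun X => .raw (univ 0) fun Y =>
    .raw (arr A B) fun g => .raw (arr A X) fun x => .raw (arr B Y) fun y => .raw (arr X Y) fun f =>
    .raw (pi A fun a => eq Y (f (x a)) (y (g a))) fun H =>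
    .raw (arr (bang X) (bang Y)) fun n =>
    .raw (pi X fun x => eq (bang Y) (n (unit X x)) (unit Y (f x))) fun nn =>
    .raw (arr (bang B) (bang Y)) fun m =>
    .raw (pi B fun b => eq (bang Y) (m (unit B b)) (unit Y (y b))) fun mm =>
    .imp (locFibers X Y f (bang X) (unitMap X) n nn) fun _ =>
    .imp (Square.isPullback ⟨A, B, X, Y, g, x, y, f, H⟩) fun _ => .raw B fun b =>
    .concl (loc (fib A B g b) (fib (bang X) (bang Y) n (m (unit B b)))
      (pullDelta A B X Y g x y f H n nn m mm b))
def pullLoc := pullLoc.stmt.thm 121 (by dsimp only [Stmt.Use])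
def pullLoc.proof : pullLoc.stmt.Proof :=
  fun A B X Y g x y f H n nn m mm h e b =>
    let l : Trm (loc (fib X Y f (y b)) (fib (bang X) (bang Y) n (unit Y (y b)))
      (deltaMap X Y f (bang X) (unitMap X) n nn (y b))) := h.apps [y b]
    (locPost (postFibEquiv n
        (⟨inv (bang Y) (m (unit B b)) (unit Y (y b)) (mm b)⟩ : Trm (eq (bang Y) (unit Y (y b)) (m (unit B b)))))
      (locPre (pullFibEquiv A B X Y g x y f H e b) l)).c

def pullLoc.context : List Tm := extend prism.context 126 [pullLoc.stmt.decl pullLoc.proof]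

theorem pullLoc.conservative : Conservative Modality.genericContext pullLoc.context 122 :=
  prism.conservative.extend _ (by decide +kernel)

/-- Apply `fibOfFamily` to the family `v ↦ fib_{!f}(!y v)` over `!B`. -/
abbrev pullbackFib.stmt : Stmt :=
  .raw (univ 0) fun X => .raw (univ 0) fun Y => .raw (arr X Y) fun f =>
    .concl (Modality.generic.pullbacksAreFibrations X Y f)
def pullbackFib := pullbackFib.stmt.thm 122 (by dsimp only [Stmt.Use])
def pullbackFib.proof : pullbackFib.stmt.Proof :=
  fun X Y f => (.lam fun h => ⟨Ex.lam (univ 0) fun A => Ex.lam (univ 0) fun B =>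
      Ex.lam (arr A B) fun g => Ex.lam (arr A X) fun x => Ex.lam (arr B Y) fun y =>
      Ex.lam (pi A fun a => eq Y (f (x a)) (y (g a))) fun H =>
      Ex.lam (Square.isPullback ⟨A, B, X, Y, g, x, y, f, H⟩) fun e =>
        let n := bmap X Y f
        let m := bmap B Y y
        (fibOfLocDelta g (show Trm (locDelta A B g) from fibOfFamily (P := fun v => fib (bang X) (bang Y) n (m v))
          (.lam fun v => fibModal n (m v) (bangModal X) (bangModal Y))
          (Ex.lam B fun b => pullDelta A B X Y g x y f H n (bnat X Y f) m (bnat B Y y) b)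
          (.lam fun b => (pullLoc A B X Y g x y f H n (bnat X Y f) m (bnat B Y y)
            (locDeltaOfFib f h).c ⟨e⟩ b).c)
          (bmap A B g) (bnat A B g)) : Trm (isFib A B g)).val⟩ :
      Trm (arr (isFib X Y f) (Square.forallSquares 0 X Y f fun S =>
        arr S.isPullback (isFib S.A S.B S.g)))).c

def pullbackFib.context : List Tm :=
  extend pullLoc.context 127 [pullbackFib.stmt.decl pullbackFib.proof]

theorem pullbackFib.conservative : Conservative Modality.genericContext pullbackFib.context 123 :=
  pullLoc.conservative.extend _ (by decide +kernel)

abbrev assoc₄.stmt : Stmt :=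
  .type fun A => .all A fun x => .all A fun y => .all A fun z => .all A fun v => .all A fun w =>
    .imp (eq A x y) fun p => .imp (eq A y z) fun q => .imp (eq A z v) fun r => .imp (eq A v w) fun s =>
    .concl (eq (eq A x w) (concat A x y w p (concat A y z w q (concat A z v w r s)))
      (concat A x v w (concat A x z v (concat A x y z p q) r) s))
def assoc₄ := assoc₄.stmt.thm 123 (by dsimp only [Stmt.Use])
def assoc₄.proof : assoc₄.stmt.Proof :=
  fun _ _ _ _ _ _ p q r s => (transAssoc p q (r.trans s)).inv.trans (transAssoc (p.trans q) r s).inv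

def assoc₄.context : List Tm := extend pullbackFib.context 128 [assoc₄.stmt.decl assoc₄.proof]

theorem assoc₄.conservative : Conservative Modality.genericContext assoc₄.context 124 :=
  pullbackFib.conservative.extend _ (by decide +kernel)

/-- Equality of points of a pullback. -/
abbrev pullEq.stmt : Stmt :=
  .small fun B => .small fun X => .small fun Y => .raw (arr B Y) fun m => .raw (arr X Y) fun n =>
    .all B fun u => .all B fun u' => .all X fun z => .all X fun z' =>
    .imp (eq B u u') fun p => .imp (eq X z z') fun q =>
    .imp (eq Y (n z) (m u)) fun r => .imp (eq Y (n z') (m u')) fun s =>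
    .imp (eq (eq Y (n z) (m u)) r (concat Y (n z) (n z') (m u) (ap X Y n z z' q)
      (concat Y (n z') (m u') (m u) s (ap B Y m u' u (inv B u u' p))))) fun _ =>
    .concl (eq (sig B fun v => fib X Y n (m v)) (dpair B (fun v => fib X Y n (m v)) u (fibMk X Y n (m u) z r))
      (dpair B (fun v => fib X Y n (m v)) u' (fibMk X Y n (m u') z' s)))
def pullEq := pullEq.stmt.thm 124 (by dsimp only [Stmt.Use])
def pullEq.proof : pullEq.stmt.Proof :=
  fun B X Y m n u u' z z' p q r s h =>
    let S := sig B fun v => fib X Y n (m v)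
    let k u z r := dpair B (fun v => fib X Y n (m v)) u (fibMk X Y n (m u) z r)
    let G u p z q := pi (eq Y (n z) (m u)) fun r =>
      arr (eq (eq Y (n z) (m u)) r (concat Y (n z) (n z') (m u) (ap X Y n z z' q)
        (concat Y (n z') (m u') (m u) s (ap B Y m u' u (inv B u u' p)))))
      (eq S (k u z r) (k u' z' s))
    (p.indR (fun u p => G u p z q) (q.indR (fun z q => G u' (Ex.rfl B u') z q)
      (.lam fun r => .lam fun h =>
        (((h.c : Trm (eq (eq Y (n z') (m u')) r.val (concat Y (n z') (m u') (m u') s (Ex.rfl Y (m u'))))).trans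
          (transRefl s)).ap (B := S) fun r => k u' z' r).c))).apps [r, h]

def pullEq.context : List Tm := extend assoc₄.context 129 [pullEq.stmt.decl pullEq.proof]

theorem pullEq.conservative : Conservative Modality.genericContext pullEq.context 125 :=
  assoc₄.conservative.extend _ (by decide +kernel)

/-- The images under `!` and their naturality squares are variables here, which keeps the terms
small for the checker. -/
def bangBase (A B X Y g x y f H ng gg nx xx m mm n nn a : Ex) : Ex :=
  let v0 := n (nx (unit A a))
  let v1 := n (unit X (x a))
  let v2 := unit Y (f (x a))
  let v3 := unit Y (y (g a))
  let v4 := m (unit B (g a))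
  let v5 := m (ng (unit A a))
  concat (bang Y) v0 v1 v5 (ap (bang X) (bang Y) n (nx (unit A a)) (unit X (x a)) (xx a)) <|
  concat (bang Y) v1 v2 v5 (nn (x a)) <|
  concat (bang Y) v2 v3 v5 (ap Y (bang Y) (unitMap Y) (f (x a)) (y (g a)) (H a)) <|
  concat (bang Y) v3 v4 v5 (inv (bang Y) v4 v3 (mm (g a))) <|
  ap (bang B) (bang Y) m (unit B (g a)) (ng (unit A a))
    (inv (bang B) (ng (unit A a)) (unit B (g a)) (gg a))

/-- The square of images under `!` of a square with `x`, `y` and `H`. -/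
def bangSquare (A B X Y g x y f H ng gg nx xx m mm n nn : Ex) : Square :=
  ⟨bang A, bang B, bang X, bang Y, ng, nx, m, n,
    Modality.generic.extendPath A Y (lam (bang A) fun u => n (nx u)) (lam (bang A) fun u => m (ng u))
      (lam A fun a => bangBase A B X Y g x y f H ng gg nx xx m mm n nn a)⟩

/-- The components are joined by naturality for `g` and `x`. By `extendPathBeta` the path over `a^!`
is the five-fold concatenation of `bangBase`, which reassociates to what `pullEq` requires. -/
abbrev gapEq.stmt : Stmt :=
  .raw (univ 0) fun A => .raw (univ 0) fun B => .raw (univ 0) fun X => .raw (univ 0) fun Y =>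
    .raw (arr A B) fun g => .raw (arr A X) fun x => .raw (arr B Y) fun y => .raw (arr X Y) fun f =>
    .raw (pi A fun a => eq Y (f (x a)) (y (g a))) fun H =>
    .raw (arr (bang A) (bang B)) fun ng =>
    .raw (pi A fun a => eq (bang B) (ng (unit A a)) (unit B (g a))) fun gg =>
    .raw (arr (bang A) (bang X)) fun nx =>
    .raw (pi A fun a => eq (bang X) (nx (unit A a)) (unit X (x a))) fun xx =>
    .raw (arr (bang B) (bang Y)) fun m =>
    .raw (pi B fun b => eq (bang Y) (m (unit B b)) (unit Y (y b))) fun mm =>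
    .concl (pi (arr (bang X) (bang Y)) fun n =>
      pi (pi X fun x => eq (bang Y) (n (unit X x)) (unit Y (f x))) fun nn =>
      pi A fun a => eq (sig (bang B) fun v => fib (bang X) (bang Y) n (m v))
      ((bangSquare A B X Y g x y f H ng gg nx xx m mm n nn).gap (unit A a))
      (dpair (bang B) (fun v => fib (bang X) (bang Y) n (m v)) (unit B (g a))
        (pullDelta A B X Y g x y f H n nn m mm (g a) (fibMk A B g (g a) a (rfl B (g a))))))
def gapEq := gapEq.stmt.thm 125 (by dsimp only [Stmt.Use])
def gapEq.proof : gapEq.stmt.Proof :=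
  fun A B X Y g x y f H ng gg nx xx m mm => .lam fun ⟨n⟩ => .lam fun ⟨nn⟩ => .lam fun a =>
    let v1 := n (unit X (x a))
    let v2 := unit Y (f (x a))
    let v3 := unit Y (y (g a))
    let v4 := m (unit B (g a))
    let S := bangSquare A B X Y g x y f H ng gg nx xx m mm n nn
    let p : Trm (eq (bang B) (ng (unit A a)) (unit B (g a))) := ⟨gg a⟩
    let q : Trm (eq (bang X) (nx (unit A a)) (unit X (x a))) := ⟨xx a⟩
    let b : Trm (eq (bang Y) v1 v2) := ⟨nn (x a)⟩
    let c : Trm (eq (bang Y) v2 v3) := (⟨H a⟩ : Trm (eq Y (f (x a)) (y (g a)))).ap fun y => unit Y y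
    let d : Trm (eq (bang Y) v3 v4) := (⟨mm (g a)⟩ : Trm (eq (bang Y) v4 v3)).inv
    let e := (p.inv).ap (B := bang Y) fun v => m v
    let r : Trm (eq (bang Y) (n (nx (unit A a))) (m (ng (unit A a)))) := ⟨S.H (unit A a)⟩
    let β := extendPathBeta A Y (Ex.lam (bang A) fun u => n (nx u)) (Ex.lam (bang A) fun u => m (ng u))
      (Ex.lam A fun a => bangBase A B X Y g x y f H ng gg nx xx m mm n nn a) a
    let k := (q.ap (B := bang Y) fun u => n u)
    (pullEq m n p q r ((b.trans c).trans d)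
      (β.trans' ((assoc₄ b c d e).ap (B := eq (bang Y) (n (nx (unit A a))) (m (ng (unit A a))))
        fun t => concat (bang Y) (n (nx (unit A a))) v1 (m (ng (unit A a))) k t)).c).c

def gapEq.context : List Tm := extend pullEq.context 130 [gapEq.stmt.decl gapEq.proof]

theorem gapEq.conservative : Conservative Modality.genericContext gapEq.context 126 :=
  pullEq.conservative.extend _ (by decide +kernel)

/-- By `gapEq` the gap map of the image square extends the map `A → Σ (v : !B), fib_n (m v)` of
`totLoc`. The latter is a localization, so the gap map is an equivalence. -/
abbrev bangPullbackOfLoc.stmt : Stmt :=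
  .raw (univ 0) fun A => .raw (univ 0) fun B => .raw (univ 0) fun X => .raw (univ 0) fun Y =>
    .raw (arr A B) fun g => .raw (arr A X) fun x => .raw (arr B Y) fun y => .raw (arr X Y) fun f =>
    .raw (pi A fun a => eq Y (f (x a)) (y (g a))) fun H =>
    .raw (arr (bang A) (bang B)) fun ng =>
    .raw (pi A fun a => eq (bang B) (ng (unit A a)) (unit B (g a))) fun gg =>
    .raw (arr (bang A) (bang X)) fun nx =>
    .raw (pi A fun a => eq (bang X) (nx (unit A a)) (unit X (x a))) fun xx =>
    .raw (arr (bang B) (bang Y)) fun m =>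
    .raw (pi B fun b => eq (bang Y) (m (unit B b)) (unit Y (y b))) fun mm =>
    .concl (pi (arr (bang X) (bang Y)) fun n =>
      pi (pi X fun x => eq (bang Y) (n (unit X x)) (unit Y (f x))) fun nn =>
      arr (locFibers X Y f (bang X) (unitMap X) n nn)
        (arr (Square.isPullback ⟨A, B, X, Y, g, x, y, f, H⟩)
          (bangSquare A B X Y g x y f H ng gg nx xx m mm n nn).isPullback))
def bangPullbackOfLoc := bangPullbackOfLoc.stmt.thm 126 (by dsimp only [Stmt.Use])
def bangPullbackOfLoc.proof : bangPullbackOfLoc.stmt.Proof :=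
  fun A B X Y g x y f H ng gg nx xx m mm => .lam fun ⟨n⟩ => .lam fun ⟨nn⟩ => .lam fun h => .lam fun e =>
    let S := bangSquare A B X Y g x y f H ng gg nx xx m mm n nn
    let k := Ex.lam A fun a => dpair (bang B) (fun v => fib (bang X) (bang Y) n (m v)) (unit B (g a))
      ((Ex.lam B fun b => pullDelta A B X Y g x y f H n nn m mm b) (g a) (fibMk A B g (g a) a (rfl B (g a))))
    let K : Trm (pi A fun a => eq (sig (bang B) fun v => fib (bang X) (bang Y) n (m v)) (S.gap (unit A a)) (k a)) :=
      (gapEq A B X Y g x y f H ng gg nx xx m mm).apps [n, nn]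
    (isEquivOfLoc S.gap K
      (totLoc g (P := fun v => fib (bang X) (bang Y) n (m v))
        (.lam fun v => fibModal n (m v) (bangModal X) (bangModal Y))
        (Ex.lam B fun b => pullDelta A B X Y g x y f H n nn m mm b)
        (.lam fun b => (pullLoc A B X Y g x y f H n nn m mm h e b).c))).c

def bangPullbackOfLoc.context : List Tm :=
  extend gapEq.context 131 [bangPullbackOfLoc.stmt.decl bangPullbackOfLoc.proof]

theorem bangPullbackOfLoc.conservative : Conservative Modality.genericContext bangPullbackOfLoc.context 127 :=
  gapEq.conservative.extend _ (by decide +kernel)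

/-- A contractible type in place of the point, with `y` as its basic element. -/
def fibBase (Y y : Ex) : Ex := sig Y fun z => eq Y y z
/-- The square that presents the fiber of `f` over `y` as a pullback. -/
def fibSquare (X Y f y : Ex) : Square :=
  ⟨fib X Y f y, fibBase Y y, X, Y,
    lam (fib X Y f y) fun _ => dpair Y (fun z => eq Y y z) y (rfl Y y),
    lam (fib X Y f y) fun w => fibPt X Y f y w,
    lam (fibBase Y y) fun b => fst Y (fun z => eq Y y z) b, f,
    lam (fib X Y f y) fun w => fibPath X Y f y w⟩

abbrev fibSquareIsPullback.stmt : Stmt :=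
  .raw (univ 0) fun X => .raw (univ 0) fun Y => .raw (arr X Y) fun f => .raw Y fun y =>
    .concl (fibSquare X Y f y).isPullback
def fibSquareIsPullback := fibSquareIsPullback.stmt.thm 127 (by dsimp only [Stmt.Use])
def fibSquareIsPullback.proof : fibSquareIsPullback.stmt.Proof :=
  fun X Y f y =>
    let S := fibSquare X Y f y
    let P b := fib X Y f (S.y b)
    let b₀ := dpair Y (fun z => eq Y y z) y (rfl Y y)
    let k w := dpair S.B P b₀ w
    let H : Trm (pi S.A fun w => eq S.pullback ((Ex.lam (P b₀) k) w) (S.gap w)) := .lam fun w =>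
      (w.fibInd (fun w => eq S.pullback (k w) (S.gap w)) fun _ _ => .rfl).c
    isEquivOfHomotopy H (sigContrBase (x := S.B) (P := P) (singletonContr (x := Y) y).c b₀).c

def fibSquareIsPullback.context : List Tm :=
  extend bangPullbackOfLoc.context 132 [fibSquareIsPullback.stmt.decl fibSquareIsPullback.proof]

theorem fibSquareIsPullback.conservative : Conservative Modality.genericContext fibSquareIsPullback.context 128 :=
  bangPullbackOfLoc.conservative.extend _ (by decide +kernel)

/-- The gap map of the image square is an equivalence extending `δ` followed by two equivalences: a
change of base point, and the inclusion of a fiber over the contractible `!(fibBase Y y)`.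
Cancelling them leaves `δ`. -/
abbrev locOfBangPullback.stmt : Stmt :=
  .raw (univ 0) fun X => .raw (univ 0) fun Y => .raw (arr X Y) fun f => .raw Y fun y =>
    .raw (arr (bang (fib X Y f y)) (bang (fibBase Y y))) fun ng =>
    .raw (pi (fib X Y f y) fun a => eq (bang (fibBase Y y)) (ng (unit (fib X Y f y) a))
      (unit (fibBase Y y) ((fibSquare X Y f y).g a))) fun gg =>
    .raw (arr (bang (fib X Y f y)) (bang X)) fun nx =>
    .raw (pi (fib X Y f y) fun a => eq (bang X) (nx (unit (fib X Y f y) a))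
      (unit X ((fibSquare X Y f y).x a))) fun xx =>
    .raw (arr (bang (fibBase Y y)) (bang Y)) fun m =>
    .raw (pi (fibBase Y y) fun b => eq (bang Y) (m (unit (fibBase Y y) b)) (unit Y ((fibSquare X Y f y).y b))) fun mm =>
    .raw (arr (bang X) (bang Y)) fun n =>
    .raw (pi X fun x => eq (bang Y) (n (unit X x)) (unit Y (f x))) fun nn =>
    .imp (bangSquare (fib X Y f y) (fibBase Y y) X Y (fibSquare X Y f y).g (fibSquare X Y f y).x
      (fibSquare X Y f y).y f (fibSquare X Y f y).H ng gg nx xx m mm n nn).isPullback fun _ =>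
    .concl (loc (fib X Y f y) (fib (bang X) (bang Y) n (unit Y y)) (deltaMap X Y f (bang X) (unitMap X) n nn y))
def locOfBangPullback := locOfBangPullback.stmt.thm 128 (by dsimp only [Stmt.Use])
def locOfBangPullback.proof : locOfBangPullback.stmt.Proof :=
  fun X Y f y ng gg nx xx m mm n nn e =>
    let S := fibSquare X Y f y
    let E v := fib (bang X) (bang Y) n (m v)
    let b₀ := dpair Y (fun z => eq Y y z) y (rfl Y y)
    let v₀ := unit S.B b₀
    let T := bangSquare S.A S.B X Y S.g S.x S.y f S.H ng gg nx xx m mm n nn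
    let r : Trm (eq (bang Y) (unit Y y) (m v₀)) := (⟨mm b₀⟩ : Trm (eq (bang Y) (m v₀) (unit Y y))).inv
    let d w := deltaMap X Y f (bang X) (unitMap X) n nn y w
    let l : Trm (loc S.A (sig (bang S.B) E) (Ex.lam S.A fun w =>
        (Ex.lam (E v₀) fun t => dpair (bang S.B) E v₀ t) ((Ex.lam S.A fun w =>
          postFib (bang X) (bang Y) n (unit Y y) (m v₀) r ((Ex.lam S.A d) w)) w))) :=
      Trm.locMk ⟨T.gap⟩ e.c ((gapEq S.A S.B X Y S.g S.x S.y f S.H ng gg nx xx m mm).apps [n, nn])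
    (locPostCancel (postFibEquiv n r) (locPostCancel
      (sigContrBase (P := E) (bangContr (singletonContr (x := Y) y)) v₀) l)).c

def locOfBangPullback.context : List Tm :=
  extend fibSquareIsPullback.context 133 [locOfBangPullback.stmt.decl locOfBangPullback.proof]

theorem locOfBangPullback.conservative : Conservative Modality.genericContext locOfBangPullback.context 129 :=
  fibSquareIsPullback.conservative.extend _ (by decide +kernel)

abbrev fibIffPreservesPullbacks.stmt : Stmt :=
  .raw (univ 0) fun X => .raw (univ 0) fun Y => .raw (arr X Y) fun f =>
    .concl (iff (isFib X Y f) (Modality.generic.preservesPullbacks X Y f))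
def fibIffPreservesPullbacks := fibIffPreservesPullbacks.stmt.thm 129 (by dsimp only [Stmt.Use])
def fibIffPreservesPullbacks.proof : fibIffPreservesPullbacks.stmt.Proof :=
  fun X Y f => iffMk
    (.lam fun h => ⟨Ex.lam (univ 0) fun A => Ex.lam (univ 0) fun B =>
      Ex.lam (arr A B) fun g => Ex.lam (arr A X) fun x => Ex.lam (arr B Y) fun y =>
      Ex.lam (pi A fun a => eq Y (f (x a)) (y (g a))) fun H =>
      Ex.lam (Square.isPullback ⟨A, B, X, Y, g, x, y, f, H⟩) fun e =>
        ((bangPullbackOfLoc A B X Y g x y f H (bmap A B g) (bnat A B g) (bmap A X x) (bnat A X x)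
          (bmap B Y y) (bnat B Y y)).apps [bmap X Y f, bnat X Y f, locDeltaOfFib f h, e] :
          Trm (Square.isPullback (Square.bang .generic ⟨A, B, X, Y, g, x, y, f, H⟩))).val⟩)
    (.lam fun h => fibOfLocDelta f (.lam fun y =>
      let S := fibSquare X Y f y
      locOfBangPullback X Y f y (bmap S.A S.B S.g) (bnat S.A S.B S.g) (bmap S.A X S.x) (bnat S.A X S.x)
        (bmap S.B Y S.y) (bnat S.B Y S.y) (bmap X Y f) (bnat X Y f)
        (h.apps [S.A, S.B, S.g, S.x, S.y, S.H, fibSquareIsPullback X Y f y]) :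
      Trm (pi Y fun y => loc (fib X Y f y) (bangFib X Y f y) (delta X Y f y))).c)

def fibIffPreservesPullbacks.context : List Tm :=
  extend locOfBangPullback.context 134 [fibIffPreservesPullbacks.stmt.decl fibIffPreservesPullbacks.proof]

theorem fibIffPreservesPullbacks.conservative : Conservative Modality.genericContext fibIffPreservesPullbacks.context 130 :=
  locOfBangPullback.conservative.extend _ (by decide +kernel)

/-! ### Composites -/

def compSquare (X Y Z f g n nn n' nn' : Ex) : Ex :=
  lam X fun x => concat (bang Z) (n' (n (unit X x))) (n' (unit Y (f x))) (unit Z (g (f x)))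
    (ap (bang Y) (bang Z) n' (n (unit X x)) (unit Y (f x)) (nn x)) (nn' (f x))

/-- A fiber of the composite is the total space of fibers of `f` over a fiber of `g`, and likewise
for `n` and `n'`. Localizations on base and fibers combine by `totSig`. -/
abbrev compLoc.stmt : Stmt :=
  .raw (univ 0) fun X => .raw (univ 0) fun Y => .raw (univ 0) fun Z => .raw (arr X Y) fun f =>
    .raw (arr Y Z) fun g => .raw (arr (bang X) (bang Y)) fun n =>
    .raw (pi X fun x => eq (bang Y) (n (unit X x)) (unit Y (f x))) fun nn =>
    .raw (arr (bang Y) (bang Z)) fun n' =>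
    .raw (pi Y fun y => eq (bang Z) (n' (unit Y y)) (unit Z (g y))) fun nn' =>
    .imp (locFibers X Y f (bang X) (unitMap X) n nn) fun _ =>
    .imp (locFibers Y Z g (bang Y) (unitMap Y) n' nn') fun _ =>
    .concl (locFibers X Z (lam X fun x => g (f x)) (bang X) (unitMap X) (lam (bang X) fun u => n' (n u))
      (compSquare X Y Z f g n nn n' nn'))
def compLoc := compLoc.stmt.thm 130 (by dsimp only [Stmt.Use])
def compLoc.proof : compLoc.stmt.Proof :=
  fun X Y Z f g n nn n' nn' hf hg =>
    let h := Ex.lam X fun x => g (f x)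
    let k := Ex.lam (bang X) fun u => n' (n u)
    let kk := compSquare X Y Z f g n nn n' nn'
    let D z := fib (bang X) (bang Z) k (unit Z z)
    (.lam fun z =>
      let B := fib Y Z g z
      let B' := fib (bang Y) (bang Z) n' (unit Z z)
      let P v := fib X Y f (fibPt Y Z g z v)
      let E t := fib (bang X) (bang Y) n (fibPt (bang Y) (bang Z) n' (unit Z z) t)
      let b := deltaMap Y Z g (bang Y) (unitMap Y) n' nn' z
      let q := Ex.lam B fun v => deltaMap X Y f (bang X) (unitMap X) n nn (fibPt Y Z g z v)
      let lb : Trm (loc B B' b) := hg.apps [z]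
      let m : Trm (pi B' fun t => isModal (E t)) := .lam fun t =>
        (fibModal n (fibPt (bang Y) (bang Z) n' (unit Z z) t) (bangModal X) (bangModal Y)).c
      let t := Ex.lam (sig B P) fun w => dpair B' E (b (fst B P w)) (q (fst B P w) (snd B P w))
      let l : Trm (loc (sig B P) (sig B' E) t) := totSig lb m q (.lam fun v => hf.apps [fibPt Y Z g z v])
      let c := compFibMap (bang X) (bang Y) (bang Z) n n' (unit Z z)
      let r := fibCompMap X Y Z f g z
      let s w := (Ex.lam (sig B P) fun w => c (t w)) (r w)
      let H : Trm (pi (fib X Z h z) fun w => eq (D z) ((Ex.lam (fib X Z h z) s) w)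
          (deltaMap X Z h (bang X) (unitMap X) k kk z w)) := .lam fun w =>
        (w.fibInd (fun w => eq (D z) (s w) (deltaMap X Z h (bang X) (unitMap X) k kk z w)) fun x p =>
          let a : Trm (eq (bang Y) (n (unit X x)) (unit Y (f x))) := ⟨nn x⟩
          let a' : Trm (eq (bang Z) (n' (unit Y (f x))) (unit Z (g (f x)))) := ⟨nn' (f x)⟩
          let p' : Trm (eq (bang Z) (unit Z (g (f x))) (unit Z z)) := (p.ap (B := bang Z) fun z => unit Z z).c
          let e (a : Ex) := Ex.ap (bang Y) (bang Z) n' (n (unit X x)) (unit Y (f x)) a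
          let d (a : Ex) := Ex.concat (bang Z) (n' (n (unit X x))) (n' (unit Y (f x))) (unit Z z) (e a)
            (Ex.concat (bang Z) (n' (unit Y (f x))) (unit Z (g (f x))) (unit Z z) a' p')
          -- On a canonical point the two maps differ by a concatenation with `rfl` inside `ap n'`
          -- and by an associativity.
          let j : Trm (eq (eq (bang Z) (n' (n (unit X x))) (unit Z z)) (d (a.trans .rfl).val)
              (Ex.concat (bang Z) (n' (n (unit X x))) (unit Z (g (f x))) (unit Z z) (kk x) p')) :=
            ((transRefl a).ap (B := eq (bang Z) (n' (n (unit X x))) (unit Z z)) d).trans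
              (transAssoc (⟨e a⟩ : Trm (eq (bang Z) (n' (n (unit X x))) (n' (unit Y (f x))))) a' p').inv.c
          (j.ap (B := D z) fun p => Ex.fibMk (bang X) (bang Z) k (unit Z z) (unit X x) p).c).c
      locOfHomotopy H (locPre (fibCompEquiv X Y Z f g z)
        (locPost (compFibEquiv (bang X) (bang Y) (bang Z) n n' (unit Z z)) l)) :
    Trm (pi Z fun z => loc (fib X Z h z) (D z) (deltaMap X Z h (bang X) (unitMap X) k kk z))).c

def compLoc.context : List Tm :=
  extend fibIffPreservesPullbacks.context 135 [compLoc.stmt.decl compLoc.proof]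

theorem compLoc.conservative : Conservative Modality.genericContext compLoc.context 131 :=
  fibIffPreservesPullbacks.conservative.extend _ (by decide +kernel)

abbrev compositeFib.stmt : Stmt :=
  .raw (univ 0) fun X => .raw (univ 0) fun Y => .raw (arr X Y) fun f =>
    .concl (Modality.generic.compositesAreFibrations X Y f)
def compositeFib := compositeFib.stmt.thm 131 (by dsimp only [Stmt.Use])
def compositeFib.proof : compositeFib.stmt.Proof :=
  fun X Y f => ⟨Ex.lam (univ 0) fun Z => Ex.lam (arr Y Z) fun g =>
    Ex.lam (isFib X Y f) fun hf => Ex.lam (isFib Y Z g) fun hg =>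
      let h := Ex.lam X fun x => g (f x)
      -- `compLoc` speaks about `!g ∘ !f`; invariance passes to `!(g ∘ f)`.
      (fibOfLocDelta h (show Trm (locDelta X Z h) from locFibersInvariance (unitLoc X)
        (compLoc X Y Z f g (bmap X Y f) (bnat X Y f) (bmap Y Z g) (bnat Y Z g)
          (locDeltaOfFib f ⟨hf⟩ : Trm (locDelta X Y f)) (locDeltaOfFib g ⟨hg⟩ : Trm (locDelta Y Z g)))
        (bmap X Z h) (bnat X Z h))).val⟩

def compositeFib.context : List Tm :=
  extend compLoc.context 136 [compositeFib.stmt.decl compositeFib.proof]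

theorem compositeFib.conservative : Conservative Modality.genericContext compositeFib.context 132 :=
  compLoc.conservative.extend _ (by decide +kernel)

/-! ### Maps between fibers of units -/

abbrev connPost.stmt : Stmt :=
  .small fun A => .small fun T => .small fun S => .all (arr A T) fun m => .all (arr T S) fun h =>
    .imp (isEquiv T S h) fun _ => .imp (conn A T m) fun _ => .concl (conn A S (lam A fun a => h (m a)))
def connPost := connPost.stmt.thm 132 (by dsimp only [Stmt.Use])
def connPost.proof : connPost.stmt.Proof :=
  fun A T S m h e c => (equivInd (Ex.lam (univ 0) fun S => Ex.lam (arr T S) fun h =>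
    conn A S (Ex.lam A fun a => h (m a))) c.c e).c

def connPost.context : List Tm :=
  extend compositeFib.context 137 [connPost.stmt.decl connPost.proof]

theorem connPost.conservative : Conservative Modality.genericContext connPost.context 133 :=
  compositeFib.conservative.extend _ (by decide +kernel)

abbrev connPostCancel.stmt : Stmt :=
  .small fun A => .small fun T => .small fun S => .all (arr A T) fun m => .all (arr T S) fun h =>
    .imp (isEquiv T S h) fun _ => .imp (conn A S (lam A fun a => h (m a))) fun _ => .concl (conn A T m)
def connPostCancel := connPostCancel.stmt.thm 133 (by dsimp only [Stmt.Use])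
def connPostCancel.proof : connPostCancel.stmt.Proof :=
  fun A T S m h e c =>
    let d : Trm (arr (conn A T (Ex.lam A fun a => idFun T (m a))) (conn A T m)) := .lam fun c => c.c
    (equivInd (Ex.lam (univ 0) fun S => Ex.lam (arr T S) fun h =>
      arr (conn A S (Ex.lam A fun a => h (m a))) (conn A T m)) d.c e).apps [c]

def connPostCancel.context : List Tm :=
  extend connPost.context 138 [connPostCancel.stmt.decl connPostCancel.proof]

theorem connPostCancel.conservative : Conservative Modality.genericContext connPostCancel.context 134 :=
  connPost.conservative.extend _ (by decide +kernel)

abbrev connOfHomotopy.stmt : Stmt :=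
  .small fun A => .small fun T => .all (arr A T) fun m => .all (arr A T) fun m' =>
    .imp (pi A fun a => eq T (m a) (m' a)) fun _ => .imp (conn A T m) fun _ => .concl (conn A T m')
def connOfHomotopy := connOfHomotopy.stmt.thm 134 (by dsimp only [Stmt.Use])
def connOfHomotopy.proof : connOfHomotopy.stmt.Proof :=
  fun A T m m' H c => (funExt H : Trm (eq (arr A T) m m')).transport (fun m => conn A T m) c

def connOfHomotopy.context : List Tm :=
  extend connPostCancel.context 139 [connOfHomotopy.stmt.decl connOfHomotopy.proof]

theorem connOfHomotopy.conservative : Conservative Modality.genericContext connOfHomotopy.context 135 :=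
  connPostCancel.conservative.extend _ (by decide +kernel)

def swapMap (A B Q : Ex) : Ex :=
  (lam (univ 0) fun A => lam (univ 0) fun B => lam (arr A (arr B (univ 0))) fun Q =>
    lam (sig A fun a => sig B fun b => Q a b) fun w =>
      ((Trm.mk w : Trm (sig A fun a => sig B fun b => Q a b)).split
        (fun _ => sig B fun b => sig A fun a => Q a b) fun a v =>
        v.split (fun _ => sig B fun b => sig A fun a => Q a b) fun b q =>
          ⟨dpair B (fun b => sig A fun a => Q a b) b (dpair A (fun a => Q a b) a q)⟩).val) A B Q

abbrev swapSwap.stmt : Stmt :=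
  .raw (univ 0) fun A => .raw (univ 0) fun B => .raw (arr A (arr B (univ 0))) fun Q =>
    .concl (pi (sig A fun a => sig B fun b => Q a b) fun w => eq (sig A fun a => sig B fun b => Q a b)
      (swapMap B A (lam B fun b => lam A fun a => Q a b) (swapMap A B Q w)) w)
def swapSwap := swapSwap.stmt.thm 135 (by dsimp only [Stmt.Use])
def swapSwap.proof : swapSwap.stmt.Proof :=
  fun A B Q =>
    let P a := sig B fun b => Q a b
    let E w := eq (sig A P) (swapMap B A (Ex.lam B fun b => Ex.lam A fun a => Q a b) (swapMap A B Q w)) w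
    .lam fun w => w.split E fun a v => v.split (fun v => E (dpair A P a v)) fun _ _ => .rfl

def swapSwap.context : List Tm :=
  extend connOfHomotopy.context 140 [swapSwap.stmt.decl swapSwap.proof]

theorem swapSwap.conservative : Conservative Modality.genericContext swapSwap.context 136 :=
  connOfHomotopy.conservative.extend _ (by decide +kernel)

abbrev swapEquiv.stmt : Stmt :=
  .raw (univ 0) fun A => .raw (univ 0) fun B => .raw (arr A (arr B (univ 0))) fun Q =>
    .concl (isEquiv (sig A fun a => sig B fun b => Q a b) (sig B fun b => sig A fun a => Q a b) (swapMap A B Q))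
def swapEquiv := swapEquiv.stmt.thm 136 (by dsimp only [Stmt.Use])
def swapEquiv.proof : swapEquiv.stmt.Proof :=
  fun A B Q =>
    let Q' := Ex.lam B fun b => Ex.lam A fun a => Q a b
    isEquivMk ⟨swapMap B A Q'⟩ (swapSwap A B Q) (swapSwap B A Q').c

def swapEquiv.context : List Tm := extend swapSwap.context 141 [swapEquiv.stmt.decl swapEquiv.proof]

theorem swapEquiv.conservative : Conservative Modality.genericContext swapEquiv.context 137 :=
  swapSwap.conservative.extend _ (by decide +kernel)

/-- The map `(a, s) ↦ (a, s⁻¹ · t)`. -/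
def flipMap (A B f x y t : Ex) : Ex :=
  lam (sig A fun a => eq B x (f a)) fun w =>
    let a := fst A (fun a => eq B x (f a)) w
    fibMk A B f y a (concat B (f a) x y (inv B x (f a) (snd A (fun a => eq B x (f a)) w)) t)

abbrev flipEquiv.stmt : Stmt :=
  .raw (univ 0) fun A => .small fun B => .raw (arr A B) fun f => .all B fun x => .all B fun y =>
    .imp (eq B x y) fun t => .concl (isEquiv (sig A fun a => eq B x (f a)) (fib A B f y) (flipMap A B f x y t))
def flipEquiv := flipEquiv.stmt.thm 137 (by dsimp only [Stmt.Use])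
def flipEquiv.proof : flipEquiv.stmt.Proof :=
  fun A B f x y t =>
    let Q a := eq B x (f a)
    let k := flipMap A B f x x (Ex.rfl B x)
    let l w : Ex := dpair A Q (fibPt A B f x w) (Ex.inv B (f (fibPt A B f x w)) x (fibPath A B f x w))
    let d : Trm (isEquiv (sig A Q) (fib A B f x) k) := isEquivMk (.lam fun w => ⟨l w⟩)
      (.lam fun w => (w.split (fun w => eq (sig A Q) (l (k w)) w) fun a s =>
        ((s.ind (fun x z s => eq (eq B x z) (Ex.inv B z x (Ex.concat B z x x (Ex.inv B x z s) (Ex.rfl B x))) s)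
          (fun _ => .rfl)).ap (B := sig A Q) fun s => dpair A Q a s).c).c)
      (.lam fun w => (w.fibInd (fun w => eq (fib A B f x) (k (l w)) w) fun a s =>
        ((s.ind (fun z x s => eq (eq B z x) (Ex.concat B z x x (Ex.inv B x z (Ex.inv B z x s)) (Ex.rfl B x)) s)
          (fun _ => .rfl)).ap (B := fib A B f x) fun s => Ex.fibMk A B f x a s).c).c)
    t.indL (fun y t => isEquiv (sig A Q) (fib A B f y) (flipMap A B f x y t)) d

def flipEquiv.context : List Tm :=
  extend swapEquiv.context 142 [flipEquiv.stmt.decl flipEquiv.proof]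

theorem flipEquiv.conservative : Conservative Modality.genericContext flipEquiv.context 138 :=
  swapEquiv.conservative.extend _ (by decide +kernel)

abbrev invTransTrans.stmt : Stmt :=
  .type fun A => .all A fun x => .all A fun y => .all A fun z => .all A fun w =>
    .imp (eq A x y) fun p => .imp (eq A x z) fun q => .imp (eq A y w) fun t =>
    .concl (eq (eq A z w) (concat A z y w (inv A y z (concat A y x z (inv A x y p) q)) t)
      (concat A z x w (inv A x z q) (concat A x y w p t)))
def invTransTrans := invTransTrans.stmt.thm 138 (by dsimp only [Stmt.Use])
def invTransTrans.proof : invTransTrans.stmt.Proof :=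
  fun A x y z w p q t => (p.indL (fun y p => pi (eq A y w) fun t =>
    eq (eq A z w) (concat A z y w (inv A y z (concat A y x z (inv A x y p) q)) t)
      (concat A z x w (inv A x z q) (concat A x y w p t))) (.lam fun _ => .rfl)).apps [t]

def invTransTrans.context : List Tm :=
  extend flipEquiv.context 143 [invTransTrans.stmt.decl invTransTrans.proof]

theorem invTransTrans.conservative : Conservative Modality.genericContext invTransTrans.context 139 :=
  flipEquiv.conservative.extend _ (by decide +kernel)

def unitFibBase (X Y n u : Ex) : Ex := sig Y fun y => eq (bang Y) (n u) (unit Y y)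
/-- The map from the fiber of the unit over `u : !X` to the type of `y : Y` with `!f u = y^!`. -/
def unitFibTot (X Y f n nn u : Ex) : Ex :=
  lamSquare (fun X Y f T m n nn => lam T fun u => lam (fib X T m u) fun w =>
    let x := fibPt X T m u w
    dpair Y (fun y => eq (bang Y) (n u) (unit Y y)) (f x)
      (concat (bang Y) (n u) (n (m x)) (unit Y (f x))
        (inv (bang Y) (n (m x)) (n u) (ap T (bang Y) n (m x) u (fibPath X T m u w))) (nn x)))
    X Y f (bang X) (unitMap X) n nn u
/-- The map between fibers of units that a square induces. -/
def unitFibMap (X Y f n nn y x p : Ex) : Ex :=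
  lamSquare (fun X Y f T m n nn => lam Y fun y => lam X fun x => lam (eq Y (f x) y) fun p =>
    lam (fib X T m (m x)) fun w =>
      let x' := fibPt X T m (m x) w
      let v0 := unit Y (f x')
      let v1 := n (m x')
      let v2 := n (m x)
      let v3 := unit Y (f x)
      let v4 := unit Y y
      fibMk Y (bang Y) (unitMap Y) v4 (f x') <|
        concat (bang Y) v0 v1 v4 (inv (bang Y) v1 v0 (nn x')) <|
        concat (bang Y) v1 v2 v4 (ap T (bang Y) n (m x') (m x) (fibPath X T m (m x) w)) <|
        concat (bang Y) v2 v3 v4 (nn x) (ap Y (bang Y) (unitMap Y) (f x) y p))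
    X Y f (bang X) (unitMap X) n nn y x p

/-- The map between fibers of units is `unitFibTot` followed by the equivalence that inverts a path
and appends `nn x · ap (-)^! p`; the coherence is `invTransTrans`. -/
abbrev unitFibMapConn.stmt : Stmt :=
  .raw (univ 0) fun X => .raw (univ 0) fun Y => .raw (arr X Y) fun f => .raw (arr (bang X) (bang Y)) fun n =>
    .raw (pi X fun x => eq (bang Y) (n (unit X x)) (unit Y (f x))) fun nn => .raw Y fun y => .raw X fun x =>
    .imp (eq Y (f x) y) fun p =>
    .concl (iff (conn (fib X (bang X) (unitMap X) (unit X x)) (unitFibBase X Y n (unit X x)) (unitFibTot X Y f n nn (unit X x)))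
      (conn (fib X (bang X) (unitMap X) (unit X x)) (fib Y (bang Y) (unitMap Y) (unit Y y)) (unitFibMap X Y f n nn y x p)))
def unitFibMapConn := unitFibMapConn.stmt.thm 139 (by dsimp only [Stmt.Use])
def unitFibMapConn.proof : unitFibMapConn.stmt.Proof :=
  fun X Y f n nn y x p =>
    let F := fib X (bang X) (unitMap X) (unit X x)
    let G := fib Y (bang Y) (unitMap Y) (unit Y y)
    let R := unitFibBase X Y n (unit X x)
    let d := unitFibTot X Y f n nn (unit X x)
    let t : Trm (eq (bang Y) (n (unit X x)) (unit Y y)) :=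
      (⟨nn x⟩ : Trm (eq (bang Y) (n (unit X x)) (unit Y (f x)))).trans (p.ap fun y => unit Y y)
    let k := flipMap Y (bang Y) (unitMap Y) (n (unit X x)) (unit Y y) t
    let K : Trm (isEquiv R G k) := (flipEquiv Y (unitMap Y) t).c
    let H : Trm (pi F fun w => eq G ((Ex.lam F fun w => k (d w)) w) (unitFibMap X Y f n nn y x p w)) := .lam fun w =>
      (((invTransTrans (w.path.ap (B := bang Y) fun u => n u)
        (⟨nn w.pt⟩ : Trm (eq (bang Y) (n (unit X w.pt)) (unit Y (f w.pt)))) t).ap (B := G)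
        fun s => fibMk Y (bang Y) (unitMap Y) (unit Y y) (f w.pt) s)).c
    let H' : Trm (pi F fun w => eq G (unitFibMap X Y f n nn y x p w) ((Ex.lam F fun w => k (d w)) w)) :=
      .lam fun w => (H.app w).inv
    iffMk (.lam fun c => connOfHomotopy H (connPost K c)) (.lam fun c => connPostCancel K (connOfHomotopy H' c))

def unitFibMapConn.context : List Tm :=
  extend invTransTrans.context 144 [unitFibMapConn.stmt.decl unitFibMapConn.proof]

theorem unitFibMapConn.conservative : Conservative Modality.genericContext unitFibMapConn.context 140 :=
  invTransTrans.conservative.extend _ (by decide +kernel)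

abbrev connIffOfTriangle.stmt : Stmt :=
  .small fun A => .small fun T => .small fun S => .all (arr A T) fun m => .all (arr A S) fun m' =>
    .all (arr T S) fun h => .imp (isEquiv T S h) fun _ => .imp (pi A fun a => eq S (h (m a)) (m' a)) fun _ =>
    .concl (iff (conn A T m) (conn A S m'))
def connIffOfTriangle := connIffOfTriangle.stmt.thm 140 (by dsimp only [Stmt.Use])
def connIffOfTriangle.proof : connIffOfTriangle.stmt.Proof :=
  fun A T S m m' h e H =>
    let H₁ : Trm (pi A fun a => eq S ((Ex.lam A fun a => h (m a)) a) (m' a)) := H.c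
    let H₂ : Trm (pi A fun a => eq S (m' a) ((Ex.lam A fun a => h (m a)) a)) := .lam fun a => (H₁.app a).inv
    iffMk (.lam fun c => connOfHomotopy H₁ (connPost e c)) (.lam fun c => connPostCancel e (connOfHomotopy H₂ c))

def connIffOfTriangle.context : List Tm :=
  extend unitFibMapConn.context 145 [connIffOfTriangle.stmt.decl connIffOfTriangle.proof]

theorem connIffOfTriangle.conservative : Conservative Modality.genericContext connIffOfTriangle.context 141 :=
  unitFibMapConn.conservative.extend _ (by decide +kernel)

/-- Exchanging the two Σ-types turns `Σ (y : Y), fib_n(y^!)` into a Σ-type over `!X`. The map from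
`X` becomes the total map along the unit of `X`, so it is connected exactly if its fiberwise parts
are. -/
abbrev connIffUnitFibTot.stmt : Stmt :=
  .raw (univ 0) fun X => .raw (univ 0) fun Y => .raw (arr X Y) fun f => .raw (arr (bang X) (bang Y)) fun n =>
    .raw (pi X fun x => eq (bang Y) (n (unit X x)) (unit Y (f x))) fun nn =>
    .concl (iff (conn X (sig Y fun y => fib (bang X) (bang Y) n (unit Y y))
        (totMap X Y f (fun y => fib (bang X) (bang Y) n (unit Y y))
          (lam Y fun y => deltaMap X Y f (bang X) (unitMap X) n nn y)))
      (pi (bang X) fun u => conn (fib X (bang X) (unitMap X) u) (unitFibBase X Y n u) (unitFibTot X Y f n nn u)))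
def connIffUnitFibTot := connIffUnitFibTot.stmt.thm 141 (by dsimp only [Stmt.Use])
def connIffUnitFibTot.proof : connIffUnitFibTot.stmt.Proof :=
  fun X Y f n nn =>
    let F y := fib (bang X) (bang Y) n (unit Y y)
    let e := totMap X Y f F (Ex.lam Y fun y => deltaMap X Y f (bang X) (unitMap X) n nn y)
    let R u := unitFibBase X Y n u
    let D := Ex.lam (bang X) fun u => unitFibTot X Y f n nn u
    let V := sig (bang X) R
    let e' := totMap X (bang X) (unitMap X) R D
    let Q := Ex.lam Y fun y => Ex.lam (bang X) fun u => eq (bang Y) (n u) (unit Y y)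
    let k := swapMap Y (bang X) Q
    let σ : Trm (isEquiv (sig Y F) V k) := (swapEquiv Y (bang X) Q).c
    let H : Trm (pi X fun x => eq V (k (e x)) (e' x)) := .lam fun x =>
      ((transRefl (⟨nn x⟩ : Trm (eq (bang Y) (n (unit X x)) (unit Y (f x))))).ap (B := V) fun s =>
        dpair (bang X) R (unit X x) (dpair Y (fun y => eq (bang Y) (n (unit X x)) (unit Y y)) (f x) s)).c
    (iffTrans (connIffOfTriangle σ H) (iffMk (.lam fun c => connOfTot X (bang X) (unitMap X) (P := R) D c)
      (.lam fun d => connTot X (bang X) (unitMap X) (P := R) D d))).c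

def connIffUnitFibTot.context : List Tm :=
  extend connIffOfTriangle.context 146 [connIffUnitFibTot.stmt.decl connIffUnitFibTot.proof]

theorem connIffUnitFibTot.conservative : Conservative Modality.genericContext connIffUnitFibTot.context 142 :=
  connIffOfTriangle.conservative.extend _ (by decide +kernel)

def unitFibsConn (X Y f n nn : Ex) : Ex := pi Y fun y => pi (fib X Y f y) fun w =>
  conn (fib X (bang X) (unitMap X) (unit X (fibPt X Y f y w))) (fib Y (bang Y) (unitMap Y) (unit Y y))
    (unitFibMap X Y f n nn y (fibPt X Y f y w) (fibPath X Y f y w))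

/-- Contractibility of types `!C` is a modal condition, so it holds for all `u : !X` once it does at
`u = x^!`; there one takes `y = f x` and the path `rfl`. -/
abbrev unitFibTotIffUnitFibs.stmt : Stmt :=
  .raw (univ 0) fun X => .raw (univ 0) fun Y => .raw (arr X Y) fun f => .raw (arr (bang X) (bang Y)) fun n =>
    .raw (pi X fun x => eq (bang Y) (n (unit X x)) (unit Y (f x))) fun nn =>
    .concl (iff
      (pi (bang X) fun u => conn (fib X (bang X) (unitMap X) u) (unitFibBase X Y n u) (unitFibTot X Y f n nn u))
      (unitFibsConn X Y f n nn))
def unitFibTotIffUnitFibs := unitFibTotIffUnitFibs.stmt.thm 142 (by dsimp only [Stmt.Use])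
def unitFibTotIffUnitFibs.proof : unitFibTotIffUnitFibs.stmt.Proof :=
  fun X Y f n nn =>
    let T u := conn (fib X (bang X) (unitMap X) u) (unitFibBase X Y n u) (unitFibTot X Y f n nn u)
    let S y x p := conn (fib X (bang X) (unitMap X) (unit X x)) (fib Y (bang Y) (unitMap Y) (unit Y y))
      (unitFibMap X Y f n nn y x p)
    iffMk (.lam fun d => (.lam fun y => .lam fun w => iffMp (unitFibMapConn X Y f n nn y w.pt w.path)
          (⟨d.val (unit X w.pt)⟩ : Trm (T (unit X w.pt))) :
        Trm (pi Y fun y => pi (fib X Y f y) fun w => S y (fibPt X Y f y w) (fibPath X Y f y w))).c)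
      (.lam fun h => modalElim (P := T)
        (.lam fun u => modalPi (.lam fun _ => isContrModal (bangModal _)))
        (.lam fun x => (iffMpr (unitFibMapConn X Y f n nn (f x) x .rfl)
          (h.apps [f x, fibMk X Y f (f x) x (rfl Y (f x))] : Trm (S (f x) x (rfl Y (f x)))).c).c))

def unitFibTotIffUnitFibs.context : List Tm :=
  extend connIffUnitFibTot.context 147 [unitFibTotIffUnitFibs.stmt.decl unitFibTotIffUnitFibs.proof]

theorem unitFibTotIffUnitFibs.conservative : Conservative Modality.genericContext unitFibTotIffUnitFibs.context 143 :=
  connIffUnitFibTot.conservative.extend _ (by decide +kernel)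

abbrev fibIffUnitFibersConn.stmt : Stmt :=
  .raw (univ 0) fun X => .raw (univ 0) fun Y => .raw (arr X Y) fun f =>
    .imp (isSurj X Y f) fun _ => .concl (iff (isFib X Y f) (Modality.generic.unitFiberMapsConnected X Y f))
def fibIffUnitFibersConn := fibIffUnitFibersConn.stmt.thm 143 (by dsimp only [Stmt.Use])
def fibIffUnitFibersConn.proof : fibIffUnitFibersConn.stmt.Proof :=
  fun X Y f _ => iffTrans (fibIffEquivalenceFactorConn X Y f)
    (iffTrans (connIffUnitFibTot X Y f (bmap X Y f) (bnat X Y f))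
      (unitFibTotIffUnitFibs X Y f (bmap X Y f) (bnat X Y f))).c

def fibIffUnitFibersConn.context : List Tm :=
  extend unitFibTotIffUnitFibs.context 148 [fibIffUnitFibersConn.stmt.decl fibIffUnitFibersConn.proof]

theorem fibIffUnitFibersConn.conservative : Conservative Modality.genericContext fibIffUnitFibersConn.context 144 :=
  unitFibTotIffUnitFibs.conservative.extend _ (by decide +kernel)

end HoTT.Internal

/-! ### The theorem in every universe -/

theorem mainTheorem1 (i : ℕ) :
    HoTT.Modality.HoldsForAllMaps i (fun M X Y f => M.prism X Y f) ∧
    HoTT.Modality.HoldsForAllMaps i (fun M X Y f =>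
      HoTT.Ex.iff (M.isFibration X Y f) (M.preservesFibers X Y f)) ∧
    HoTT.Modality.HoldsForAllMaps i (fun M X Y f =>
      HoTT.Ex.iff (M.isFibration X Y f) (M.preservesPullbacks X Y f)) ∧
    HoTT.Modality.HoldsForAllMaps i (fun M X Y f =>
      HoTT.Ex.iff (M.isFibration X Y f) (M.factorizationsAgree X Y f)) ∧
    HoTT.Modality.HoldsForAllMaps i (fun M X Y f =>
      HoTT.Ex.iff (M.isFibration X Y f) (M.modalFactorIsEtale X Y f)) ∧
    HoTT.Modality.HoldsForAllMaps i (fun M X Y f =>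
      HoTT.Ex.iff (M.isFibration X Y f) (M.equivalenceFactorIsConnected X Y f)) ∧
    HoTT.Modality.HoldsForAllMaps i (fun M X Y f =>
      HoTT.Ex.iff (M.isFibration X Y f) (M.totGammaIsFibration X Y f)) ∧
    HoTT.Modality.HoldsForAllMaps i (fun M X Y f =>
      HoTT.Ex.iff (M.isFibration X Y f) (M.locallyConstantFibers X Y f)) ∧
    HoTT.Modality.HoldsForAllMaps i (fun M X Y f =>
      HoTT.Ex.arr (HoTT.Ex.isSurj X Y f)
        (HoTT.Ex.iff (M.isFibration X Y f) (M.unitFiberMapsConnected X Y f))) ∧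
    HoTT.Modality.HoldsForAllMaps i (fun M X Y f => M.pullbacksAreFibrations X Y f) ∧
    HoTT.Modality.HoldsForAllMaps i (fun M X Y f => M.compositesAreFibrations X Y f) := by
  refine ⟨?_, ?_, ?_, ?_, ?_, ?_, ?_, ?_, ?_, ?_, ?_⟩
  -- The index 0 is the lemma added last in the respective context; `rfl` verifies that the
  -- statement is uniform in the universe.
  · exact HoTT.Modality.holdsForAllMaps_of_test HoTT.Internal.prism.conservative 0 (by decide +kernel) rfl
  · exact HoTT.Modality.holdsForAllMaps_of_test HoTT.Internal.fibIffPreservesFibers.conservative 0 (by decide +kernel) rfl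
  · exact HoTT.Modality.holdsForAllMaps_of_test HoTT.Internal.fibIffPreservesPullbacks.conservative 0 (by decide +kernel) rfl
  · exact HoTT.Modality.holdsForAllMaps_of_test HoTT.Internal.fibIffFactorizationsAgree.conservative 0 (by decide +kernel) rfl
  · exact HoTT.Modality.holdsForAllMaps_of_test HoTT.Internal.fibIffModalFactorEtale.conservative 0 (by decide +kernel) rfl
  · exact HoTT.Modality.holdsForAllMaps_of_test HoTT.Internal.fibIffEquivalenceFactorConn.conservative 0 (by decide +kernel) rfl
  · exact HoTT.Modality.holdsForAllMaps_of_test HoTT.Internal.fibIffTotGammaFib.conservative 0 (by decide +kernel) rfl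
  · exact HoTT.Modality.holdsForAllMaps_of_test HoTT.Internal.fibIffLocallyConstant.conservative 0 (by decide +kernel) rfl
  · exact HoTT.Modality.holdsForAllMaps_of_test HoTT.Internal.fibIffUnitFibersConn.conservative 0 (by decide +kernel) rfl
  · exact HoTT.Modality.holdsForAllMaps_of_test HoTT.Internal.pullbackFib.conservative 0 (by decide +kernel) rfl
  · exact HoTT.Modality.holdsForAllMaps_of_test HoTT.Internal.compositeFib.conservative 0 (by decide +kernel) rfl
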